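/- **Setting.** Let $d\in\mathbb N$, $m>0$, let $V,\Phi\in C^2(\mathbb R^d;\mathbb R)$ with $\Phi(-q)=\Phi(q)$, and write $x=(q,p)\in\mathbb R^{2d}$ and $(\Phi*\rho)(q)=\int\Phi(q-q')\,\rho(q',p')\,dq'dp'$. *Generator.* Let $\mathcal G:D\to C_b(\mathbb R^d)$, $D\subseteq C_b(\mathbb R^d)$, be a linear Markov (pre-)generator acting on functions of the momentum: $1\in D$, $\mathcal G1=0$, and $\mathcal Gf(p)\ge 0$ whenever $f\in D$ has a global minimum at $p$. It acts on functions of $(q,p)$ with $q$ frozen. Let $\mathcal A\subseteq C_b^2(\mathbb R^{2d})$ be a linear space of test functions such that: $\mathcal A$ contains $C^2_c(\mathbb R^{2d})$ and all $C_b^2$ functions of $q$ alone; $\varphi(f_1,\dots,f_l)\in\mathcal A$ for $f_i\in\mathcal A$, $\varphi\in C^2(\mathbb R^l)$; and for $f\in\mathcal A$ one has $f(q,\cdot)\in D$ for all $q$ and $\mathcal Gf\in C_b(\mathbb R^{2d})$. *Energy and entropy.* For densities $\rho$ set $$E(\rho)=\int\Big(\frac{|p|^2}{2m}+V+\tfrac12\Phi*\rho\Big)\rho,\quad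 dE(\rho)=\frac{|p|^2}{2m}+V+\Phi*\rho,\quad S(\rho)=\int\rho\log\rho+E(\rho),\quad dS(\rho)=\log\rho+1+dE(\rho),$$ $w_\rho=1+\frac{|p|^2}{2m}+|V|+|\Phi|*\rho$ and $L(\rho)\xi=\operatorname{div}(\rho J\nabla\xi)=-\operatorname{div}_q(\rho\nabla_p\xi)+\operatorname{div}_p(\rho\nabla_q\xi)$. *State space.* $T^*_\rho Z$ is the space of $\xi\in C^2(\mathbb R^{2d})$ such that, for some $C$, $|\xi|\le Cw_\rho$ and $|\nabla\xi|\le C(1+|\nabla dE(\rho)|)$. $T_\rho Z$ is the space of integrable $v$ with $\int v=0$ and $\int w_\rho|v|<\infty$. The pairing is $\langle v,\xi\rangle=\int v\xi$. For a function $\zeta$ on $\mathbb R^{2d}$ let $\zeta^0(q,p)=\zeta(q,p)-\zeta(q,0)$. $Z$ is the set of probability densities $\rho\in C^2(\mathbb R^{2d})$, $\rho>0$, such that $\Phi(q-\cdot)$ and its first two derivatives are $\rho$-integrably dominated, locally uniformly in $q$; $\int w_\rho^2(1+|\nabla dE(\rho)|)^2\rho<\infty$; $dS(\rho)\in T^*_\rho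 Z$; and $dS(\rho)^0\in\mathcal A$. *Dynamics.* $\mathcal G^*(\rho)\in T_\rho Z$ is determined by $\int f\,\mathcal G^*(\rho)=\int(\mathcal Gf)\rho$ for $f\in\mathcal A$, and $$\mathbf F(\rho)=-\operatorname{div}_q\Big(\rho\frac pm\Big)+\operatorname{div}_p\big(\rho\nabla V+\rho(\nabla\Phi*\rho)\big)+\mathcal G^*(\rho).$$ **Condition.** $\mathcal G$ acts on the momentum only, as above, and 1. $\mathcal G$ is reversible with respect to $\rho_m(dp)=(2\pi m)^{-d/2}e^{-|p|^2/2m}dp$: $\int f\,\mathcal Gg\,d\rho_m=\int g\,\mathcal Gf\,d\rho_m$ for $f,g\in D$; 2. with $\eta_n(y)=\frac1n\sum_i\delta_{y_i}$ and $(G_nF)(\eta_n(y))=\sum_{i=1}^n\big(\mathcal G\,[p\mapsto F(\eta_n(y_1,\dots,(q_i,p),\dots,y_n))]\big)(p_i)$, where $y_i=(q_i,p_i)$, there is a function $\mathcal H_2$ such that for every $\rho\in Z$ and every cylinder functional $F(\mu)=\varphi(\int f_1d\mu,\dots,\int f_l d\mu)$ ($f_i\in\mathcal A$, $\varphi\in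 C^2(\mathbb R^l)$), $\frac1n e^{-nF}G_ne^{nF}$ converges to $\mathcal H_2(\rho,dF(\rho))$ along every sequence of $n$-point empirical measures converging weakly to $\rho$. Here $dF(\rho)=\sum_i\partial_i\varphi(\int f_1\rho,\dots,\int f_l\rho)\,f_i$. **Potentials.** Let $C_\rho=\{\xi\in T_\rho^*Z:\xi^0\in\mathcal A\}$; the functional $\mathcal H_2(\rho,\cdot)$ does not see functions of $q$ and is extended by $\mathcal H_2(\rho,\zeta)=\mathcal H_2(\rho,\zeta^0)$. For $\xi\in C_\rho$ put $\psi_\rho(\xi)=\mathcal H_2(\rho,\xi+\tfrac12dS(\rho))-\mathcal H_2(\rho,\tfrac12dS(\rho))$, and let $$\Psi(\rho,v)=\sup_{\xi\in C_\rho}\{\langle v,\xi\rangle-\psi_\rho(\xi)\}\ (v\in T_\rho Z),\qquad \Psi^*(\rho,\xi)=\sup_{v\in T_\rho Z}\{\langle v,\xi\rangle-\Psi(\rho,v)\}\ (\xi\in T^*_\rho Z).$$ **GENERIC.** On $\bar Z=Z\times\mathbb R$, with $T_{(\rho,e)}\bar Z=T_\rho Z\times\mathbb R$ and $T^*_{(\rho,e)}\bar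 Z=T^*_\rho Z\times\mathbb R$, a vector field $\bar{\mathbf F}$ is GENERIC for $\bar S,\bar E,(\bar\Psi,\bar\Psi^*),\bar L$ if: - $\bar S,\bar E$ have functional derivatives $d\bar S(z),d\bar E(z)\in T_z^*\bar Z$, tested along lines in directions $(b\rho,s)$ with $b\in C_c^\infty(\mathbb R^{2d})$, $\int b\rho=0$, $s\in\mathbb R$, along which the functionals are $C^1$ near $z$; - $\bar\Psi,\bar\Psi^*$ are $[0,\infty]$-valued, convex, even, zero at zero and Legendre transforms of each other; - $\bar L(z):T^*_z\bar Z\to T_z\bar Z$ is linear and antisymmetric, and the bracket $\{F,G\}=\langle dF,\bar L\,dG\rangle$ satisfies the Jacobi identity on the functionals $\varphi(\int f_1\rho,\dots,\int f_l\rho,e)$ with $f_i\in C_c^\infty(\mathbb R^{2d})$ and $\varphi$ smooth; - $\bar L(z)\,d\bar S(z)=0$ and $\bar\Psi^*(z,\zeta+\alpha\,d\bar E(z))=\bar\Psi^*(z,\zeta)$ for all $\zeta\in T_z^*\bar Z$, $\alpha\in\mathbb R$; - $\bar\Psi\big(z,\bar{\mathbf F}-\bar L\,d\bar E\big)+\bar\Psi^*\big(z,-\tfrac12d\bar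 S\big)+\tfrac12\langle\bar{\mathbf F},d\bar S\rangle=0$ for all $z\in\bar Z$. **Corollary 5.5.** Assume the Condition. Then $\mathcal G^*(\rho)$ exists for all $\rho\in Z$, $\Psi^*(\rho,\cdot)=\psi_\rho$ on $C_\rho$, and $$\bar{\mathbf F}(\rho,e)=\big(\mathbf F(\rho),\,-\langle dE(\rho),\mathbf F(\rho)\rangle\big)$$ is GENERIC for $\bar E(\rho,e)=E(\rho)+e$, $\bar S(\rho,e)=S(\rho)-(E(\rho)+e)$, $\bar L(\rho,e)(\xi,r)=(L(\rho)\xi,0)$, $\bar\Psi^*((\rho,e),(\xi,r))=\Psi^*(\rho,\xi-r\,dE(\rho))$ and $\bar\Psi$ the Legendre transform of $\bar\Psi^*$. If moreover $\mathcal Gf=-\gamma\langle\frac pm,\nabla f\rangle+\gamma\Delta f$ with $\gamma>0$ and $D\subseteq C^2$ (Vlasov–Fokker–Planck), this is the quadratic GENERIC structure of Duong, Peletier and Zimmer: $\bar S(\rho,e)=\int\rho\log\rho-e$; for all $(\xi,r)\in T^*_\rho Z\times\mathbb R$, $$\bar\Psi^*((\rho,e),(\xi,r))=\gamma\int\Big|\nabla_p\xi-r\frac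 pm\Big|^2\rho ;$$ with $$\bar M(\rho,e)(\xi,r)=2\gamma\begin{pmatrix}-\operatorname{div}_p(\rho\nabla_p\xi)+r\operatorname{div}_p(\rho\frac pm)\\ -\int\langle\frac pm,\nabla_p\xi\rangle\rho+r\int|\frac pm|^2\rho\end{pmatrix}$$ one has $\bar\Psi^*((\rho,e),(\xi,r))=\tfrac12\langle\bar M(\xi,r),(\xi,r)\rangle$ for $\xi\in C_\rho$; and $\bar{\mathbf F}=\bar L\,d\bar E-\tfrac12\bar M\,d\bar S$ (densities being identified almost everywhere), whose energy component is $\dot e=\gamma\int|\frac pm|^2\rho-\gamma\frac dm$. -/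

import Mathlib

open MeasureTheory Filter Topology
open scoped ContDiff BoundedContinuousFunction

noncomputable section

namespace Underdamped

/-- Position space, and momentum space, of one particle. -/
abbrev P (d : ℕ) : Type := EuclideanSpace ℝ (Fin d)

/-- Phase space of one particle: pairs (position, momentum). -/
abbrev X (d : ℕ) : Type := P d × P d

/-- Points, tangent vectors and cotangent vectors of the extended state space all have two
components: a function on phase space and a real number. A point is (density, heat-bath energy),
a tangent vector is (signed density, rate of change of the energy), a cotangent vector is
(function on phase space, number). -/
abbrev ExtSpace (d : ℕ) : Type := (X d → ℝ) × ℝ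

variable {d : ℕ}

/-! ### Differential operators in position and momentum -/

def gradQ (f : X d → ℝ) (x : X d) : P d := gradient (fun q => f (q, x.2)) x.1

def gradP (f : X d → ℝ) (x : X d) : P d := gradient (fun p => f (x.1, p)) x.2

def divQ (u : X d → P d) (x : X d) : ℝ :=
  ∑ i, fderiv ℝ (fun q => u (q, x.2)) x.1 (EuclideanSpace.single i 1) i

def divP (u : X d → P d) (x : X d) : ℝ :=
  ∑ i, fderiv ℝ (fun p => u (x.1, p)) x.2 (EuclideanSpace.single i 1) i

/-- `L(ρ) ξ = div (ρ J ∇ξ)` with `J = [[0, -1], [1, 0]]`, that is `J ∇ξ = (-∇_p ξ, ∇_q ξ)`. -/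
def poisson (ρ ξ : X d → ℝ) (x : X d) : ℝ :=
  -divQ (fun y => ρ y • gradP ξ y) x + divP (fun y => ρ y • gradQ ξ y) x

/-- The duality pairing of a tangent vector `v` with a cotangent vector `ξ`. -/
def pair (v ξ : X d → ℝ) : ℝ := ∫ x, ξ x * v x

def pairExt (v ξ : ExtSpace d) : ℝ := pair v.1 ξ.1 + v.2 * ξ.2

/-! ### GENERIC -/

/-- A set of points (density, energy) with a tangent and a cotangent space at each of them. -/
structure StateSpace (d : ℕ) where
  points : Set (ExtSpace d)
  tan : ExtSpace d → Submodule ℝ (ExtSpace d)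
  cot : ExtSpace d → Submodule ℝ (ExtSpace d)

/-- `ζ` is the functional derivative of `F` at `z = (ρ, e)`: along each line in a direction
`(b ρ, s)`, where `b` is a smooth compactly supported function and `b ρ` has mass zero, `F` is
`C¹` near `z` with derivative `⟨(b ρ, s), ζ⟩` at `z`. -/
def HasDifferential (F : ExtSpace d → ℝ) (z ζ : ExtSpace d) : Prop :=
  ∀ b : X d → ℝ, ContDiff ℝ ∞ b → HasCompactSupport b → ∫ x, b x * z.1 x = 0 → ∀ s : ℝ,
    ContDiffAt ℝ 1 (fun t : ℝ => F (z + t • ((fun x => b x * z.1 x), s))) 0 ∧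
    HasDerivAt (fun t : ℝ => F (z + t • ((fun x => b x * z.1 x), s)))
      (pairExt ((fun x => b x * z.1 x), s) ζ) 0

/-- Smooth functionals `(ρ, e) ↦ φ(∫ f₁ ρ, …, ∫ f_l ρ, e)`. -/
structure SmoothFunctional (d : ℕ) where
  l : ℕ
  f : Fin l → X d → ℝ
  f_smooth : ∀ i, ContDiff ℝ ∞ (f i)
  f_compact : ∀ i, HasCompactSupport (f i)
  φ : (Fin l → ℝ) × ℝ → ℝ
  φ_smooth : ContDiff ℝ ∞ φ

namespace SmoothFunctional

def arg (F : SmoothFunctional d) (z : ExtSpace d) : (Fin F.l → ℝ) × ℝ :=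
  (fun i => ∫ x, F.f i x * z.1 x, z.2)

def value (F : SmoothFunctional d) (z : ExtSpace d) : ℝ := F.φ (F.arg z)

def diff (F : SmoothFunctional d) (z : ExtSpace d) : ExtSpace d :=
  (fun x => ∑ i, fderiv ℝ F.φ (F.arg z) (Pi.single i 1, 0) * F.f i x,
    fderiv ℝ F.φ (F.arg z) (0, 1))

end SmoothFunctional

/-- `{F, G} = ⟨dF, L dG⟩`. -/
def bracket (L : ExtSpace d → ExtSpace d → ExtSpace d) (F G : SmoothFunctional d) (z : ExtSpace d) : ℝ :=
  pairExt (L z (G.diff z)) (F.diff z)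

/-- The bracket of two smooth functionals is differentiable, and
`{{F₁, F₂}, F₃} + {{F₃, F₁}, F₂} + {{F₂, F₃}, F₁} = 0`. -/
def JacobiIdentity (M : StateSpace d) (L : ExtSpace d → ExtSpace d → ExtSpace d) : Prop :=
  ∀ F₁ F₂ F₃ : SmoothFunctional d, ∀ z ∈ M.points, ∃ D₁₂ ∈ M.cot z, ∃ D₃₁ ∈ M.cot z,
    ∃ D₂₃ ∈ M.cot z,
      HasDifferential (bracket L F₁ F₂) z D₁₂ ∧
      HasDifferential (bracket L F₃ F₁) z D₃₁ ∧
      HasDifferential (bracket L F₂ F₃) z D₂₃ ∧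
      pairExt (L z (F₃.diff z)) D₁₂ + pairExt (L z (F₂.diff z)) D₃₁ +
        pairExt (L z (F₁.diff z)) D₂₃ = 0

/-- Symmetric dissipation potentials: `[0, ∞]`-valued convex functions that vanish at zero, are
even, and are Legendre transforms of each other. (Strict convexity is not required: it is
incompatible with the invariance `Ψ*(z, ξ + α dE(z)) = Ψ*(z, ξ)` of a GENERIC system.) -/
structure IsSymmetricDissipationPair (M : StateSpace d) (Ψ Ψs : ExtSpace d → ExtSpace d → EReal) :
    Prop where
  nonneg : ∀ z ∈ M.points, ∀ v ∈ M.tan z, 0 ≤ Ψ z v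
  nonneg_dual : ∀ z ∈ M.points, ∀ ξ ∈ M.cot z, 0 ≤ Ψs z ξ
  zero : ∀ z ∈ M.points, Ψ z 0 = 0
  zero_dual : ∀ z ∈ M.points, Ψs z 0 = 0
  legendre : ∀ z ∈ M.points, ∀ v ∈ M.tan z,
    Ψ z v = ⨆ ξ ∈ M.cot z, (pairExt v ξ : EReal) - Ψs z ξ
  legendre_dual : ∀ z ∈ M.points, ∀ ξ ∈ M.cot z,
    Ψs z ξ = ⨆ v ∈ M.tan z, (pairExt v ξ : EReal) - Ψ z v
  convex : ∀ z ∈ M.points, ∀ v ∈ M.tan z, ∀ w ∈ M.tan z, ∀ a b : ℝ, 0 ≤ a → 0 ≤ b → a + b = 1 →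
    Ψ z (a • v + b • w) ≤ (a : EReal) * Ψ z v + (b : EReal) * Ψ z w
  convex_dual : ∀ z ∈ M.points, ∀ ξ ∈ M.cot z, ∀ η ∈ M.cot z, ∀ a b : ℝ,
    0 ≤ a → 0 ≤ b → a + b = 1 →
    Ψs z (a • ξ + b • η) ≤ (a : EReal) * Ψs z ξ + (b : EReal) * Ψs z η
  symm : ∀ z ∈ M.points, ∀ v ∈ M.tan z, Ψ z (-v) = Ψ z v
  symm_dual : ∀ z ∈ M.points, ∀ ξ ∈ M.cot z, Ψs z (-ξ) = Ψs z ξ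

/-- The flow `ż = F(z)` is GENERIC for the entropy `S` and the energy `E` (with differentials `dS`
and `dE`), the dissipation potentials `(Ψ, Ψs)` and the operators `L`. -/
structure IsGENERIC (M : StateSpace d) (S E : ExtSpace d → ℝ) (dS dE : ExtSpace d → ExtSpace d)
    (Ψ Ψs : ExtSpace d → ExtSpace d → EReal) (L : ExtSpace d → ExtSpace d → ExtSpace d) (F : ExtSpace d → ExtSpace d) : Prop where
  dS_mem : ∀ z ∈ M.points, dS z ∈ M.cot z
  dE_mem : ∀ z ∈ M.points, dE z ∈ M.cot z
  hasDifferential_S : ∀ z ∈ M.points, HasDifferential S z (dS z)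
  hasDifferential_E : ∀ z ∈ M.points, HasDifferential E z (dE z)
  F_mem : ∀ z ∈ M.points, F z ∈ M.tan z
  potentials : IsSymmetricDissipationPair M Ψ Ψs
  L_mem : ∀ z ∈ M.points, ∀ ξ ∈ M.cot z, L z ξ ∈ M.tan z
  L_linear : ∀ z ∈ M.points, ∀ ξ ∈ M.cot z, ∀ η ∈ M.cot z, ∀ a : ℝ,
    L z (a • ξ + η) = a • L z ξ + L z η
  L_antisymm : ∀ z ∈ M.points, ∀ ξ ∈ M.cot z, ∀ η ∈ M.cot z,
    pairExt (L z ξ) η = -pairExt (L z η) ξ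
  jacobi : JacobiIdentity M L
  degenerate_S : ∀ z ∈ M.points, L z (dS z) = 0
  degenerate_E : ∀ z ∈ M.points, ∀ ξ ∈ M.cot z, ∀ α : ℝ, Ψs z (ξ + α • dE z) = Ψs z ξ
  equation : ∀ z ∈ M.points,
    Ψ z (F z - L z (dE z)) + Ψs z (-(1 / 2 : ℝ) • dS z) +
      ((1 / 2 * pairExt (F z) (dS z) : ℝ) : EReal) = 0

/-! ### The model -/

/-- The data of the underdamped dynamics: mass, external potential, interaction potential, the
operator `𝒢 ⊆ C_b × C_b` on functions of the momentum alone, and the test functions on phase space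
from which cylinder functionals are formed. -/
structure Model (d : ℕ) where
  mass : ℝ
  V : P d → ℝ
  Φ : P d → ℝ
  gen : (P d →ᵇ ℝ) →ₗ.[ℝ] (P d →ᵇ ℝ)
  test : Submodule ℝ (X d → ℝ)

/-- The value of the operator on a function of the momentum (zero outside of the domain). -/
def applyGen (G : (P d →ᵇ ℝ) →ₗ.[ℝ] (P d →ᵇ ℝ)) (g : P d → ℝ) (p : P d) : ℝ :=
  open Classical in
  if h : ∃ f : G.domain, ((f : P d →ᵇ ℝ) : P d → ℝ) = g then G h.choose p else 0

/-- The operator on functions on phase space, acting on the momentum with the position frozen. -/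
def liftGen (G : (P d →ᵇ ℝ) →ₗ.[ℝ] (P d →ᵇ ℝ)) (f : X d → ℝ) (x : X d) : ℝ :=
  applyGen G (fun p => f (x.1, p)) x.2

/-- The centered Gaussian measure with density `(2πm)^(-d/2) exp(-|p|²/2m)`. -/
def maxwellian (d : ℕ) (m : ℝ) : Measure (P d) :=
  volume.withDensity fun p =>
    ENNReal.ofReal ((2 * Real.pi * m) ^ (-(d : ℝ) / 2) * Real.exp (-‖p‖ ^ 2 / (2 * m)))

/-- The measure with density `ρ`. -/
def law (ρ : X d → ℝ) : Measure (X d) := volume.withDensity fun x => ENNReal.ofReal (ρ x)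

/-- `C²` functions that are bounded together with their first and second derivatives. -/
def IsCb2 {A : Type*} [NormedAddCommGroup A] [NormedSpace ℝ A] (f : A → ℝ) : Prop :=
  ContDiff ℝ 2 f ∧ ∃ C, ∀ k ≤ 2, ∀ x, ‖iteratedFDeriv ℝ k f x‖ ≤ C

/-! ### The interacting particles -/

/-- The empirical measure of `n` particles. -/
def empirical {n : ℕ} (y : Fin n → X d) : Measure (X d) :=
  (n : ENNReal)⁻¹ • ∑ i, Measure.dirac (y i)

/-- The generator of `n` particles whose momenta evolve independently according to `G`. -/
def particleGen (G : (P d →ᵇ ℝ) →ₗ.[ℝ] (P d →ᵇ ℝ)) {n : ℕ} (u : (Fin n → X d) → ℝ)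
    (y : Fin n → X d) : ℝ :=
  ∑ i, applyGen G (fun p => u (Function.update y i ((y i).1, p))) (y i).2

/-- `n⁻¹ exp(-n F) (G_n exp(n F))`, evaluated at the empirical measure of `y`. -/
def preHamiltonian (G : (P d →ᵇ ℝ) →ₗ.[ℝ] (P d →ᵇ ℝ)) (F : Measure (X d) → ℝ) {n : ℕ}
    (y : Fin n → X d) : ℝ :=
  (n : ℝ)⁻¹ * Real.exp (-(n * F (empirical y))) *
    particleGen G (fun y' => Real.exp (n * F (empirical y'))) y

/-- The cylinder functional `μ ↦ φ(∫ f₁ dμ, …, ∫ f_l dμ)`. -/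
def cylinder {l : ℕ} (f : Fin l → X d → ℝ) (φ : (Fin l → ℝ) → ℝ) (μ : Measure (X d)) : ℝ :=
  φ fun i => ∫ x, f i x ∂μ

/-- The functional derivative `∑ᵢ ∂ᵢφ(∫ f₁ dμ, …, ∫ f_l dμ) fᵢ` of a cylinder functional. -/
def cylinderDeriv {l : ℕ} (f : Fin l → X d → ℝ) (φ : (Fin l → ℝ) → ℝ) (μ : Measure (X d))
    (x : X d) : ℝ :=
  ∑ i, fderiv ℝ φ (fun j => ∫ x', f j x' ∂μ) (Pi.single i 1) * f i x

/-- `ζ(q, p) - ζ(q, 0)`. An operator that acts on the momentum only does not see the function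
`ζ(q, 0)` of the position that is removed. -/
def momentumPart (ζ : X d → ℝ) (x : X d) : ℝ := ζ x - ζ (x.1, 0)

namespace Model

variable (M : Model d)

/-! ### Energy, entropy, and the state space -/

/-- `(Φ ∗ ρ)(q) = ∫ Φ(q - q') ρ(q', p') dq' dp'`. -/
def conv (ρ : X d → ℝ) (q : P d) : ℝ := ∫ x, M.Φ (q - x.1) * ρ x

def energy (ρ : X d → ℝ) : ℝ :=
  ∫ x, (‖x.2‖ ^ 2 / (2 * M.mass) + M.V x.1 + 1 / 2 * M.conv ρ x.1) * ρ x

def entropy (ρ : X d → ℝ) : ℝ := (∫ x, Real.log (ρ x) * ρ x) + M.energy ρ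

def dEnergy (ρ : X d → ℝ) (x : X d) : ℝ :=
  ‖x.2‖ ^ 2 / (2 * M.mass) + M.V x.1 + M.conv ρ x.1

def dEntropy (ρ : X d → ℝ) (x : X d) : ℝ := Real.log (ρ x) + 1 + M.dEnergy ρ x

/-- `1 + |p|²/2m + |V(q)| + (|Φ| ∗ ρ)(q)`. -/
def weight (ρ : X d → ℝ) (x : X d) : ℝ :=
  1 + ‖x.2‖ ^ 2 / (2 * M.mass) + |M.V x.1| + ∫ y, |M.Φ (x.1 - y.1)| * ρ y

/-- Cotangent vectors at `ρ`: `C²` functions that grow at most like the energy, with gradients that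
grow at most like that of the energy. -/
def IsCotangent (ρ ξ : X d → ℝ) : Prop :=
  ContDiff ℝ 2 ξ ∧ ∃ C : ℝ, ∀ x, |ξ x| ≤ C * M.weight ρ x ∧
    ‖fderiv ℝ ξ x‖ ≤ C * (1 + ‖fderiv ℝ (M.dEnergy ρ) x‖)

/-- Tangent vectors at `ρ`: signed densities of mass zero with finite energy moment. -/
def IsTangent (ρ v : X d → ℝ) : Prop :=
  Integrable v ∧ Integrable (fun x => M.weight ρ x * v x) ∧ ∫ x, v x = 0

def cot (ρ : X d → ℝ) : Submodule ℝ (X d → ℝ) where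
  carrier := {ξ | M.IsCotangent ρ ξ}
  zero_mem' := ⟨contDiff_const, 0, fun x => by simp [Pi.zero_def]⟩
  add_mem' := by
    rintro ξ η ⟨hξ, C, hC⟩ ⟨hη, D, hD⟩
    refine ⟨hξ.add hη, C + D, fun x => ⟨?_, ?_⟩⟩
    · rw [add_mul]
      exact (abs_add_le _ _).trans (add_le_add (hC x).1 (hD x).1)
    · rw [fderiv_add (hξ.differentiable (by norm_num) x) (hη.differentiable (by norm_num) x),
        add_mul]
      exact (norm_add_le _ _).trans (add_le_add (hC x).2 (hD x).2)
  smul_mem' := by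
    rintro a ξ ⟨hξ, C, hC⟩
    refine ⟨contDiff_const.smul hξ, |a| * C, fun x => ⟨?_, ?_⟩⟩
    · rw [Pi.smul_apply, smul_eq_mul, abs_mul, mul_assoc]
      exact mul_le_mul_of_nonneg_left (hC x).1 (abs_nonneg a)
    · rw [fderiv_const_smul (hξ.differentiable (by norm_num) x), norm_smul, Real.norm_eq_abs,
        mul_assoc]
      exact mul_le_mul_of_nonneg_left (hC x).2 (abs_nonneg a)

def tan (ρ : X d → ℝ) : Submodule ℝ (X d → ℝ) where
  carrier := {v | M.IsTangent ρ v}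
  zero_mem' := ⟨integrable_zero _ _ _, by simp, by simp⟩
  add_mem' := by
    rintro v w ⟨hv, hv', hv0⟩ ⟨hw, hw', hw0⟩
    refine ⟨hv.add hw, ?_, ?_⟩
    · refine (hv'.add hw').congr (Eventually.of_forall fun x => ?_)
      simp only [Pi.add_apply, mul_add]
    · simp only [Pi.add_apply]
      rw [integral_add hv hw, hv0, hw0, add_zero]
  smul_mem' := by
    rintro a v ⟨hv, hv', hv0⟩
    refine ⟨hv.smul a, ?_, ?_⟩
    · simpa only [Pi.smul_apply, smul_eq_mul, mul_left_comm] using hv'.const_mul a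
    · simp only [Pi.smul_apply, smul_eq_mul]
      rw [integral_const_mul, hv0, mul_zero]

/-- The densities `ρ` of the state space. -/
structure IsState (ρ : X d → ℝ) : Prop where
  smooth : ContDiff ℝ 2 ρ
  pos : ∀ x, 0 < ρ x
  integrable : Integrable ρ
  integral_eq_one : ∫ x, ρ x = 1
  /-- Up to its second derivatives, `Φ(q - ·)` is `ρ`-integrable, locally uniformly in `q`. -/
  interaction : ∀ R : ℝ, ∃ B : P d → ℝ, Integrable (fun x : X d => B x.1 * ρ x) ∧
    ∀ q q' : P d, ‖q‖ ≤ R → ∀ k ≤ 2, ‖iteratedFDeriv ℝ k M.Φ (q - q')‖ ≤ B q'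
  moments : Integrable fun x =>
    M.weight ρ x ^ 2 * (1 + ‖fderiv ℝ (M.dEnergy ρ) x‖) ^ 2 * ρ x
  /-- The covector `dS(ρ) = log ρ + 1 + dE(ρ)` is a cotangent vector. -/
  dEntropy_mem : M.IsCotangent ρ (M.dEntropy ρ)
  /-- Up to a function of the position, `dS(ρ)` is a test function. -/
  dEntropy_test : momentumPart (M.dEntropy ρ) ∈ M.test

/-! ### The dynamics -/

/-- `g` is a density of `𝒢*(ρ)`: `∫ f g = ∫ (𝒢 f) ρ` for all test functions `f`. -/
def IsAdjointImage (ρ g : X d → ℝ) : Prop :=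
  M.IsTangent ρ g ∧ ∀ f ∈ M.test, ∫ x, f x * g x = ∫ x, liftGen M.gen f x * ρ x

/-- The density of `𝒢*(ρ)` (zero if there is none). -/
def adjointGen (ρ : X d → ℝ) : X d → ℝ :=
  open Classical in if h : ∃ g, M.IsAdjointImage ρ g then h.choose else 0

/-- `F(ρ) = -div_q(ρ p/m) + div_p(ρ ∇V + ρ (∇Φ ∗ ρ)) + 𝒢*(ρ)`. -/
def drift (ρ : X d → ℝ) (x : X d) : ℝ :=
  -divQ (fun y => ρ y • (M.mass⁻¹ • y.2)) x +
    divP (fun y => ρ y • gradient M.V y.1 +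
      ρ y • ∫ y', ρ y' • gradient M.Φ (y.1 - y'.1)) x +
    M.adjointGen ρ x

/-! ### The condition -/

/-- The standing assumptions, the properties of the operator `𝒢` (a Markov generator that acts on
the momentum only and is reversible with respect to the Gaussian), and the existence of the limiting
Hamiltonian `𝓗₂` for all cylinder functionals. -/
structure Condition (H₂ : (X d → ℝ) → (X d → ℝ) → ℝ) : Prop where
  mass_pos : 0 < M.mass
  V_smooth : ContDiff ℝ 2 M.V
  Φ_smooth : ContDiff ℝ 2 M.Φ
  Φ_even : ∀ q, M.Φ (-q) = M.Φ q
  /-- `𝒢` is a Markov generator: constants are in its kernel and it satisfies the positive maximum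
  principle. -/
  gen_const : ∃ f : M.gen.domain, (∀ p, (f : P d →ᵇ ℝ) p = 1) ∧ ∀ p, M.gen f p = 0
  gen_min : ∀ f : M.gen.domain, ∀ p, (∀ p', (f : P d →ᵇ ℝ) p ≤ (f : P d →ᵇ ℝ) p') →
    0 ≤ M.gen f p
  gen_reversible : ∀ f g : M.gen.domain,
    ∫ p, (f : P d →ᵇ ℝ) p * M.gen g p ∂(maxwellian d M.mass) =
      ∫ p, (g : P d →ᵇ ℝ) p * M.gen f p ∂(maxwellian d M.mass)
  test_smooth : ∀ f ∈ M.test, IsCb2 f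
  test_compact : ∀ f : X d → ℝ, ContDiff ℝ 2 f → HasCompactSupport f → f ∈ M.test
  test_position : ∀ a : P d → ℝ, IsCb2 a → (fun x : X d => a x.1) ∈ M.test
  test_comp : ∀ (l : ℕ) (f : Fin l → X d → ℝ) (φ : (Fin l → ℝ) → ℝ), (∀ i, f i ∈ M.test) →
    ContDiff ℝ 2 φ → (fun x => φ fun i => f i x) ∈ M.test
  /-- Test functions are in the domain of `𝒢`, acting on the momentum for fixed position. -/
  test_domain : ∀ f ∈ M.test, (∀ q, ∃ g : M.gen.domain, ∀ p, (g : P d →ᵇ ℝ) p = f (q, p)) ∧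
    Continuous (liftGen M.gen f) ∧ ∃ C, ∀ x, |liftGen M.gen f x| ≤ C
  /-- For cylinder functionals `F`, the functions `n⁻¹ exp(-n F) (G_n exp(n F))` converge to
  `𝓗₂(ρ, dF(ρ))` along all sequences of empirical measures that converge weakly to `ρ`. -/
  limit : ∀ ρ, M.IsState ρ → ∀ (l : ℕ) (f : Fin l → X d → ℝ) (φ : (Fin l → ℝ) → ℝ),
    (∀ i, f i ∈ M.test) → ContDiff ℝ 2 φ → ∀ y : (n : ℕ) → Fin n → X d,
    (∀ g : X d →ᵇ ℝ, Tendsto (fun n => ∫ x, g x ∂(empirical (y n))) atTop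
      (𝓝 (∫ x, g x ∂(law ρ)))) →
    Tendsto (fun n => preHamiltonian M.gen (cylinder f φ) (y n)) atTop
      (𝓝 (H₂ ρ (cylinderDeriv f φ (law ρ))))

/-! ### The dissipation potentials -/

/-- The cotangent vectors on which the limiting Hamiltonian determines the dissipation potential:
those that are test functions up to a function of the position. -/
def core (ρ : X d → ℝ) : Set (X d → ℝ) := {ξ | ξ ∈ M.cot ρ ∧ momentumPart ξ ∈ M.test}

variable (H₂ : (X d → ℝ) → (X d → ℝ) → ℝ)

/-- `𝓗₂(ρ, ξ + ½ dS(ρ)) - 𝓗₂(ρ, ½ dS(ρ))`, for `ξ` in the core. -/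
def shiftedHamiltonian (ρ ξ : X d → ℝ) : ℝ :=
  H₂ ρ (momentumPart (ξ + (1 / 2 : ℝ) • M.dEntropy ρ)) -
    H₂ ρ (momentumPart ((1 / 2 : ℝ) • M.dEntropy ρ))

/-- The dissipation potential `Ψ(ρ, ·)` on tangent vectors: the Legendre transform of the shifted
Hamiltonian. -/
def Ψ (ρ v : X d → ℝ) : EReal :=
  ⨆ ξ ∈ M.core ρ, ((pair v ξ - M.shiftedHamiltonian H₂ ρ ξ : ℝ) : EReal)

/-- The dual dissipation potential `Ψ*(ρ, ·)` on cotangent vectors: the Legendre transform of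
`Ψ(ρ, ·)`, that is, the lower semicontinuous extension of the shifted Hamiltonian from the core to
all cotangent vectors. -/
def Ψstar (ρ ξ : X d → ℝ) : EReal :=
  ⨆ v ∈ M.tan ρ, (pair v ξ : EReal) - M.Ψ H₂ ρ v

/-! ### The extended system -/

def extStateSpace : StateSpace d where
  points := {z | M.IsState z.1}
  tan := fun z => (M.tan z.1).prod ⊤
  cot := fun z => (M.cot z.1).prod ⊤

/-- `Ē(ρ, e) = E(ρ) + e`. -/
def extEnergy (z : ExtSpace d) : ℝ := M.energy z.1 + z.2

/-- `S̄(ρ, e) = S(ρ) - (E(ρ) + e)`. -/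
def extEntropy (z : ExtSpace d) : ℝ := M.entropy z.1 - (M.energy z.1 + z.2)

def dExtEnergy (z : ExtSpace d) : ExtSpace d := (M.dEnergy z.1, 1)

def dExtEntropy (z : ExtSpace d) : ExtSpace d := (M.dEntropy z.1 - M.dEnergy z.1, -1)

/-- `Ψ̄*((ρ, e), (ξ, r)) = Ψ*(ρ, ξ - r dE(ρ))`. -/
def extΨstar (z ζ : ExtSpace d) : EReal := M.Ψstar H₂ z.1 (ζ.1 - ζ.2 • M.dEnergy z.1)

/-- The Legendre transform of `Ψ̄*`. -/
def extΨ (z v : ExtSpace d) : EReal :=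
  ⨆ ζ ∈ M.extStateSpace.cot z, (pairExt v ζ : EReal) - M.extΨstar H₂ z ζ

/-- `F̄(ρ, e) = (F(ρ), -⟨dE(ρ), F(ρ)⟩)`. -/
def extDrift (z : ExtSpace d) : ExtSpace d := (M.drift z.1, -pair (M.drift z.1) (M.dEnergy z.1))

/-! ### The Vlasov-Fokker-Planck case -/

/-- `𝒢 f = -γ ⟨p/m, ∇f⟩ + γ Δf`. -/
def IsVlasovFokkerPlanck (γ : ℝ) : Prop :=
  ∀ f : M.gen.domain, ContDiff ℝ 2 ((f : P d →ᵇ ℝ) : P d → ℝ) ∧ ∀ p,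
    M.gen f p = -γ * inner ℝ (M.mass⁻¹ • p) (gradient ((f : P d →ᵇ ℝ) : P d → ℝ) p) +
      γ * Laplacian.laplacian ((f : P d →ᵇ ℝ) : P d → ℝ) p

/-- The operator `M̄(ρ, e)` sending `(ξ, r)` to
`2γ (-div_p(ρ ∇_p ξ) + r div_p(ρ p/m), -∫ ⟨p/m, ∇_p ξ⟩ ρ + r ∫ |p/m|² ρ)`. -/
def vfpOperator (γ : ℝ) (z ζ : ExtSpace d) : ExtSpace d :=
  (fun x => 2 * γ * (-divP (fun y => z.1 y • gradP ζ.1 y) x +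
      ζ.2 * divP (fun y => z.1 y • (M.mass⁻¹ • y.2)) x),
    2 * γ * (-(∫ x, inner ℝ (M.mass⁻¹ • x.2) (gradP ζ.1 x) * z.1 x) +
      ζ.2 * ∫ x, ‖M.mass⁻¹ • x.2‖ ^ 2 * z.1 x))

end Model

/-- `L̄(ρ, e) (ξ, r) = (L(ρ) ξ, 0)`. -/
def extPoisson (z ζ : ExtSpace d) : ExtSpace d := (poisson z.1 ζ.1, 0)

end Underdamped

end

open Underdamped

/-!
The argument rests on an explicit formula for the limiting Hamiltonian. Every probability measure is
a weak limit of empirical measures (`exists_empirical_tendsto`, by the law of large numbers), and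
for a linear cylinder functional `F(μ) = ∫ f dμ` the function `n⁻¹ e^{-nF} G_n e^{nF}` is the
integral of the bounded continuous function `e^{-f} 𝒢 e^f`, whatever `n` is. Hence
`𝓗₂(ρ, f) = ∫ e^{-f} (𝒢 e^f) ρ` for test functions `f` (`hamiltonian_eq`).

Write `ρ = B e^{2u}` with `B(q, p) = ρ(q, 0) e^{-|p|²/2m}` (`base`) and `u` half of the momentum
part of `dS(ρ)` (`halfEntropy`). Then `𝓗₂(ρ, u + f) = ∫ B e^{u-f} 𝒢 e^{u+f}`. Since `𝒢` is symmetric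
with respect to `B`, this is even in `f` (`hamiltonian_even`). The positive maximum principle gives
convexity, with the subgradient `B (e^{u+f} 𝒢 e^{u-f} - e^{u-f} 𝒢 e^{u+f})` at `f`
(`hamiltonian_subgradient`). This subgradient is a tangent vector that does not see functions of the
position, and at `f = -u` it is `B 𝒢 e^{2u}`, which is the density of `𝒢*(ρ)`
(`adjointGen_ae_eq_coreGradient`).

So `ψ_ρ` is even, convex, zero at zero, nonnegative, and has a gradient in `T_ρ Z` at each point of
the core. Therefore `Ψ* = ψ_ρ` on the core, and the energy-entropy balance `generic_equation` is
equality in Young's inequality for `𝒢*(ρ)` and `-dS(ρ)/2`; the Hamiltonian part drops out by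
antisymmetry of `L` and `L(ρ) (log ρ + 1) = 0`. The potential `Ψ̄` is `Ψ` on tangent vectors that
conserve the total energy and infinite elsewhere. The Poisson structure is treated by writing
`L(ρ) ξ` as the canonical bracket `{ξ, ρ}`, so that the Jacobi identity of functionals reduces to
that of functions on phase space (`pb_jacobi`); boundary terms vanish by the divergence theorem for
integrable fields with integrable divergence (`integral_divergence_eq_zero`).

In the Fokker-Planck case `e^{-f} 𝒢 e^f = 𝒢 f + γ |∇_p f|²`, and the even part of the Hamiltonian is
`γ ∫ |∇_p ξ|² ρ`. Truncation extends this from the core to all cotangent vectors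
(`Ψstar_fokkerPlanck`), since compactly supported functions are in the core.
-/

noncomputable section

namespace Underdamped

/-! ### Cutoff functions and the divergence theorem -/

section Cutoff

variable {E : Type*} [NormedAddCommGroup E] [NormedSpace ℝ E] [FiniteDimensional ℝ E]

/-- Smooth cutoff functions: `cutoff E n` equals `1` on the ball of radius `n + 1`, vanishes outside
of the ball of radius `2 (n + 1)`, and has a gradient of order `1 / (n + 1)`. -/
def cutoff (E : Type*) [NormedAddCommGroup E] [NormedSpace ℝ E] [FiniteDimensional ℝ E]
    (n : ℕ) (x : E) : ℝ :=
  (⟨1, 2, one_pos, one_lt_two⟩ : ContDiffBump (0 : E)) (((n : ℝ) + 1)⁻¹ • x)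

lemma cutoff_contDiff (n : ℕ) : ContDiff ℝ ∞ (cutoff E n) := by
  unfold cutoff
  exact (ContDiffBump.contDiff _).comp (contDiff_id.const_smul _)

lemma cutoff_hasCompactSupport (n : ℕ) : HasCompactSupport (cutoff E n) := by
  unfold cutoff
  exact (ContDiffBump.hasCompactSupport _).comp_homeomorph
    (Homeomorph.smulOfNeZero (((n : ℝ) + 1)⁻¹) (by positivity))

lemma cutoff_nonneg (n : ℕ) (x : E) : 0 ≤ cutoff E n x := ContDiffBump.nonneg _

lemma cutoff_le_one (n : ℕ) (x : E) : cutoff E n x ≤ 1 := ContDiffBump.le_one _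

lemma cutoff_eventually_eq_one (x : E) : ∀ᶠ n in atTop, cutoff E n x = 1 := by
  obtain ⟨N, hN⟩ := exists_nat_gt ‖x‖
  filter_upwards [eventually_ge_atTop N] with n hn
  apply ContDiffBump.one_of_mem_closedBall
  have : (N : ℝ) ≤ n := by exact_mod_cast hn
  rw [mem_closedBall_zero_iff, norm_smul, norm_inv, Real.norm_eq_abs,
    abs_of_pos (by positivity : (0 : ℝ) < n + 1), inv_mul_le_iff₀ (by positivity)]
  simp only [mul_one]
  linarith

lemma cutoff_tendsto (x : E) : Tendsto (fun n => cutoff E n x) atTop (𝓝 1) :=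
  tendsto_const_nhds.congr' ((cutoff_eventually_eq_one x).mono fun _ h => h.symm)

lemma exists_norm_fderiv_cutoff_le :
    ∃ C, 0 ≤ C ∧ ∀ (n : ℕ) (x : E), ‖fderiv ℝ (cutoff E n) x‖ ≤ C * ((n : ℝ) + 1)⁻¹ := by
  let f : ContDiffBump (0 : E) := ⟨1, 2, one_pos, one_lt_two⟩
  have hf : ContDiff ℝ 1 f := f.contDiff
  obtain ⟨C, hC⟩ := (hf.continuous_fderiv one_ne_zero).bounded_above_of_compact_support
    (f.hasCompactSupport.fderiv ℝ)
  refine ⟨C, (norm_nonneg _).trans (hC 0), fun n x => ?_⟩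
  have : fderiv ℝ (cutoff E n) x = ((n : ℝ) + 1)⁻¹ • fderiv ℝ f (((n : ℝ) + 1)⁻¹ • x) := by
    exact fderiv_comp_smul (f := f) (x := x) (((n : ℝ) + 1)⁻¹)
  rw [this, norm_smul, Real.norm_eq_abs, abs_of_pos (by positivity : (0 : ℝ) < ((n : ℝ) + 1)⁻¹),
    mul_comm]
  gcongr
  exact hC _

variable [MeasurableSpace E] [BorelSpace E] (μ : Measure E) [μ.IsAddHaarMeasure]

/-- The divergence theorem on the whole space for an integrable vector field with an integrable
divergence. The partial derivatives need not be integrable one by one. -/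
lemma integral_divergence_eq_zero {ι : Type*} [Fintype ι] (e : ι → E) (u : ι → E → ℝ)
    (hu : ∀ i, ContDiff ℝ 1 (u i)) (hi : ∀ i, Integrable (u i) μ)
    (hd : Integrable (fun x => ∑ i, fderiv ℝ (u i) x (e i)) μ) :
    ∫ x, ∑ i, fderiv ℝ (u i) x (e i) ∂μ = 0 := by
  obtain ⟨C, hC0, hC⟩ := exists_norm_fderiv_cutoff_le (E := E)
  have hχ : ∀ n, ContDiff ℝ 1 (cutoff E n) := fun n => (cutoff_contDiff n).of_le (by simp)
  have hc1 : ∀ n i, Continuous fun x => fderiv ℝ (cutoff E n) x (e i) := fun n i =>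
    ((hχ n).continuous_fderiv one_ne_zero).clm_apply continuous_const
  have hc2 : ∀ i, Continuous fun x => fderiv ℝ (u i) x (e i) := fun i =>
    ((hu i).continuous_fderiv one_ne_zero).clm_apply continuous_const
  have hI1 : ∀ n i, Integrable (fun x => fderiv ℝ (cutoff E n) x (e i) * u i x) μ := fun n i =>
    ((hc1 n i).mul (hu i).continuous).integrable_of_hasCompactSupport
      (((cutoff_hasCompactSupport n).fderiv_apply ℝ (e i)).mul_right)
  have hI2 : ∀ n i, Integrable (fun x => cutoff E n x * fderiv ℝ (u i) x (e i)) μ := fun n i =>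
    ((hχ n).continuous.mul (hc2 i)).integrable_of_hasCompactSupport
      ((cutoff_hasCompactSupport n).mul_right)
  have key : ∀ n : ℕ, ∫ x, cutoff E n x * ∑ i, fderiv ℝ (u i) x (e i) ∂μ =
      -∑ i, ∫ x, fderiv ℝ (cutoff E n) x (e i) * u i x ∂μ := by
    intro n
    simp_rw [Finset.mul_sum]
    rw [integral_finsetSum _ fun i _ => hI2 n i, ← Finset.sum_neg_distrib]
    refine Finset.sum_congr rfl fun i _ => ?_
    refine integral_mul_fderiv_eq_neg_fderiv_mul_of_integrable (hI1 n i) (hI2 n i) ?_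
      (fun x _ => (hχ n).differentiable one_ne_zero x)
      (fun x _ => (hu i).differentiable one_ne_zero x)
    exact ((hχ n).continuous.mul (hu i).continuous).integrable_of_hasCompactSupport
      ((cutoff_hasCompactSupport n).mul_right)
  have l1 : Tendsto (fun n => ∫ x, cutoff E n x * ∑ i, fderiv ℝ (u i) x (e i) ∂μ) atTop
      (𝓝 (∫ x, ∑ i, fderiv ℝ (u i) x (e i) ∂μ)) := by
    refine tendsto_integral_of_dominated_convergence _
      (fun n => ((hχ n).continuous.aestronglyMeasurable.mul hd.1)) hd.norm
      (fun n => Eventually.of_forall fun x => ?_) (Eventually.of_forall fun x => ?_)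
    · rw [norm_mul, Real.norm_eq_abs, abs_of_nonneg (cutoff_nonneg n x)]
      exact mul_le_of_le_one_left (norm_nonneg _) (cutoff_le_one n x)
    · simpa using (cutoff_tendsto x).mul_const (∑ i, fderiv ℝ (u i) x (e i))
  have l2 : Tendsto (fun n => -∑ i, ∫ x, fderiv ℝ (cutoff E n) x (e i) * u i x ∂μ) atTop
      (𝓝 0) := by
    rw [← neg_zero, ← Finset.sum_const_zero (ι := ι) (s := Finset.univ)]
    refine (tendsto_finsetSum _ fun i _ => ?_).neg
    have hb : Tendsto (fun n : ℕ => C * ((n : ℝ) + 1)⁻¹ * ‖e i‖ * ∫ x, ‖u i x‖ ∂μ) atTop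
        (𝓝 0) := by
      have : Tendsto (fun n : ℕ => ((n : ℝ) + 1)⁻¹) atTop (𝓝 0) := by
        simpa only [one_div] using tendsto_one_div_add_atTop_nhds_zero_nat (𝕜 := ℝ)
      simpa using ((this.const_mul C).mul_const ‖e i‖).mul_const (∫ x, ‖u i x‖ ∂μ)
    refine squeeze_zero_norm (fun n => ?_) hb
    rw [← integral_const_mul]
    refine norm_integral_le_of_norm_le ((hi i).norm.const_mul _) (Eventually.of_forall fun x => ?_)
    rw [norm_mul]
    gcongr
    exact ((fderiv ℝ (cutoff E n) x).le_opNorm _).trans (by gcongr; exact hC n x)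
  exact tendsto_nhds_unique (l1.congr key) l2

end Cutoff

variable {d : ℕ}

instance : (volume : Measure (X d)).IsAddHaarMeasure :=
  inferInstanceAs ((volume : Measure (P d)).prod (volume : Measure (P d))).IsAddHaarMeasure

/-! ### Partial derivatives and the Poisson bracket of functions on phase space -/

/-- The unit vector of the `i`-th position coordinate. -/
def eQ (i : Fin d) : X d := (EuclideanSpace.single i 1, 0)

/-- The unit vector of the `i`-th momentum coordinate. -/
def eP (i : Fin d) : X d := (0, EuclideanSpace.single i 1)

/-- `∂f/∂q_i`. -/
def dQ (i : Fin d) (f : X d → ℝ) (x : X d) : ℝ := fderiv ℝ f x (eQ i)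

/-- `∂f/∂p_i`. -/
def dP (i : Fin d) (f : X d → ℝ) (x : X d) : ℝ := fderiv ℝ f x (eP i)

/-- The canonical Poisson bracket of functions on phase space. -/
def pb (f g : X d → ℝ) (x : X d) : ℝ := ∑ i, (dQ i f x * dP i g x - dP i f x * dQ i g x)

/-- The Hamiltonian vector field of `g`: the derivative of `f` along it is `pb f g`. -/
def hamField (g : X d → ℝ) (x : X d) : X d := ∑ i, (dP i g x • eQ i - dQ i g x • eP i)

lemma fderiv_hamField (f g : X d → ℝ) (x : X d) : fderiv ℝ f x (hamField g x) = pb f g x := by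
  simp only [hamField, pb, map_sum, map_sub, map_smul, smul_eq_mul, dQ, dP]
  exact Finset.sum_congr rfl fun i _ => by ring

lemma pb_antisymm (f g : X d → ℝ) (x : X d) : pb f g x = -pb g f x := by
  simp only [pb, ← Finset.sum_neg_distrib]
  exact Finset.sum_congr rfl fun i _ => by ring

@[simp] lemma norm_eQ (i : Fin d) : ‖eQ i‖ = 1 := by
  simp [eQ, Prod.norm_def]

@[simp] lemma norm_eP (i : Fin d) : ‖eP i‖ = 1 := by
  simp [eP, Prod.norm_def]

lemma abs_dQ_le (i : Fin d) (f : X d → ℝ) (x : X d) : |dQ i f x| ≤ ‖fderiv ℝ f x‖ := by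
  simpa [dQ] using (fderiv ℝ f x).le_opNorm (eQ i)

lemma abs_dP_le (i : Fin d) (f : X d → ℝ) (x : X d) : |dP i f x| ≤ ‖fderiv ℝ f x‖ := by
  simpa [dP] using (fderiv ℝ f x).le_opNorm (eP i)

lemma abs_pb_le (f g : X d → ℝ) (x : X d) :
    |pb f g x| ≤ 2 * d * (‖fderiv ℝ f x‖ * ‖fderiv ℝ g x‖) := by
  refine (Finset.abs_sum_le_sum_abs _ _).trans ?_
  have : ∀ i ∈ (Finset.univ : Finset (Fin d)), |dQ i f x * dP i g x - dP i f x * dQ i g x| ≤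
      2 * (‖fderiv ℝ f x‖ * ‖fderiv ℝ g x‖) := fun i _ => by
    refine (abs_sub _ _).trans ?_
    rw [abs_mul, abs_mul, two_mul]
    gcongr <;> first | exact abs_dQ_le _ _ _ | exact abs_dP_le _ _ _
  refine (Finset.sum_le_sum this).trans (le_of_eq ?_)
  simp
  ring

section Regularity

variable {f g h : X d → ℝ}

lemma contDiff_dQ {n : ℕ∞} (hf : ContDiff ℝ (n + 1) f) (i : Fin d) : ContDiff ℝ n (dQ i f) :=
  (hf.fderiv_right (m := n) le_rfl).clm_apply contDiff_const

lemma contDiff_dP {n : ℕ∞} (hf : ContDiff ℝ (n + 1) f) (i : Fin d) : ContDiff ℝ n (dP i f) :=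
  (hf.fderiv_right (m := n) le_rfl).clm_apply contDiff_const

lemma contDiff_one_dQ (hf : ContDiff ℝ 2 f) (i : Fin d) : ContDiff ℝ 1 (dQ i f) :=
  contDiff_dQ (n := 1) hf i

lemma contDiff_one_dP (hf : ContDiff ℝ 2 f) (i : Fin d) : ContDiff ℝ 1 (dP i f) :=
  contDiff_dP (n := 1) hf i

lemma continuous_dQ (hf : ContDiff ℝ 1 f) (i : Fin d) : Continuous (dQ i f) :=
  (hf.continuous_fderiv one_ne_zero).clm_apply continuous_const

lemma continuous_dP (hf : ContDiff ℝ 1 f) (i : Fin d) : Continuous (dP i f) :=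
  (hf.continuous_fderiv one_ne_zero).clm_apply continuous_const

lemma continuous_pb (hf : ContDiff ℝ 1 f) (hg : ContDiff ℝ 1 g) : Continuous (pb f g) :=
  continuous_finsetSum _ fun i _ => ((continuous_dQ hf i).mul (continuous_dP hg i)).sub
    ((continuous_dP hf i).mul (continuous_dQ hg i))

lemma contDiff_pb (hf : ContDiff ℝ ∞ f) (hg : ContDiff ℝ ∞ g) : ContDiff ℝ ∞ (pb f g) :=
  ContDiff.sum fun i _ =>
    ((contDiff_dQ (n := ⊤) (by simpa using hf) i).mul
      (contDiff_dP (n := ⊤) (by simpa using hg) i)).sub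
    ((contDiff_dP (n := ⊤) (by simpa using hf) i).mul
      (contDiff_dQ (n := ⊤) (by simpa using hg) i))

lemma HasCompactSupport.pb_left (hf : HasCompactSupport f) : HasCompactSupport (pb f g) := by
  refine (hf.fderiv ℝ).mono ?_
  intro x hx hx'
  apply hx
  rw [← fderiv_hamField, hx']
  rfl

/-- Symmetry of the mixed second derivatives. -/
lemma fderiv_dQ_symm (hf : ContDiff ℝ 2 f) (i j : Fin d) (x : X d) :
    dQ i (dP j f) x = dP j (dQ i f) x := by
  have hs := (hf.contDiffAt (x := x)).isSymmSndFDerivAt (by simp)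
  have hd : DifferentiableAt ℝ (fderiv ℝ f) x :=
    (hf.fderiv_right (m := 1) (by norm_num)).differentiable one_ne_zero x
  have h1 : ∀ v w : X d, fderiv ℝ (fun y => fderiv ℝ f y v) x w = fderiv ℝ (fderiv ℝ f) x w v := by
    intro v w
    rw [fderiv_clm_apply hd (differentiableAt_const v)]
    simp
  change fderiv ℝ (fun y => fderiv ℝ f y (eP j)) x (eQ i) =
    fderiv ℝ (fun y => fderiv ℝ f y (eQ i)) x (eP j)
  rw [h1, h1]
  exact hs _ _

lemma dQ_mul (hf : DifferentiableAt ℝ f x) (hg : DifferentiableAt ℝ g x) (i : Fin d) :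
    dQ i (fun y => f y * g y) x = f x * dQ i g x + g x * dQ i f x := by
  simp [dQ, fderiv_fun_mul hf hg]

lemma dP_mul (hf : DifferentiableAt ℝ f x) (hg : DifferentiableAt ℝ g x) (i : Fin d) :
    dP i (fun y => f y * g y) x = f x * dP i g x + g x * dP i f x := by
  simp [dP, fderiv_fun_mul hf hg]

lemma pb_mul_left (hf : DifferentiableAt ℝ f x) (hg : DifferentiableAt ℝ g x) :
    pb (fun y => f y * g y) h x = f x * pb g h x + g x * pb f h x := by
  simp only [← fderiv_hamField, fderiv_fun_mul hf hg]
  simp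

lemma pb_add_left (hf : DifferentiableAt ℝ f x) (hg : DifferentiableAt ℝ g x) :
    pb (fun y => f y + g y) h x = pb f h x + pb g h x := by
  simp only [← fderiv_hamField, fderiv_fun_add hf hg]
  simp

lemma pb_const_mul_left (hf : DifferentiableAt ℝ f x) (c : ℝ) :
    pb (fun y => c * f y) h x = c * pb f h x := by
  simp only [← fderiv_hamField, fderiv_const_mul hf c]
  simp

lemma pb_sum_left {ι : Type*} (s : Finset ι) {F : ι → X d → ℝ}
    (hF : ∀ i ∈ s, DifferentiableAt ℝ (F i) x) :
    pb (fun y => ∑ i ∈ s, F i y) h x = ∑ i ∈ s, pb (F i) h x := by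
  simp only [← fderiv_hamField, fderiv_fun_sum hF]
  simp

/-- The derivative of a Poisson bracket, in terms of second derivatives. -/
lemma fderiv_pb (hf : ContDiff ℝ 2 f) (hg : ContDiff ℝ 2 g) (x v : X d) :
    fderiv ℝ (pb f g) x v = fderiv ℝ (fderiv ℝ f) x v (hamField g x) -
      fderiv ℝ (fderiv ℝ g) x v (hamField f x) := by
  have hd : ∀ {f : X d → ℝ}, ContDiff ℝ 2 f → DifferentiableAt ℝ (fderiv ℝ f) x := fun hf =>
    (hf.fderiv_right (m := 1) (by norm_num)).differentiable one_ne_zero x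
  have hQ : ∀ {f : X d → ℝ} (i : Fin d), ContDiff ℝ 2 f → HasFDerivAt (dQ i f)
      ((fderiv ℝ (fderiv ℝ f) x).flip (eQ i)) x := fun i hf => by
    have := (hd hf).hasFDerivAt.clm_apply (hasFDerivAt_const (eQ i) x)
    exact this.congr_fderiv (by simp)
  have hP : ∀ {f : X d → ℝ} (i : Fin d), ContDiff ℝ 2 f → HasFDerivAt (dP i f)
      ((fderiv ℝ (fderiv ℝ f) x).flip (eP i)) x := fun i hf => by
    have := (hd hf).hasFDerivAt.clm_apply (hasFDerivAt_const (eP i) x)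
    exact this.congr_fderiv (by simp)
  have := HasFDerivAt.fun_sum (u := Finset.univ) fun i _ =>
    ((hQ i hf).mul (hP i hg)).sub ((hP i hf).mul (hQ i hg))
  rw [show pb f g = fun y => ∑ i, (dQ i f * dP i g - dP i f * dQ i g) y from rfl, this.fderiv]
  simp only [hamField, map_sum, map_sub, map_smul, smul_eq_mul, sum_apply,
    sub_apply, add_apply, smul_apply,
    ContinuousLinearMap.flip_apply, ← Finset.sum_sub_distrib]
  exact Finset.sum_congr rfl fun i _ => by ring

/-- The Jacobi identity of the canonical Poisson bracket. -/
lemma pb_jacobi (hf : ContDiff ℝ 2 f) (hg : ContDiff ℝ 2 g) (hh : ContDiff ℝ 2 h) (x : X d) :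
    pb (pb f g) h x + pb (pb h f) g x + pb (pb g h) f x = 0 := by
  have sf := (hf.contDiffAt (x := x)).isSymmSndFDerivAt (by simp)
  have sg := (hg.contDiffAt (x := x)).isSymmSndFDerivAt (by simp)
  have sh := (hh.contDiffAt (x := x)).isSymmSndFDerivAt (by simp)
  rw [← fderiv_hamField, ← fderiv_hamField, ← fderiv_hamField, fderiv_pb hf hg, fderiv_pb hh hf,
    fderiv_pb hg hh, sf (hamField g x), sg (hamField f x), sh (hamField f x)]
  ring

end Regularity

/-! ### The operators of the model in coordinates -/

section Coordinates

variable {f g : X d → ℝ} {u : X d → P d} {x : X d}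

lemma gradQ_apply (hf : DifferentiableAt ℝ f x) (i : Fin d) : gradQ f x i = dQ i f x := by
  have h1 : HasFDerivAt (fun q => f (q, x.2)) ((fderiv ℝ f x).comp
      (ContinuousLinearMap.inl ℝ (P d) (P d))) x.1 :=
    HasFDerivAt.comp (g := f) (f := fun q => (q, x.2)) x.1 hf.hasFDerivAt
      (hasFDerivAt_prodMk_left x.1 x.2)
  have h2 : inner ℝ (gradQ f x) (EuclideanSpace.single i 1) = dQ i f x := by
    rw [gradQ, gradient, InnerProductSpace.toDual_symm_apply, h1.fderiv]
    simp [dQ, eQ]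
  rw [← h2, EuclideanSpace.inner_single_right]
  simp

lemma gradP_apply (hf : DifferentiableAt ℝ f x) (i : Fin d) : gradP f x i = dP i f x := by
  have h1 : HasFDerivAt (fun p => f (x.1, p)) ((fderiv ℝ f x).comp
      (ContinuousLinearMap.inr ℝ (P d) (P d))) x.2 :=
    HasFDerivAt.comp (g := f) (f := fun p => (x.1, p)) x.2 hf.hasFDerivAt
      (hasFDerivAt_prodMk_right x.1 x.2)
  have h2 : inner ℝ (gradP f x) (EuclideanSpace.single i 1) = dP i f x := by
    rw [gradP, gradient, InnerProductSpace.toDual_symm_apply, h1.fderiv]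
    simp [dP, eP]
  rw [← h2, EuclideanSpace.inner_single_right]
  simp

/-- The divergence in the positions, from the coordinates of the vector field. -/
lemma divQ_eq {c : Fin d → X d → ℝ} (hu : ∀ y i, u y i = c i y)
    (hc : ∀ i, DifferentiableAt ℝ (c i) x) : divQ u x = ∑ i, dQ i (c i) x := by
  refine Finset.sum_congr rfl fun i _ => ?_
  have h1 : ∀ j, HasFDerivAt (fun q => c j (q, x.2)) ((fderiv ℝ (c j) x).comp
      (ContinuousLinearMap.inl ℝ (P d) (P d))) x.1 := fun j =>
    HasFDerivAt.comp (g := c j) (f := fun q => (q, x.2)) x.1 (hc j).hasFDerivAt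
      (hasFDerivAt_prodMk_left x.1 x.2)
  have h2 : DifferentiableAt ℝ (fun q => u (q, x.2)) x.1 := by
    rw [differentiableAt_euclidean]
    intro j
    simp only [hu]
    exact (h1 j).differentiableAt
  have h3 := ((EuclideanSpace.proj (𝕜 := ℝ) i).hasFDerivAt.comp x.1 h2.hasFDerivAt).unique
    ((h1 i).congr_of_eventuallyEq (Eventually.of_forall fun q => hu (q, x.2) i))
  have := congrArg (fun T => T (EuclideanSpace.single i 1)) h3
  simpa [dQ, eQ] using this

/-- The divergence in the momenta, from the coordinates of the vector field. -/
lemma divP_eq {c : Fin d → X d → ℝ} (hu : ∀ y i, u y i = c i y)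
    (hc : ∀ i, DifferentiableAt ℝ (c i) x) : divP u x = ∑ i, dP i (c i) x := by
  refine Finset.sum_congr rfl fun i _ => ?_
  have h1 : ∀ j, HasFDerivAt (fun p => c j (x.1, p)) ((fderiv ℝ (c j) x).comp
      (ContinuousLinearMap.inr ℝ (P d) (P d))) x.2 := fun j =>
    HasFDerivAt.comp (g := c j) (f := fun p => (x.1, p)) x.2 (hc j).hasFDerivAt
      (hasFDerivAt_prodMk_right x.1 x.2)
  have h2 : DifferentiableAt ℝ (fun p => u (x.1, p)) x.2 := by
    rw [differentiableAt_euclidean]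
    intro j
    simp only [hu]
    exact (h1 j).differentiableAt
  have h3 := ((EuclideanSpace.proj (𝕜 := ℝ) i).hasFDerivAt.comp x.2 h2.hasFDerivAt).unique
    ((h1 i).congr_of_eventuallyEq (Eventually.of_forall fun p => hu (x.1, p) i))
  have := congrArg (fun T => T (EuclideanSpace.single i 1)) h3
  simpa [dP, eP] using this

/-- `L(ρ) ξ` is the Poisson bracket of `ξ` and `ρ`: the mixed second derivatives cancel. -/
lemma poisson_eq_pb {ρ ξ : X d → ℝ} (hρ : ContDiff ℝ 1 ρ) (hξ : ContDiff ℝ 2 ξ) :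
    poisson ρ ξ = pb ξ ρ := by
  funext x
  have hξ' : Differentiable ℝ ξ := hξ.differentiable (by norm_num)
  have hρ' : Differentiable ℝ ρ := hρ.differentiable (by norm_num)
  have hP : ∀ i, Differentiable ℝ (dP i ξ) := fun i =>
    (contDiff_one_dP hξ i).differentiable one_ne_zero
  have hQ : ∀ i, Differentiable ℝ (dQ i ξ) := fun i =>
    (contDiff_one_dQ hξ i).differentiable one_ne_zero
  rw [poisson, divQ_eq (c := fun i y => ρ y * dP i ξ y) (fun y i => by simp [gradP_apply (hξ' y)])
    (fun i => (hρ' x).mul (hP i x)),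
    divP_eq (c := fun i y => ρ y * dQ i ξ y) (fun y i => by simp [gradQ_apply (hξ' y)])
    (fun i => (hρ' x).mul (hQ i x)), pb, ← Finset.sum_neg_distrib, ← Finset.sum_add_distrib]
  refine Finset.sum_congr rfl fun i _ => ?_
  rw [dQ_mul (hρ' x) (hP i x), dP_mul (hρ' x) (hQ i x), fderiv_dQ_symm hξ]
  ring

end Coordinates

/-- `∫ {η, ξ} = 0`, in the form in which the growth of `η`, `ξ` at infinity enters. -/
lemma integral_pb_eq_zero {η ξ : X d → ℝ} (hη : ContDiff ℝ 1 η) (hξ : ContDiff ℝ 2 ξ)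
    (h1 : Integrable fun x => η x * ‖fderiv ℝ ξ x‖) (h2 : Integrable (pb η ξ)) :
    ∫ x, pb η ξ x = 0 := by
  have hη' : Differentiable ℝ η := hη.differentiable (by norm_num)
  have hP : ∀ i, Differentiable ℝ (dP i ξ) := fun i =>
    (contDiff_one_dP hξ i).differentiable one_ne_zero
  have hQ : ∀ i, Differentiable ℝ (dQ i ξ) := fun i =>
    (contDiff_one_dQ hξ i).differentiable one_ne_zero
  let e : Fin d ⊕ Fin d → X d := Sum.elim eQ eP
  let u : Fin d ⊕ Fin d → X d → ℝ :=
    Sum.elim (fun i y => η y * dP i ξ y) (fun i y => η y * (-1 * dQ i ξ y))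
  have heq : ∀ x, ∑ i, fderiv ℝ (u i) x (e i) = pb η ξ x := by
    intro x
    rw [Fintype.sum_sum_type, pb, ← Finset.sum_add_distrib]
    refine Finset.sum_congr rfl fun i _ => ?_
    change dQ i (fun y => η y * dP i ξ y) x + dP i (fun y => η y * (-1 * dQ i ξ y)) x = _
    rw [dQ_mul (hη' x) (hP i x), dP_mul (hη' x) ((hQ i x).const_mul _), fderiv_dQ_symm hξ]
    have : dP i (fun y => -1 * dQ i ξ y) x = -dP i (dQ i ξ) x := by
      simp [dP]
    rw [this]
    ring
  have := integral_divergence_eq_zero (volume : Measure (X d)) e u ?_ ?_ ?_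
  · simpa only [heq] using this
  · rintro (i | i)
    · exact hη.mul (contDiff_one_dP hξ i)
    · exact hη.mul (contDiff_const.mul (contDiff_one_dQ hξ i))
  · rintro (i | i)
    · refine h1.mono (hη.continuous.mul
        (continuous_dP (hξ.of_le one_le_two) i)).aestronglyMeasurable
        (Eventually.of_forall fun x => ?_)
      simp only [u, Sum.elim_inl, norm_mul, norm_norm]
      gcongr
      exact abs_dP_le _ _ _
    · refine h1.mono (hη.continuous.mul (continuous_const.mul
        (continuous_dQ (hξ.of_le one_le_two) i))).aestronglyMeasurable
        (Eventually.of_forall fun x => ?_)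
      simp only [u, Sum.elim_inr, norm_mul, norm_norm, norm_neg, norm_one, one_mul]
      gcongr
      exact abs_dQ_le _ _ _
  · simpa only [heq] using h2

/-! ### Approximation of a probability measure by empirical measures -/

lemma empirical_real_apply {n : ℕ} (y : Fin n → X d) {s : Set (X d)} (hs : MeasurableSet s) :
    (empirical y).real s = (n : ℝ)⁻¹ * ∑ i, s.indicator 1 (y i) := by
  simp only [empirical, measureReal_def, Measure.smul_apply, Measure.finsetSum_apply,
    Measure.dirac_apply' _ hs, smul_eq_mul, ENNReal.toReal_mul, ENNReal.toReal_inv,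
    ENNReal.toReal_natCast]
  rw [ENNReal.toReal_sum fun i _ => by by_cases h : y i ∈ s <;> simp [h]]
  congr 1
  refine Finset.sum_congr rfl fun i _ => ?_
  by_cases h : y i ∈ s <;> simp [h]

lemma integral_empirical {n : ℕ} (y : Fin n → X d) (g : X d → ℝ) :
    ∫ x, g x ∂(empirical y) = (n : ℝ)⁻¹ * ∑ i, g (y i) := by
  rw [empirical, integral_smul_measure, integral_finsetSum_measure]
  · simp
  · intro i _
    exact integrable_dirac (by simp)

lemma isProbabilityMeasure_empirical {n : ℕ} (y : Fin (n + 1) → X d) :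
    IsProbabilityMeasure (empirical y) := by
  constructor
  simp only [empirical, Measure.smul_apply, Measure.finsetSum_apply, measure_univ]
  simp only [Finset.sum_const, Finset.card_univ, Fintype.card_fin, nsmul_eq_mul, mul_one,
    smul_eq_mul]
  exact ENNReal.inv_mul_cancel (by simp) (by finiteness)

/-- Every probability measure on phase space is a weak limit of empirical measures. By the law of
large numbers, the empirical measures of almost every sequence of independent samples converge on
each set of a countable π-system of open sets. -/
lemma exists_empirical_tendsto (μ : Measure (X d)) [IsProbabilityMeasure μ] :
    ∃ y : (n : ℕ) → Fin n → X d, ∀ g : X d →ᵇ ℝ,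
      Tendsto (fun n => ∫ x, g x ∂(empirical (y n))) atTop (𝓝 (∫ x, g x ∂μ)) := by
  let B := TopologicalSpace.countableBasis (X d)
  have hB : TopologicalSpace.IsTopologicalBasis B := TopologicalSpace.isBasis_countableBasis (X d)
  let S : Set (Set (X d)) := Set.sInter '' {F | F.Finite ∧ F ⊆ B}
  have hSc : S.Countable :=
    (Set.countable_ofPred_finite_subset (TopologicalSpace.countable_countableBasis (X d))).image _
  have hSo : ∀ s ∈ S, IsOpen s := by
    rintro _ ⟨F, ⟨hF, hFB⟩, rfl⟩
    exact hF.isOpen_sInter fun t ht => hB.isOpen (hFB ht)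
  have hSp : IsPiSystem S := by
    rintro _ ⟨F, ⟨hF, hFB⟩, rfl⟩ _ ⟨G, ⟨hG, hGB⟩, rfl⟩ _
    exact ⟨F ∪ G, ⟨hF.union hG, Set.union_subset hFB hGB⟩, Set.sInter_union F G⟩
  have hae : ∀ᵐ z ∂(Measure.infinitePi fun _ : ℕ => μ), ∀ s ∈ S,
      Tendsto (fun n : ℕ => (n : ℝ)⁻¹ • ∑ i ∈ Finset.range n, s.indicator (1 : X d → ℝ) (z i)) atTop
        (𝓝 (μ.real s)) := by
    rw [ae_ball_iff hSc]
    intro s hs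
    have hsm := (hSo s hs).measurableSet
    have hm : Measurable (s.indicator (1 : X d → ℝ)) := measurable_one.indicator hsm
    have hid : ∀ i, (Measure.infinitePi fun _ : ℕ => μ).map (fun z => z i) = μ := fun i =>
      Measure.infinitePi_map_eval _ i
    have hint : ∫ z, s.indicator (1 : X d → ℝ) (z 0) ∂(Measure.infinitePi fun _ : ℕ => μ) =
        μ.real s := by
      rw [← integral_indicator_one hsm]
      conv_rhs => rw [← hid 0]
      rw [integral_map (measurable_pi_apply 0).aemeasurable hm.aestronglyMeasurable]
    rw [← hint]
    refine ProbabilityTheory.strong_law_ae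
      (fun i (z : ℕ → X d) => s.indicator (1 : X d → ℝ) (z i)) ?_ ?_ ?_
    · refine (integrable_const (1 : ℝ)).mono (hm.comp (measurable_pi_apply 0)).aestronglyMeasurable
        (Eventually.of_forall fun z => ?_)
      by_cases h : z 0 ∈ s <;> simp [h]
    · intro i j hij
      exact (ProbabilityTheory.iIndepFun_infinitePi (P := fun _ : ℕ => μ)
        (X := fun _ => s.indicator (1 : X d → ℝ)) (fun _ => hm)).indepFun hij
    · intro i
      refine ⟨(hm.comp (measurable_pi_apply i)).aemeasurable,
        (hm.comp (measurable_pi_apply 0)).aemeasurable, ?_⟩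
      rw [show (fun z : ℕ → X d => s.indicator (1 : X d → ℝ) (z i)) =
          s.indicator (1 : X d → ℝ) ∘ fun z => z i from rfl,
        show (fun z : ℕ → X d => s.indicator (1 : X d → ℝ) (z 0)) =
          s.indicator (1 : X d → ℝ) ∘ fun z => z 0 from rfl,
        ← Measure.map_map hm (measurable_pi_apply i), ← Measure.map_map hm (measurable_pi_apply 0),
        hid, hid]
  obtain ⟨z, hz⟩ := hae.exists
  refine ⟨fun n i => z i, fun g => ?_⟩
  rw [← tendsto_add_atTop_iff_nat 1]
  have hp : ∀ n : ℕ, IsProbabilityMeasure (empirical fun i : Fin (n + 1) => z i) := fun n =>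
    isProbabilityMeasure_empirical _
  let ν : ℕ → ProbabilityMeasure (X d) := fun n => ⟨empirical fun i : Fin (n + 1) => z i, hp n⟩
  let ν' : ProbabilityMeasure (X d) := ⟨μ, inferInstance⟩
  have hlim : Tendsto ν atTop (𝓝 ν') := by
    refine hSp.tendsto_probabilityMeasure_of_tendsto_of_mem
      (fun s hs => (hSo s hs).measurableSet) ?_ ?_
    · intro u hu x hx
      obtain ⟨v, hv, hxv, hvu⟩ := hB.exists_subset_of_mem_open hx hu
      exact ⟨v, ⟨{v}, ⟨Set.finite_singleton v, by simpa using hv⟩, by simp⟩,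
        (hB.isOpen hv).mem_nhds hxv, hvu⟩
    · intro s hs
      rw [← NNReal.tendsto_coe]
      have := (tendsto_add_atTop_iff_nat 1).2 (hz s hs)
      refine (this.congr fun n => ?_)
      rw [Finset.sum_range, smul_eq_mul]
      exact (empirical_real_apply _ (hSo s hs).measurableSet).symm
  exact (ProbabilityMeasure.tendsto_iff_forall_integral_tendsto.1 hlim) g

/-! ### Regularity of convolutions with a density -/

/-- The first `n` derivatives of `q ↦ K (q - ·)` are `ρ`-integrably dominated, locally uniformly
in `q`. -/
def LocDominated {F : Type} [NormedAddCommGroup F] [NormedSpace ℝ F] (n : ℕ) (K : P d → F)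
    (ρ : X d → ℝ) : Prop :=
  ∀ R : ℝ, ∃ B : P d → ℝ, Integrable (fun x : X d => B x.1 * ρ x) ∧
    ∀ q q' : P d, ‖q‖ ≤ R → ∀ k ≤ n, ‖iteratedFDeriv ℝ k K (q - q')‖ ≤ B q'

section Convolution

variable {F : Type} [NormedAddCommGroup F] [NormedSpace ℝ F] {K : P d → F} {ρ : X d → ℝ} {n : ℕ}

lemma LocDominated.mono (h : LocDominated n K ρ) {m : ℕ} (hm : m ≤ n) : LocDominated m K ρ :=
  fun R => by
    obtain ⟨B, hB, hK⟩ := h R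
    exact ⟨B, hB, fun q q' hq k hk => hK q q' hq k (hk.trans hm)⟩

lemma LocDominated.fderiv (h : LocDominated (n + 1) K ρ) : LocDominated n (fderiv ℝ K) ρ :=
  fun R => by
    obtain ⟨B, hB, hK⟩ := h R
    refine ⟨B, hB, fun q q' hq k hk => ?_⟩
    rw [norm_iteratedFDeriv_fderiv]
    exact hK q q' hq (k + 1) (by omega)

/-- Domination of the function itself. -/
lemma LocDominated.exists_bound (h : LocDominated n K ρ) (hρ : ∀ x, 0 ≤ ρ x) (R : ℝ) :
    ∃ b : X d → ℝ, Integrable b ∧ ∀ q, ‖q‖ ≤ R → ∀ x, ‖ρ x • K (q - x.1)‖ ≤ b x := by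
  obtain ⟨B, hB, hK⟩ := h R
  refine ⟨_, hB, fun q hq x => ?_⟩
  have := hK q x.1 hq 0 (by omega)
  rw [norm_iteratedFDeriv_zero] at this
  rw [norm_smul, Real.norm_eq_abs, abs_of_nonneg (hρ x), mul_comm]
  exact mul_le_mul_of_nonneg_right this (hρ x)

lemma LocDominated.continuous (h : LocDominated n K ρ) (hK : Continuous K) (hρc : Continuous ρ)
    (hρ : ∀ x, 0 ≤ ρ x) : Continuous fun q => ∫ x, ρ x • K (q - x.1) := by
  refine continuous_iff_continuousAt.2 fun q => ?_
  obtain ⟨b, hb, hK'⟩ := h.exists_bound hρ (‖q‖ + 1)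
  refine continuousAt_of_dominated (bound := b)
    (Eventually.of_forall fun q' => Continuous.aestronglyMeasurable (by fun_prop)) ?_ hb
    (Eventually.of_forall fun x => Continuous.continuousAt (by fun_prop))
  filter_upwards [Metric.ball_mem_nhds q one_pos] with q' hq'
  refine Eventually.of_forall fun x => hK' q' ?_ x
  have := norm_sub_norm_le q' q
  rw [mem_ball_iff_norm] at hq'
  linarith

lemma LocDominated.integrable (h : LocDominated n K ρ) (hK : Continuous K) (hρc : Continuous ρ)
    (hρ : ∀ x, 0 ≤ ρ x) (q : P d) : Integrable fun x => ρ x • K (q - x.1) := by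
  obtain ⟨b, hb, hK'⟩ := h.exists_bound hρ ‖q‖
  exact hb.mono' (Continuous.aestronglyMeasurable (by fun_prop))
    (Eventually.of_forall fun x => hK' q le_rfl x)

lemma LocDominated.hasFDerivAt (h : LocDominated 1 K ρ) (hK : ContDiff ℝ 1 K)
    (hρc : Continuous ρ) (hρ : ∀ x, 0 ≤ ρ x) (q : P d) :
    HasFDerivAt (fun q => ∫ x, ρ x • K (q - x.1)) (∫ x, ρ x • _root_.fderiv ℝ K (q - x.1)) q := by
  obtain ⟨b, hb, hK'⟩ := (h.fderiv (n := 0)).exists_bound hρ (‖q‖ + 1)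
  have hKc := hK.continuous
  have hK1 := hK.continuous_fderiv one_ne_zero
  refine hasFDerivAt_integral_of_dominated_of_fderiv_le (bound := b)
    (F' := fun q x => ρ x • _root_.fderiv ℝ K (q - x.1)) (Metric.ball_mem_nhds q one_pos)
    (Eventually.of_forall fun q' => Continuous.aestronglyMeasurable (by fun_prop))
    (h.integrable hK.continuous hρc hρ q)
    (Continuous.aestronglyMeasurable (by fun_prop)) ?_ hb ?_
  · refine Eventually.of_forall fun x q' hq' => hK' q' ?_ x
    have := norm_sub_norm_le q' q
    rw [mem_ball_iff_norm] at hq'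
    linarith
  · refine Eventually.of_forall fun x q' _ => ?_
    exact ((hK.differentiable one_ne_zero _).hasFDerivAt.comp q'
      ((hasFDerivAt_id q').sub_const x.1)).const_smul (ρ x)

lemma LocDominated.contDiff (hρc : Continuous ρ) (hρ : ∀ x, 0 ≤ ρ x) (n : ℕ) :
    ∀ {F : Type} [NormedAddCommGroup F] [NormedSpace ℝ F] {K : P d → F},
      LocDominated n K ρ → ContDiff ℝ n K → ContDiff ℝ n fun q => ∫ x, ρ x • K (q - x.1) := by
  induction n with
  | zero =>
    intro F _ _ K h hK
    exact contDiff_zero.2 (h.continuous hK.continuous hρc hρ)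
  | succ n ih =>
    intro F _ _ K h hK
    have hd := (h.mono (m := 1) (by omega)).hasFDerivAt (hK.of_le (by simp)) hρc hρ
    push_cast
    refine contDiff_succ_iff_fderiv.2 ⟨fun q => (hd q).differentiableAt, by simp, ?_⟩
    rw [show _root_.fderiv ℝ (fun q => ∫ x, ρ x • K (q - x.1)) =
      fun q => ∫ x, ρ x • _root_.fderiv ℝ K (q - x.1) from funext fun q => (hd q).fderiv]
    exact ih h.fderiv (hK.fderiv_right (by simp))

end Convolution

/-! ### Growth and integrability at a state -/

namespace Model

variable {M : Model d} {H₂ : (X d → ℝ) → (X d → ℝ) → ℝ} {ρ : X d → ℝ}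

lemma IsState.nonneg (hρ : M.IsState ρ) (x : X d) : 0 ≤ ρ x := (hρ.pos x).le

lemma IsState.contDiff_one (hρ : M.IsState ρ) : ContDiff ℝ 1 ρ := hρ.smooth.of_le one_le_two

lemma IsState.locDominated (hρ : M.IsState ρ) : LocDominated 2 M.Φ ρ := hρ.interaction

lemma conv_eq (ρ : X d → ℝ) : M.conv ρ = fun q => ∫ x, ρ x • M.Φ (q - x.1) := by
  funext q
  simp only [conv, smul_eq_mul, mul_comm]

variable (hM : M.Condition H₂) (hρ : M.IsState ρ)
include hM hρ

lemma contDiff_conv : ContDiff ℝ 2 (M.conv ρ) := by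
  rw [conv_eq]
  exact LocDominated.contDiff hρ.smooth.continuous hρ.nonneg 2 hρ.locDominated hM.Φ_smooth

lemma contDiff_dEnergy : ContDiff ℝ 2 (M.dEnergy ρ) := by
  have h1 : ContDiff ℝ 2 fun x : X d => ‖x.2‖ ^ 2 / (2 * M.mass) :=
    (contDiff_snd.norm_sq ℝ).div_const _
  exact (h1.add (hM.V_smooth.comp contDiff_fst)).add ((contDiff_conv hM hρ).comp contDiff_fst)

lemma integrable_interaction (q : P d) : Integrable fun x => M.Φ (q - x.1) * ρ x := by
  have := hρ.locDominated.integrable hM.Φ_smooth.continuous hρ.smooth.continuous hρ.nonneg q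
  simpa only [smul_eq_mul, mul_comm] using this

lemma continuous_weight : Continuous (M.weight ρ) := by
  have h0 : LocDominated 0 (fun q => |M.Φ q|) ρ := fun R => by
    obtain ⟨B, hB, hK⟩ := hρ.interaction R
    refine ⟨B, hB, fun q q' hq k hk => ?_⟩
    obtain rfl : k = 0 := by omega
    have := hK q q' hq 0 (by omega)
    rw [norm_iteratedFDeriv_zero] at this ⊢
    simpa using this
  have h1 := h0.continuous hM.Φ_smooth.continuous.abs hρ.smooth.continuous hρ.nonneg
  simp only [smul_eq_mul] at h1
  have h2 : Continuous fun q => ∫ y : X d, |M.Φ (q - y.1)| * ρ y := by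
    simpa only [mul_comm] using h1
  have := hM.V_smooth.continuous
  have h3 : Continuous fun x : X d => ∫ y : X d, |M.Φ (x.1 - y.1)| * ρ y := h2.comp continuous_fst
  unfold weight
  exact (by fun_prop : Continuous fun x : X d => 1 + ‖x.2‖ ^ 2 / (2 * M.mass) + |M.V x.1|).add h3

omit hM in
lemma weight_aux_nonneg (q : P d) : 0 ≤ ∫ y : X d, |M.Φ (q - y.1)| * ρ y :=
  integral_nonneg fun y => mul_nonneg (abs_nonneg _) (hρ.nonneg y)

omit hρ in
lemma kinetic_nonneg (x : X d) : 0 ≤ ‖x.2‖ ^ 2 / (2 * M.mass) := by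
  have := hM.mass_pos
  positivity

lemma one_le_weight (x : X d) : 1 ≤ M.weight ρ x := by
  have := kinetic_nonneg hM x
  have := weight_aux_nonneg hρ x.1
  have := abs_nonneg (M.V x.1)
  unfold weight
  linarith

lemma weight_nonneg (x : X d) : 0 ≤ M.weight ρ x := zero_le_one.trans (one_le_weight hM hρ x)

lemma abs_dEnergy_le (x : X d) : |M.dEnergy ρ x| ≤ M.weight ρ x := by
  have h1 := kinetic_nonneg hM x
  have h2 : |M.conv ρ x.1| ≤ ∫ y : X d, |M.Φ (x.1 - y.1)| * ρ y := by
    refine (abs_integral_le_integral_abs).trans (le_of_eq ?_)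
    simp only [abs_mul, abs_of_pos (hρ.pos _)]
  have h3 := abs_add_three (‖x.2‖ ^ 2 / (2 * M.mass)) (M.V x.1) (M.conv ρ x.1)
  rw [abs_of_nonneg h1] at h3
  unfold dEnergy weight
  linarith

lemma dEnergy_mem : M.dEnergy ρ ∈ M.cot ρ := by
  refine ⟨contDiff_dEnergy hM hρ, 1, fun x => ⟨?_, ?_⟩⟩
  · rw [one_mul]
    exact abs_dEnergy_le hM hρ x
  · rw [one_mul]
    linarith

/-- Compactly supported `C²` functions are cotangent vectors. -/
lemma mem_cot_of_hasCompactSupport {f : X d → ℝ} (hf : ContDiff ℝ 2 f) (hc : HasCompactSupport f) :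
    f ∈ M.cot ρ := by
  obtain ⟨A, hA⟩ := hf.continuous.bounded_above_of_compact_support hc
  obtain ⟨B, hB⟩ := (hf.continuous_fderiv two_ne_zero).bounded_above_of_compact_support
    (hc.fderiv ℝ)
  have hA0 : 0 ≤ A := (norm_nonneg _).trans (hA 0)
  have hB0 : 0 ≤ B := (norm_nonneg _).trans (hB 0)
  refine ⟨hf, A + B, fun x => ⟨?_, ?_⟩⟩
  · have := hA x
    rw [Real.norm_eq_abs] at this
    nlinarith [one_le_weight hM hρ x]
  · nlinarith [hB x, norm_nonneg (fderiv ℝ (M.dEnergy ρ) x)]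

lemma const_mem_cot (c : ℝ) : (fun _ => c) ∈ M.cot ρ := by
  refine ⟨contDiff_const, |c|, fun x => ⟨?_, ?_⟩⟩
  · nlinarith [one_le_weight hM hρ x, abs_nonneg c]
  · simp only [fderiv_fun_const, Pi.zero_apply, norm_zero]
    positivity

/-- Functions that grow like `w (1 + |∇dE|)² ρ` are integrable, also against the weight `w`. -/
lemma integrable_of_le {f : X d → ℝ} (hf : AEStronglyMeasurable f) (C : ℝ)
    (h : ∀ x, |f x| ≤ C * (M.weight ρ x * (1 + ‖fderiv ℝ (M.dEnergy ρ) x‖) ^ 2 * ρ x)) :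
    Integrable f ∧ Integrable fun x => M.weight ρ x * f x := by
  have hw := one_le_weight hM hρ
  have h2 : ∀ x, |M.weight ρ x * f x| ≤
      C * (M.weight ρ x ^ 2 * (1 + ‖fderiv ℝ (M.dEnergy ρ) x‖) ^ 2 * ρ x) := by
    intro x
    rw [abs_mul, abs_of_nonneg (weight_nonneg hM hρ x)]
    refine (mul_le_mul_of_nonneg_left (h x) (weight_nonneg hM hρ x)).trans (le_of_eq (by ring))
  have hI : Integrable fun x => M.weight ρ x * f x :=
    (hρ.moments.const_mul C).mono' ((continuous_weight hM hρ).aestronglyMeasurable.mul hf)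
      (Eventually.of_forall h2)
  refine ⟨hI.mono hf (Eventually.of_forall fun x => ?_), hI⟩
  rw [norm_mul, Real.norm_eq_abs (M.weight ρ x), abs_of_nonneg (weight_nonneg hM hρ x)]
  exact le_mul_of_one_le_left (norm_nonneg _) (hw x)

/-- Functions that grow like `w ρ` are integrable, also against the weight `w`. -/
lemma integrable_of_le_weight {f : X d → ℝ} (hf : AEStronglyMeasurable f) (C : ℝ)
    (h : ∀ x, |f x| ≤ C * (M.weight ρ x * ρ x)) :
    Integrable f ∧ Integrable fun x => M.weight ρ x * f x := by
  refine integrable_of_le hM hρ hf |C| fun x => (h x).trans ?_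
  have h1 : 0 ≤ M.weight ρ x * ρ x := mul_nonneg (weight_nonneg hM hρ x) (hρ.nonneg x)
  have h2 : (1 : ℝ) ≤ (1 + ‖fderiv ℝ (M.dEnergy ρ) x‖) ^ 2 :=
    one_le_pow₀ (by linarith [norm_nonneg (fderiv ℝ (M.dEnergy ρ) x)])
  calc C * (M.weight ρ x * ρ x) ≤ |C| * (M.weight ρ x * ρ x) := by gcongr; exact le_abs_self C
    _ ≤ |C| * ((M.weight ρ x * ρ x) * (1 + ‖fderiv ℝ (M.dEnergy ρ) x‖) ^ 2) := by
      exact mul_le_mul_of_nonneg_left (le_mul_of_one_le_right h1 h2) (abs_nonneg C)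
    _ = _ := by ring

lemma log_mem_cot : (fun x => Real.log (ρ x) + 1) ∈ M.cot ρ := by
  have : (fun x => Real.log (ρ x) + 1) = M.dEntropy ρ - M.dEnergy ρ := by
    funext x
    simp [dEntropy]
  rw [this]
  exact (M.cot ρ).sub_mem hρ.dEntropy_mem (dEnergy_mem hM hρ)

omit hM in
lemma fderiv_log_add_one (x : X d) :
    fderiv ℝ (fun y => Real.log (ρ y) + 1) x = (ρ x)⁻¹ • fderiv ℝ ρ x := by
  rw [fderiv_add_const]
  exact fderiv.log (hρ.smooth.differentiable (by norm_num) x) (hρ.pos x).ne'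

/-- The gradient of the density is controlled by the density itself and the force. -/
lemma exists_norm_fderiv_le : ∃ C, 0 ≤ C ∧ ∀ x,
    ‖fderiv ℝ ρ x‖ ≤ C * (ρ x * (1 + ‖fderiv ℝ (M.dEnergy ρ) x‖)) := by
  obtain ⟨-, C, hC⟩ := log_mem_cot hM hρ
  refine ⟨|C|, abs_nonneg C, fun x => ?_⟩
  have h1 := (hC x).2
  rw [fderiv_log_add_one hρ, norm_smul, norm_inv, Real.norm_eq_abs, abs_of_pos (hρ.pos x),
    inv_mul_le_iff₀ (hρ.pos x)] at h1
  refine h1.trans ?_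
  have : 0 ≤ ρ x * (1 + ‖fderiv ℝ (M.dEnergy ρ) x‖) :=
    mul_nonneg (hρ.nonneg x) (by positivity)
  calc _ = C * (ρ x * (1 + ‖fderiv ℝ (M.dEnergy ρ) x‖)) := by ring
    _ ≤ _ := by gcongr; exact le_abs_self C

omit hM hρ in
/-- The bounds of a cotangent vector, with a nonnegative constant. -/
lemma exists_bound_of_mem_cot (hw : ∀ x, 0 ≤ M.weight ρ x) {ξ : X d → ℝ} (hξ : ξ ∈ M.cot ρ) :
    ContDiff ℝ 2 ξ ∧ ∃ C, 0 ≤ C ∧ ∀ x, |ξ x| ≤ C * M.weight ρ x ∧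
      ‖fderiv ℝ ξ x‖ ≤ C * (1 + ‖fderiv ℝ (M.dEnergy ρ) x‖) := by
  obtain ⟨h, C, hC⟩ := hξ
  refine ⟨h, |C|, abs_nonneg C, fun x => ⟨(hC x).1.trans ?_, (hC x).2.trans ?_⟩⟩
  · gcongr
    · exact hw x
    · exact le_abs_self C
  · gcongr
    exact le_abs_self C

/-! ### The Poisson operator -/

lemma exists_abs_pb_density_le {ξ : X d → ℝ} (hξ : ξ ∈ M.cot ρ) : ∃ C, 0 ≤ C ∧ ∀ x,
    |pb ξ ρ x| ≤ C * ((1 + ‖fderiv ℝ (M.dEnergy ρ) x‖) ^ 2 * ρ x) := by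
  obtain ⟨C, hC0, hC⟩ := exists_norm_fderiv_le hM hρ
  obtain ⟨h, D, hD0, hD⟩ := exists_bound_of_mem_cot (weight_nonneg hM hρ) hξ
  refine ⟨2 * d * (D * C), by positivity, fun x => (abs_pb_le ξ ρ x).trans ?_⟩
  have h0 := hρ.nonneg x
  calc _ ≤ 2 * d * ((D * (1 + ‖fderiv ℝ (M.dEnergy ρ) x‖)) *
        (C * (ρ x * (1 + ‖fderiv ℝ (M.dEnergy ρ) x‖)))) := by
        gcongr
        · exact (hD x).2
        · exact hC x
    _ = _ := by ring

lemma integrable_mul_pb_density {ξ η : X d → ℝ} (hξ : ξ ∈ M.cot ρ) (hη : η ∈ M.cot ρ) :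
    Integrable fun x => η x * pb ξ ρ x := by
  obtain ⟨C, hC0, hC⟩ := exists_abs_pb_density_le hM hρ hξ
  obtain ⟨h, D, hD0, hD⟩ := exists_bound_of_mem_cot (weight_nonneg hM hρ) hη
  refine (integrable_of_le hM hρ (h.continuous.mul
    (continuous_pb (hξ.1.of_le one_le_two) hρ.contDiff_one)).aestronglyMeasurable (D * C)
    fun x => ?_).1
  rw [Pi.mul_apply, abs_mul]
  calc _ ≤ (D * M.weight ρ x) * (C * ((1 + ‖fderiv ℝ (M.dEnergy ρ) x‖) ^ 2 * ρ x)) := by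
        have := weight_nonneg hM hρ x
        gcongr
        · exact (hD x).1
        · exact hC x
    _ = _ := by ring

lemma integrable_density_mul_pb {ξ η : X d → ℝ} (hξ : ξ ∈ M.cot ρ) (hη : η ∈ M.cot ρ) :
    Integrable fun x => ρ x * pb η ξ x := by
  obtain ⟨hξ', C, hC0, hC⟩ := exists_bound_of_mem_cot (weight_nonneg hM hρ) hξ
  obtain ⟨hη', D, hD0, hD⟩ := exists_bound_of_mem_cot (weight_nonneg hM hρ) hη
  refine (integrable_of_le hM hρ (hρ.smooth.continuous.mul
    (continuous_pb (hη'.of_le one_le_two) (hξ'.of_le one_le_two))).aestronglyMeasurable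
    (2 * d * (D * C)) fun x => ?_).1
  rw [Pi.mul_apply, abs_mul, abs_of_pos (hρ.pos x)]
  have h0 := hρ.nonneg x
  calc _ ≤ ρ x * (2 * d * ((D * (1 + ‖fderiv ℝ (M.dEnergy ρ) x‖)) *
        (C * (1 + ‖fderiv ℝ (M.dEnergy ρ) x‖)))) := by
        gcongr
        refine (abs_pb_le η ξ x).trans ?_
        gcongr
        · exact (hD x).2
        · exact (hC x).2
    _ = 2 * d * (D * C) * (1 * (1 + ‖fderiv ℝ (M.dEnergy ρ) x‖) ^ 2 * ρ x) := by ring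
    _ ≤ _ := by
        gcongr
        exact one_le_weight hM hρ x

/-- The weak form of the Poisson operator: `⟨L(ρ) ξ, η⟩ = ∫ ρ {η, ξ}`. -/
lemma integral_mul_poisson {ξ η : X d → ℝ} (hξ : ξ ∈ M.cot ρ) (hη : η ∈ M.cot ρ) :
    ∫ x, η x * poisson ρ ξ x = ∫ x, ρ x * pb η ξ x := by
  have hρd : Differentiable ℝ ρ := hρ.smooth.differentiable (by norm_num)
  have hηd : Differentiable ℝ η := hη.1.differentiable (by norm_num)
  obtain ⟨hξ', C, hC0, hC⟩ := exists_bound_of_mem_cot (weight_nonneg hM hρ) hξ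
  obtain ⟨hη', D, hD0, hD⟩ := exists_bound_of_mem_cot (weight_nonneg hM hρ) hη
  have hI1 := integrable_mul_pb_density hM hρ hξ hη
  have hI2 := integrable_density_mul_pb hM hρ hξ hη
  have hpb : ∀ x, pb (fun y => ρ y * η y) ξ x = ρ x * pb η ξ x - η x * pb ξ ρ x := fun x => by
    rw [pb_mul_left (hρd x) (hηd x), pb_antisymm ρ ξ]
    ring
  have h0 := integral_pb_eq_zero (η := fun y => ρ y * η y) (ξ := ξ)
    (hρ.contDiff_one.mul (hη'.of_le one_le_two)) hξ' ?_ ?_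
  · simp only [hpb] at h0
    rw [integral_sub hI2 hI1, sub_eq_zero] at h0
    rw [h0, poisson_eq_pb hρ.contDiff_one hξ']
  · refine (integrable_of_le hM hρ ((hρ.smooth.continuous.mul hη'.continuous).mul
      (hξ'.continuous_fderiv two_ne_zero).norm).aestronglyMeasurable (D * C) fun x => ?_).1
    simp only [Pi.mul_apply]
    rw [abs_mul, abs_mul, abs_of_pos (hρ.pos x), abs_norm]
    have h0 := hρ.nonneg x
    have hw := weight_nonneg hM hρ x
    have h1 : (1 + ‖fderiv ℝ (M.dEnergy ρ) x‖) ≤ (1 + ‖fderiv ℝ (M.dEnergy ρ) x‖) ^ 2 :=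
      le_self_pow₀ (by linarith [norm_nonneg (fderiv ℝ (M.dEnergy ρ) x)]) two_ne_zero
    calc _ ≤ ρ x * (D * M.weight ρ x) * (C * (1 + ‖fderiv ℝ (M.dEnergy ρ) x‖)) := by
          gcongr
          · exact (hD x).1
          · exact (hC x).2
      _ = D * C * (M.weight ρ x * (1 + ‖fderiv ℝ (M.dEnergy ρ) x‖) * ρ x) := by ring
      _ ≤ _ := by gcongr
  · rw [show pb (fun y => ρ y * η y) ξ = fun x => ρ x * pb η ξ x - η x * pb ξ ρ x from funext hpb]
    exact hI2.sub hI1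

lemma poisson_mem_tan {ξ : X d → ℝ} (hξ : ξ ∈ M.cot ρ) : poisson ρ ξ ∈ M.tan ρ := by
  obtain ⟨C, hC0, hC⟩ := exists_abs_pb_density_le hM hρ hξ
  have hI := integrable_of_le hM hρ
    (continuous_pb (hξ.1.of_le one_le_two) hρ.contDiff_one).aestronglyMeasurable C
    fun x => (hC x).trans (by
      rw [mul_assoc]
      have := hρ.nonneg x
      exact mul_le_mul_of_nonneg_left
        (le_mul_of_one_le_left (by positivity) (one_le_weight hM hρ x)) hC0)
  rw [← poisson_eq_pb hρ.contDiff_one hξ.1] at hI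
  refine ⟨hI.1, hI.2, ?_⟩
  have := integral_mul_poisson hM hρ hξ (const_mem_cot hM hρ 1)
  simp only [one_mul] at this
  rw [this]
  have h0 : ∀ x : X d, pb (fun _ => (1 : ℝ)) ξ x = 0 := fun x => by
    rw [← fderiv_hamField]
    simp
  simp [h0]

lemma pair_poisson_antisymm {ξ η : X d → ℝ} (hξ : ξ ∈ M.cot ρ) (hη : η ∈ M.cot ρ) :
    pair (poisson ρ ξ) η = -pair (poisson ρ η) ξ := by
  unfold pair
  rw [integral_mul_poisson hM hρ hξ hη, integral_mul_poisson hM hρ hη hξ, ← integral_neg]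
  simp only [pb_antisymm η ξ, mul_neg]

omit hM in
lemma poisson_linear {ξ η : X d → ℝ} (hξ : ξ ∈ M.cot ρ) (hη : η ∈ M.cot ρ) (a : ℝ) :
    poisson ρ (a • ξ + η) = a • poisson ρ ξ + poisson ρ η := by
  have hξd : Differentiable ℝ ξ := hξ.1.differentiable (by norm_num)
  have hηd : Differentiable ℝ η := hη.1.differentiable (by norm_num)
  rw [poisson_eq_pb hρ.contDiff_one ((M.cot ρ).add_mem ((M.cot ρ).smul_mem a hξ) hη).1,
    poisson_eq_pb hρ.contDiff_one hξ.1, poisson_eq_pb hρ.contDiff_one hη.1]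
  funext x
  change pb (fun y => a * ξ y + η y) ρ x = a * pb ξ ρ x + pb η ρ x
  rw [pb_add_left ((hξd x).const_mul a) (hηd x), pb_const_mul_left (hξd x)]

lemma poisson_log : poisson ρ (fun x => Real.log (ρ x) + 1) = 0 := by
  rw [poisson_eq_pb hρ.contDiff_one (log_mem_cot hM hρ).1]
  funext x
  rw [← fderiv_hamField, fderiv_log_add_one hρ]
  have : pb ρ ρ x = 0 := by linarith [pb_antisymm ρ ρ x]
  simp [fderiv_hamField, this]

omit hM hρ in
lemma gradP_dEnergy (x : X d) : gradP (M.dEnergy ρ) x = M.mass⁻¹ • x.2 := by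
  have h1 : HasGradientAt (fun p => M.dEnergy ρ (x.1, p)) (M.mass⁻¹ • x.2) x.2 := by
    rw [hasGradientAt_iff_hasFDerivAt]
    have := (((hasStrictFDerivAt_norm_sq x.2).hasFDerivAt.mul_const (2 * M.mass)⁻¹).add_const
      (M.V x.1)).add_const (M.conv ρ x.1)
    refine this.congr_fderiv ?_
    ext v
    simp
    ring
  exact h1.gradient

lemma gradQ_dEnergy (x : X d) : gradQ (M.dEnergy ρ) x =
    gradient M.V x.1 + ∫ y : X d, ρ y • gradient M.Φ (x.1 - y.1) := by
  have hd := (hρ.locDominated.mono one_le_two).hasFDerivAt (hM.Φ_smooth.of_le one_le_two)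
    hρ.smooth.continuous hρ.nonneg x.1
  have hΦ1 := (hρ.locDominated.fderiv (n := 1)).integrable
    (hM.Φ_smooth.continuous_fderiv two_ne_zero) hρ.smooth.continuous hρ.nonneg x.1
  have hgr : (∫ y : X d, ρ y • gradient M.Φ (x.1 - y.1)) =
      (InnerProductSpace.toDual ℝ (P d)).symm (∫ y : X d, ρ y • fderiv ℝ M.Φ (x.1 - y.1)) := by
    let T : StrongDual ℝ (P d) →L[ℝ] P d :=
      { toFun := (InnerProductSpace.toDual ℝ (P d)).symm
        map_add' := fun f g => map_add _ f g
        map_smul' := fun c f => by simp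
        cont := (InnerProductSpace.toDual ℝ (P d)).symm.continuous }
    have := T.integral_comp_comm hΦ1
    simpa [T, gradient] using this
  have h1 : HasGradientAt (fun q => M.dEnergy ρ (q, x.2))
      (gradient M.V x.1 + ∫ y : X d, ρ y • gradient M.Φ (x.1 - y.1)) x.1 := by
    rw [hasGradientAt_iff_hasFDerivAt]
    have hV : HasFDerivAt M.V (fderiv ℝ M.V x.1) x.1 :=
      (hM.V_smooth.differentiable (by norm_num) x.1).hasFDerivAt
    rw [← conv_eq] at hd
    refine ((hV.const_add (‖x.2‖ ^ 2 / (2 * M.mass))).add hd).congr_fderiv ?_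
    rw [map_add, hgr, gradient]
    simp
  exact h1.gradient

/-- The drift consists of the Hamiltonian part generated by the energy and the image of `𝒢*`. -/
lemma drift_eq : M.drift ρ = poisson ρ (M.dEnergy ρ) + M.adjointGen ρ := by
  funext x
  simp only [drift, poisson, Pi.add_apply]
  simp only [gradP_dEnergy, gradQ_dEnergy hM hρ, smul_add]

end Model

namespace Model

variable {M : Model d} {H₂ : (X d → ℝ) → (X d → ℝ) → ℝ} {ρ : X d → ℝ}

/-! ### The differentials of energy and entropy -/

section Differentials

variable (hM : M.Condition H₂) (hρ : M.IsState ρ)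
include hM hρ

/-- Pairings of tangent and cotangent vectors are integrals of integrable functions. -/
lemma integrable_pair {v ξ : X d → ℝ} (hv : v ∈ M.tan ρ) (hξ : ξ ∈ M.cot ρ) :
    Integrable fun x => ξ x * v x := by
  obtain ⟨h, C, hC0, hC⟩ := exists_bound_of_mem_cot (weight_nonneg hM hρ) hξ
  refine (hv.2.1.norm.const_mul C).mono' (h.continuous.aestronglyMeasurable.mul hv.1.1)
    (Eventually.of_forall fun x => ?_)
  rw [norm_mul, norm_mul, Real.norm_eq_abs (M.weight ρ x), abs_of_nonneg (weight_nonneg hM hρ x),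
    ← mul_assoc]
  gcongr
  exact (hC x).1

lemma integrable_mul_density {ξ : X d → ℝ} (hξ : ξ ∈ M.cot ρ) : Integrable fun x => ξ x * ρ x := by
  obtain ⟨h, C, hC0, hC⟩ := exists_bound_of_mem_cot (weight_nonneg hM hρ) hξ
  refine (integrable_of_le_weight hM hρ (h.continuous.mul hρ.smooth.continuous).aestronglyMeasurable
    C fun x => ?_).1
  rw [Pi.mul_apply, abs_mul, abs_of_pos (hρ.pos x), ← mul_assoc]
  exact mul_le_mul_of_nonneg_right (hC x).1 (hρ.nonneg x)

variable {b : X d → ℝ} (hb : Continuous b) (hc : HasCompactSupport b)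
include hb hc

omit hM hb in
/-- Symmetry of the interaction energy of `ρ` and a compactly supported perturbation. -/
lemma integral_conv_symm (hΦc : Continuous M.Φ) (hΦ : ∀ q, M.Φ (-q) = M.Φ q) (hb : Continuous b) :
    ∫ x, M.conv (fun y => b y * ρ y) x.1 * ρ x = ∫ x, M.conv ρ x.1 * (b x * ρ x) := by
  obtain ⟨C, hC⟩ := hb.bounded_above_of_compact_support hc
  obtain ⟨R, hR0, hR⟩ : ∃ R : ℝ, 0 ≤ R ∧ ∀ x, b x ≠ 0 → ‖x.1‖ ≤ R := by
    obtain ⟨R, hR⟩ := hc.isCompact.isBounded.exists_norm_le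
    refine ⟨max R 0, le_max_right _ _, fun x hx => ?_⟩
    exact (norm_fst_le x).trans ((hR x (subset_tsupport _ hx)).trans (le_max_left _ _))
  obtain ⟨B, hB, hK⟩ := hρ.interaction R
  have hK0 : ∀ q q' : P d, ‖q‖ ≤ R → |M.Φ (q - q')| ≤ B q' := fun q q' hq => by
    have := hK q q' hq 0 (by omega)
    rwa [norm_iteratedFDeriv_zero] at this
  have hB0 : ∀ q, 0 ≤ B q := fun q => (abs_nonneg _).trans (hK0 0 q (by simpa using hR0))
  have hC0 : 0 ≤ C := (norm_nonneg _).trans (hC 0)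
  have hρc := hρ.smooth.continuous
  have hI : Integrable (fun z : X d × X d => M.Φ (z.1.1 - z.2.1) * (b z.2 * ρ z.2) * ρ z.1)
      (volume.prod volume) := by
    refine ((hB.mul_prod (hρ.integrable.const_mul C))).mono'
      (Continuous.aestronglyMeasurable (by fun_prop)) (Eventually.of_forall fun z => ?_)
    rw [norm_mul, norm_mul, norm_mul, Real.norm_of_nonneg (hρ.nonneg z.1),
      Real.norm_of_nonneg (hρ.nonneg z.2)]
    have h1 := hρ.nonneg z.1
    have h2 := hρ.nonneg z.2
    by_cases hz : b z.2 = 0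
    · rw [hz]
      simp only [norm_zero, zero_mul, mul_zero]
      have := hB0 z.1.1
      positivity
    · have h3 : ‖M.Φ (z.1.1 - z.2.1)‖ ≤ B z.1.1 := by
        rw [← hΦ, neg_sub]
        exact hK0 _ _ (hR _ hz)
      calc _ ≤ B z.1.1 * (C * ρ z.2) * ρ z.1 := by
            have := hB0 z.1.1
            gcongr
            exact hC z.2
        _ = _ := by ring
  have h1 : ∀ x : X d, M.conv (fun y => b y * ρ y) x.1 * ρ x =
      ∫ y, M.Φ (x.1 - y.1) * (b y * ρ y) * ρ x := fun x => by
    rw [integral_mul_const]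
    rfl
  have h2 : ∀ y : X d, M.conv ρ y.1 * (b y * ρ y) =
      ∫ x, M.Φ (x.1 - y.1) * (b y * ρ y) * ρ x := fun y => by
    rw [conv, ← integral_mul_const]
    refine integral_congr_ae (Eventually.of_forall fun x => ?_)
    change M.Φ (y.1 - x.1) * ρ x * (b y * ρ y) = _
    rw [← hΦ, neg_sub]
    ring
  simp only [h1, h2]
  exact integral_integral_swap hI

/-- Along a line the energy is a quadratic polynomial. -/
lemma energy_line (t : ℝ) : M.energy (fun x => ρ x + t * (b x * ρ x)) =
    M.energy ρ + t * (∫ x, M.dEnergy ρ x * (b x * ρ x)) +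
      t ^ 2 * (1 / 2 * ∫ x, M.conv (fun y => b y * ρ y) x.1 * (b x * ρ x)) := by
  obtain ⟨C, hC⟩ := hb.bounded_above_of_compact_support hc
  have hC0 : 0 ≤ C := (norm_nonneg _).trans (hC 0)
  have hρc := hρ.smooth.continuous
  have hVc := hM.V_smooth.continuous
  have hΦc := hM.Φ_smooth.continuous
  have hcc := (contDiff_conv hM hρ).continuous
  let a : X d → ℝ := fun y => b y * ρ y
  let K : X d → ℝ := fun x => ‖x.2‖ ^ 2 / (2 * M.mass) + M.V x.1
  have hw0 := weight_nonneg hM hρ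
  have haux := weight_aux_nonneg hρ
  have hΦa : ∀ q, Integrable fun x : X d => M.Φ (q - x.1) * a x := fun q => by
    refine ((integrable_interaction hM hρ q).norm.const_mul C).mono'
      (Continuous.aestronglyMeasurable (by fun_prop)) (Eventually.of_forall fun x => ?_)
    simp only [a, norm_mul]
    rw [mul_left_comm]
    gcongr
    exact hC x
  have hconv : ∀ q, M.conv (fun x => ρ x + t * a x) q = M.conv ρ q + t * M.conv a q := fun q => by
    simp only [conv, mul_add]
    rw [integral_add (integrable_interaction hM hρ q), ← integral_const_mul]
    · simp only [mul_left_comm]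
    · simpa only [mul_left_comm] using (hΦa q).const_mul t
  have hca : ∀ q, |M.conv a q| ≤ C * ∫ y : X d, |M.Φ (q - y.1)| * ρ y := fun q => by
    rw [conv, ← integral_const_mul, ← Real.norm_eq_abs]
    refine norm_integral_le_of_norm_le ?_ (Eventually.of_forall fun x => ?_)
    · have := (integrable_interaction hM hρ q).norm.const_mul C
      simpa only [norm_mul, Real.norm_eq_abs, abs_of_pos (hρ.pos _)] using this
    · simp only [a, norm_mul, Real.norm_eq_abs, abs_of_pos (hρ.pos _)]
      rw [mul_left_comm]
      have := hρ.nonneg x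
      gcongr
      exact hC x
  have hcm : AEStronglyMeasurable fun x : X d => M.conv a x.1 := by
    refine (StronglyMeasurable.integral_prod_right'
      (f := fun z : X d × X d => M.Φ (z.1.1 - z.2.1) * a z.2) ?_).aestronglyMeasurable
    exact Continuous.stronglyMeasurable (by fun_prop)
  -- all the functions that are paired with `ρ` and with `b ρ` are bounded by the weight
  have hk := kinetic_nonneg hM
  have hKw : ∀ x, |K x| ≤ 1 * M.weight ρ x := fun x => by
    have := abs_add_le (‖x.2‖ ^ 2 / (2 * M.mass)) (M.V x.1)
    rw [abs_of_nonneg (hk x)] at this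
    have := haux x.1
    simp only [K, weight]
    linarith
  have hcw : ∀ x : X d, |M.conv ρ x.1| ≤ 1 * M.weight ρ x := fun x => by
    have h2 : |M.conv ρ x.1| ≤ ∫ y : X d, |M.Φ (x.1 - y.1)| * ρ y := by
      refine (abs_integral_le_integral_abs).trans (le_of_eq ?_)
      simp only [abs_mul, abs_of_pos (hρ.pos _)]
    have := hk x
    have := abs_nonneg (M.V x.1)
    simp only [weight]
    linarith
  have hcaw : ∀ x : X d, |M.conv a x.1| ≤ C * M.weight ρ x := fun x => by
    refine (hca x.1).trans ?_
    have := hk x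
    have := abs_nonneg (M.V x.1)
    simp only [weight]
    gcongr
    linarith
  have hIρ : ∀ {f : X d → ℝ} {D : ℝ}, AEStronglyMeasurable f → (∀ x, |f x| ≤ D * M.weight ρ x) →
      Integrable fun x => f x * ρ x := fun {f D} hf hD =>
    (integrable_of_le_weight hM hρ (hf.mul hρc.aestronglyMeasurable) D fun x => by
      rw [Pi.mul_apply, abs_mul, abs_of_pos (hρ.pos x), ← mul_assoc]
      exact mul_le_mul_of_nonneg_right (hD x) (hρ.nonneg x)).1
  have hIa : ∀ {f : X d → ℝ} {D : ℝ}, AEStronglyMeasurable f → (∀ x, |f x| ≤ D * M.weight ρ x) →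
      Integrable fun x => f x * a x := fun {f D} hf hD => by
    have := (hIρ hf hD).norm.const_mul C
    refine this.mono' (hf.mul (Continuous.aestronglyMeasurable (by fun_prop)))
      (Eventually.of_forall fun x => ?_)
    simp only [a, norm_mul]
    rw [mul_left_comm]
    gcongr
    exact hC x
  have mK : AEStronglyMeasurable K := Continuous.aestronglyMeasurable (by fun_prop)
  have mc : AEStronglyMeasurable fun x : X d => M.conv ρ x.1 :=
    Continuous.aestronglyMeasurable (by fun_prop)
  have e1 := hIρ mK hKw
  have e2 := hIρ mc hcw
  have e3 := hIρ hcm hcaw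
  have e4 := hIa mK hKw
  have e5 := hIa mc hcw
  have e6 := hIa hcm hcaw
  have hsymm : ∫ x, M.conv a x.1 * ρ x = ∫ x, M.conv ρ x.1 * a x :=
    integral_conv_symm hρ hc hΦc hM.Φ_even hb
  have hE0 : M.energy ρ = (∫ x, K x * ρ x) + 1 / 2 * ∫ x, M.conv ρ x.1 * ρ x := by
    rw [← integral_const_mul, ← integral_add e1 (e2.const_mul _)]
    exact integral_congr_ae (Eventually.of_forall fun x => by simp only [K]; ring)
  have hd0 : ∫ x, M.dEnergy ρ x * a x = (∫ x, K x * a x) + ∫ x, M.conv ρ x.1 * a x := by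
    rw [← integral_add e4 e5]
    exact integral_congr_ae (Eventually.of_forall fun x => by simp only [K, dEnergy]; ring)
  have hEt : M.energy (fun x => ρ x + t * a x) =
      (∫ x, K x * ρ x) + 1 / 2 * (∫ x, M.conv ρ x.1 * ρ x) +
      t / 2 * (∫ x, M.conv a x.1 * ρ x) + t * (∫ x, K x * a x) +
      t / 2 * (∫ x, M.conv ρ x.1 * a x) + t ^ 2 / 2 * (∫ x, M.conv a x.1 * a x) := by
    have s2 : Integrable fun x => K x * ρ x + 1 / 2 * (M.conv ρ x.1 * ρ x) :=
      e1.add (e2.const_mul _)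
    have s3 : Integrable fun x => K x * ρ x + 1 / 2 * (M.conv ρ x.1 * ρ x) +
      t / 2 * (M.conv a x.1 * ρ x) := s2.add (e3.const_mul _)
    have s4 : Integrable fun x => K x * ρ x + 1 / 2 * (M.conv ρ x.1 * ρ x) +
      t / 2 * (M.conv a x.1 * ρ x) + t * (K x * a x) := s3.add (e4.const_mul _)
    have s5 : Integrable fun x => K x * ρ x + 1 / 2 * (M.conv ρ x.1 * ρ x) +
      t / 2 * (M.conv a x.1 * ρ x) + t * (K x * a x) + t / 2 * (M.conv ρ x.1 * a x) :=
      s4.add (e5.const_mul _)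
    rw [← integral_const_mul, ← integral_const_mul, ← integral_const_mul, ← integral_const_mul,
      ← integral_const_mul, ← integral_add e1 (e2.const_mul _), ← integral_add s2 (e3.const_mul _),
      ← integral_add s3 (e4.const_mul _), ← integral_add s4 (e5.const_mul _),
      ← integral_add s5 (e6.const_mul _)]
    refine integral_congr_ae (Eventually.of_forall fun x => ?_)
    simp only [hconv, K]
    ring
  change M.energy (fun x => ρ x + t * a x) = M.energy ρ + t * (∫ x, M.dEnergy ρ x * a x) +
      t ^ 2 * (1 / 2 * ∫ x, M.conv a x.1 * a x)
  rw [hEt, hE0, hd0, hsymm]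
  ring

/-- The negative Boltzmann entropy is `C¹` along lines in compactly supported directions. -/
lemma exists_hasDerivAt_boltzmann : ∃ J : ℝ → ℝ, ∃ δ > 0, ContinuousOn J (Metric.ball 0 δ) ∧
    J 0 = ∫ x, (Real.log (ρ x) + 1) * (b x * ρ x) ∧ ∀ t ∈ Metric.ball (0 : ℝ) δ,
      HasDerivAt (fun t : ℝ => ∫ x, Real.log (ρ x + t * (b x * ρ x)) * (ρ x + t * (b x * ρ x)))
        (J t) t := by
  obtain ⟨C, hC⟩ := hb.bounded_above_of_compact_support hc
  have hC0 : 0 ≤ C := (norm_nonneg _).trans (hC 0)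
  have hρc := hρ.smooth.continuous
  have hδ : (0 : ℝ) < (2 * (C + 1))⁻¹ := by positivity
  -- for such `t` the density is multiplied by a factor between `1/2` and `3/2`
  have htb : ∀ t ∈ Metric.ball (0 : ℝ) (2 * (C + 1))⁻¹, ∀ x, |t * b x| ≤ 1 / 2 := by
    intro t ht x
    rw [mem_ball_zero_iff, Real.norm_eq_abs] at ht
    rw [abs_mul]
    calc |t| * |b x| ≤ (2 * (C + 1))⁻¹ * (C + 1) := by
          gcongr
          exact (hC x).trans (by linarith)
      _ = 1 / 2 := by field_simp
  have hlogt : ∀ t ∈ Metric.ball (0 : ℝ) (2 * (C + 1))⁻¹, ∀ x,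
      0 < ρ x + t * (b x * ρ x) ∧ ρ x + t * (b x * ρ x) ≤ 2 * ρ x ∧
      |Real.log (ρ x + t * (b x * ρ x))| ≤ |Real.log (ρ x)| + 1 := by
    intro t ht x
    have h1 := abs_le.1 (htb t ht x)
    have h2 : ρ x + t * (b x * ρ x) = ρ x * (1 + t * b x) := by ring
    have h3 : 0 < 1 + t * b x := by linarith
    have hpos := hρ.pos x
    refine ⟨by rw [h2]; positivity, by rw [h2]; nlinarith, ?_⟩
    rw [h2, Real.log_mul hpos.ne' h3.ne']
    refine (abs_add_le _ _).trans (by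
      gcongr
      rw [abs_le]
      constructor
      · have := Real.one_sub_inv_le_log_of_pos h3
        have h4 : (1 + t * b x)⁻¹ ≤ 2 := by
          rw [inv_le_comm₀ h3 two_pos]
          linarith
        linarith
      · linarith [Real.log_le_sub_one_of_pos h3])
  have hLI : Integrable fun x => (|Real.log (ρ x)| + 2) * ρ x := by
    have h := (integrable_mul_density hM hρ (log_mem_cot hM hρ)).norm.add
      (hρ.integrable.const_mul 3)
    refine h.mono' (((hρc.log fun x => (hρ.pos x).ne').abs.add continuous_const).mul
      hρc).aestronglyMeasurable (Eventually.of_forall fun x => ?_)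
    have hpos := hρ.pos x
    simp only [Pi.add_apply, norm_mul, Real.norm_eq_abs, abs_of_pos hpos, ← add_mul]
    gcongr
    rw [abs_of_nonneg (by positivity)]
    have := abs_sub_abs_le_abs_sub (Real.log (ρ x)) (-1)
    simp only [abs_neg, abs_one, sub_neg_eq_add] at this
    linarith
  have hmeas : ∀ t : ℝ, AEStronglyMeasurable fun x => Real.log (ρ x + t * (b x * ρ x)) := fun t =>
    (Real.measurable_log.comp (by fun_prop : Continuous fun x =>
      ρ x + t * (b x * ρ x)).measurable).aestronglyMeasurable
  have hmeas' : ∀ t : ℝ, AEStronglyMeasurable fun x =>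
      (Real.log (ρ x + t * (b x * ρ x)) + 1) * (b x * ρ x) := fun t =>
    ((hmeas t).add aestronglyMeasurable_const).mul (Continuous.aestronglyMeasurable (by fun_prop))
  have hbound : ∀ t ∈ Metric.ball (0 : ℝ) (2 * (C + 1))⁻¹, ∀ x,
      ‖(Real.log (ρ x + t * (b x * ρ x)) + 1) * (b x * ρ x)‖ ≤
        C * ((|Real.log (ρ x)| + 2) * ρ x) := by
    intro t ht x
    have hpos := hρ.pos x
    rw [norm_mul, norm_mul, Real.norm_eq_abs (ρ x), abs_of_pos hpos]
    have h1 : ‖Real.log (ρ x + t * (b x * ρ x)) + 1‖ ≤ |Real.log (ρ x)| + 2 := by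
      refine (norm_add_le _ _).trans ?_
      have := (hlogt t ht x).2.2
      rw [norm_one, Real.norm_eq_abs]
      linarith
    calc _ ≤ (|Real.log (ρ x)| + 2) * (C * ρ x) := by
          gcongr
          exact hC x
      _ = _ := by ring
  refine ⟨fun t => ∫ x, (Real.log (ρ x + t * (b x * ρ x)) + 1) * (b x * ρ x), _, hδ, ?_,
    by simp, ?_⟩
  · intro t ht
    refine (continuousAt_of_dominated (Eventually.of_forall hmeas') ?_ (hLI.const_mul C)
      ?_).continuousWithinAt
    · filter_upwards [Metric.isOpen_ball.mem_nhds ht] with t' ht'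
      exact Eventually.of_forall (hbound t' ht')
    · refine Eventually.of_forall fun x => ?_
      have h0 := (hlogt t ht x).1.ne'
      exact (((by fun_prop : Continuous fun t => ρ x + t * (b x * ρ x)).continuousAt.log
        h0).add continuousAt_const).mul continuousAt_const
  · intro t ht
    refine (hasDerivAt_integral_of_dominated_loc_of_deriv_le
      (bound := fun x => C * ((|Real.log (ρ x)| + 2) * ρ x))
      (F' := fun t x => (Real.log (ρ x + t * (b x * ρ x)) + 1) * (b x * ρ x))
      (Metric.isOpen_ball.mem_nhds ht) (Eventually.of_forall fun t => ?_) ?_ (hmeas' t)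
      (Eventually.of_forall fun x t ht => hbound t ht x) (hLI.const_mul C)
      (Eventually.of_forall fun x t ht => ?_)).2
    · exact (hmeas t).mul (Continuous.aestronglyMeasurable (by fun_prop))
    · refine (hLI.const_mul 2).mono' ((hmeas t).mul
        (Continuous.aestronglyMeasurable (by fun_prop))) (Eventually.of_forall fun x => ?_)
      obtain ⟨h1, h2, h3⟩ := hlogt t ht x
      simp only [norm_mul, Real.norm_eq_abs]
      rw [abs_of_pos h1]
      calc _ ≤ (|Real.log (ρ x)| + 2) * (2 * ρ x) := by gcongr; linarith
        _ = _ := by ring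
    · have h1 : HasDerivAt (fun t : ℝ => ρ x + t * (b x * ρ x)) (b x * ρ x) t := by
        simpa using ((hasDerivAt_id t).mul_const (b x * ρ x)).const_add (ρ x)
      have h0 := (hlogt t ht x).1.ne'
      refine ((h1.log h0).mul h1).congr_deriv ?_
      rw [div_mul_cancel₀ _ h0]
      ring

end Differentials

lemma hasDifferential_extEnergy (hM : M.Condition H₂) {z : ExtSpace d} (hz : M.IsState z.1) :
    HasDifferential M.extEnergy z (M.dExtEnergy z) := by
  intro b hb hc _ s
  have h : (fun t : ℝ => M.extEnergy (z + t • ((fun x => b x * z.1 x), s))) = fun t =>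
      M.energy z.1 + t * (∫ x, M.dEnergy z.1 x * (b x * z.1 x)) +
      t ^ 2 * (1 / 2 * ∫ x, M.conv (fun y => b y * z.1 y) x.1 * (b x * z.1 x)) + (z.2 + t * s) := by
    funext t
    rw [← energy_line hM hz hb.continuous hc t]
    rfl
  rw [h]
  constructor
  · fun_prop
  · have h1 := (((hasDerivAt_id (0 : ℝ)).mul_const
      (∫ x, M.dEnergy z.1 x * (b x * z.1 x))).const_add (M.energy z.1)).add
      (((hasDerivAt_id (0 : ℝ)).pow 2).mul_const
        (1 / 2 * ∫ x, M.conv (fun y => b y * z.1 y) x.1 * (b x * z.1 x)))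
    have h2 := h1.add (((hasDerivAt_id (0 : ℝ)).mul_const s).const_add z.2)
    refine h2.congr_deriv ?_
    simp [pairExt, pair, dExtEnergy]

lemma extEntropy_eq (z : ExtSpace d) :
    M.extEntropy z = (∫ x, Real.log (z.1 x) * z.1 x) - z.2 := by
  unfold extEntropy entropy
  ring

lemma dExtEntropy_eq (z : ExtSpace d) :
    M.dExtEntropy z = (fun x => Real.log (z.1 x) + 1, -1) := by
  refine Prod.ext (funext fun x => ?_) rfl
  simp [dExtEntropy, dEntropy]

lemma hasDifferential_extEntropy (hM : M.Condition H₂) {z : ExtSpace d} (hz : M.IsState z.1) :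
    HasDifferential M.extEntropy z (M.dExtEntropy z) := by
  intro b hb hc _ s
  obtain ⟨J, δ, hδ, hJc, hJ0, hJ⟩ := exists_hasDerivAt_boltzmann hM hz hb.continuous hc
  have h : (fun t : ℝ => M.extEntropy (z + t • ((fun x => b x * z.1 x), s))) = fun t =>
      (∫ x, Real.log (z.1 x + t * (b x * z.1 x)) * (z.1 x + t * (b x * z.1 x))) -
        (z.2 + t * s) := by
    funext t
    rw [extEntropy_eq]
    rfl
  rw [h]
  have hd : ∀ t ∈ Metric.ball (0 : ℝ) δ, HasDerivAt (fun t : ℝ =>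
      (∫ x, Real.log (z.1 x + t * (b x * z.1 x)) * (z.1 x + t * (b x * z.1 x))) - (z.2 + t * s))
      (J t - s) t := fun t ht => by
    have := (hJ t ht).sub (((hasDerivAt_id t).mul_const s).const_add z.2)
    exact this.congr_deriv (by simp)
  constructor
  · rw [contDiffAt_one_iff]
    refine ⟨fun t => ContinuousLinearMap.toSpanSingleton ℝ (J t - s), Metric.ball 0 δ,
      Metric.ball_mem_nhds 0 hδ, ?_, fun t ht => (hd t ht).hasFDerivAt⟩
    exact (ContinuousLinearMap.toSpanSingletonCLE (𝕜 := ℝ) (E := ℝ)).continuous.comp_continuousOn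
      (hJc.sub continuousOn_const)
  · refine (hd 0 (Metric.mem_ball_self hδ)).congr_deriv ?_
    rw [hJ0, dExtEntropy_eq]
    simp [pairExt, pair]
    ring

end Model

/-! ### The Jacobi identity -/

lemma apply_prod_zero {l : ℕ} (T : ((Fin l → ℝ) × ℝ) →L[ℝ] ℝ) (v : Fin l → ℝ) :
    T (v, 0) = ∑ i, T (Pi.single i 1, 0) * v i := by
  have := LinearMap.pi_apply_eq_sum_univ
    ((T.comp (ContinuousLinearMap.inl ℝ (Fin l → ℝ) ℝ)) : (Fin l → ℝ) →ₗ[ℝ] ℝ) v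
  simp only [ContinuousLinearMap.coe_coe, ContinuousLinearMap.comp_apply,
    ContinuousLinearMap.inl_apply, smul_eq_mul] at this
  rw [this]
  refine Finset.sum_congr rfl fun i _ => ?_
  rw [mul_comm]
  congr 3
  funext j
  simp [Pi.single_apply, eq_comm]

lemma contDiff_two_of_smooth {E : Type*} [NormedAddCommGroup E] [NormedSpace ℝ E] {f : E → ℝ}
    (h : ContDiff ℝ ∞ f) : ContDiff ℝ 2 f := contDiff_infty.1 h 2

lemma contDiff_one_of_smooth {E : Type*} [NormedAddCommGroup E] [NormedSpace ℝ E] {f : E → ℝ}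
    (h : ContDiff ℝ ∞ f) : ContDiff ℝ 1 f := contDiff_infty.1 h 1

namespace SmoothFunctional

variable (F G H : SmoothFunctional d) (z : ExtSpace d)

/-- The values `(f₁(x), …, f_l(x))` of the test functions of a functional, as a direction in which
the outer function can be differentiated. -/
def testVec (x : X d) : (Fin F.l → ℝ) × ℝ := (fun i => F.f i x, 0)

/-- The second derivative of the outer function. -/
def hess : ((Fin F.l → ℝ) × ℝ) →L[ℝ] ((Fin F.l → ℝ) × ℝ) →L[ℝ] ℝ :=
  fderiv ℝ (fderiv ℝ F.φ) (F.arg z)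

/-- The brackets of the linear functionals `∫ f₁ ρ, …, ∫ f_l ρ` with `G`. -/
def flow : (Fin F.l → ℝ) × ℝ := (fun i => ∫ x, z.1 x * pb (F.f i) (G.diff z).1 x, 0)

/-- The differential of the bracket of two smooth functionals. -/
def bracketDiff : ExtSpace d :=
  (fun x => pb (F.diff z).1 (G.diff z).1 x + F.hess z (F.testVec x) (F.flow G z) -
      G.hess z (G.testVec x) (G.flow F z),
    F.hess z (0, 1) (F.flow G z) - G.hess z (0, 1) (G.flow F z))

lemma differentiable_f (i : Fin F.l) : Differentiable ℝ (F.f i) :=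
  (F.f_smooth i).differentiable (by simp)

lemma contDiff_fderiv : ContDiff ℝ 1 (fderiv ℝ F.φ) :=
  (contDiff_two_of_smooth F.φ_smooth).fderiv_right (m := 1) (by norm_num)

lemma hasFDerivAt_fderiv (a : (Fin F.l → ℝ) × ℝ) :
    HasFDerivAt (fderiv ℝ F.φ) (fderiv ℝ (fderiv ℝ F.φ) a) a :=
  ((F.contDiff_fderiv.differentiable one_ne_zero) a).hasFDerivAt

lemma hess_symm (v w : (Fin F.l → ℝ) × ℝ) : F.hess z v w = F.hess z w v :=
  (((contDiff_two_of_smooth F.φ_smooth).contDiffAt (x := F.arg z)).isSymmSndFDerivAt (by simp)) v w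

lemma contDiff_diff : ContDiff ℝ ∞ (F.diff z).1 := by
  change ContDiff ℝ ∞ fun x => ∑ i, fderiv ℝ F.φ (F.arg z) (Pi.single i 1, 0) * F.f i x
  exact ContDiff.sum fun i _ => contDiff_const.mul (F.f_smooth i)

/-- Linear combinations of the test functions have compact support. -/
lemma hasCompactSupport_sum (c : Fin F.l → ℝ) : HasCompactSupport fun x => ∑ i, c i * F.f i x := by
  refine HasCompactSupport.intro (isCompact_iUnion fun i => (F.f_compact i).isCompact)
    fun x hx => ?_
  refine Finset.sum_eq_zero fun i _ => ?_
  rw [image_eq_zero_of_notMem_tsupport fun h => hx (Set.mem_iUnion.2 ⟨i, h⟩), mul_zero]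

lemma hasCompactSupport_diff : HasCompactSupport (F.diff z).1 := F.hasCompactSupport_sum _

lemma pb_diff_left (g : X d → ℝ) (x : X d) : pb (F.diff z).1 g x =
    ∑ i, fderiv ℝ F.φ (F.arg z) (Pi.single i 1, 0) * pb (F.f i) g x := by
  change pb (fun x => ∑ i, fderiv ℝ F.φ (F.arg z) (Pi.single i 1, 0) * F.f i x) g x = _
  rw [pb_sum_left _ fun i _ => (F.differentiable_f i x).const_mul _]
  exact Finset.sum_congr rfl fun i _ => pb_const_mul_left (F.differentiable_f i x) _

/-- `x ↦ T (f₁(x), …, f_l(x))` for a linear map `T`. -/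
lemma apply_testVec (T : ((Fin F.l → ℝ) × ℝ) →L[ℝ] ℝ) (x : X d) :
    T (F.testVec x) = ∑ i, T (Pi.single i 1, 0) * F.f i x := apply_prod_zero T _

lemma integrable_mul_pb {σ f g : X d → ℝ} (hσ : Continuous σ) (hf : ContDiff ℝ ∞ f)
    (hc : HasCompactSupport f) (hg : ContDiff ℝ ∞ g) : Integrable fun x => σ x * pb f g x :=
  (hσ.mul (contDiff_pb hf hg).continuous).integrable_of_hasCompactSupport hc.pb_left.mul_left

lemma integrable_f_mul {σ : X d → ℝ} (hσ : Continuous σ) (i : Fin F.l) :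
    Integrable fun x => F.f i x * σ x :=
  ((F.f_smooth i).continuous.mul hσ).integrable_of_hasCompactSupport (F.f_compact i).mul_right

/-- The bracket of two smooth functionals, at densities that need not be states. -/
lemma bracket_eq (hz : ContDiff ℝ 2 z.1) :
    bracket extPoisson F G z = fderiv ℝ F.φ (F.arg z) (F.flow G z) := by
  have hzc := hz.continuous
  have hz1 : ContDiff ℝ 1 z.1 := hz.of_le one_le_two
  have hzd : Differentiable ℝ z.1 := hz1.differentiable one_ne_zero
  have hF := F.contDiff_diff z
  have hG := G.contDiff_diff z
  have hFd : Differentiable ℝ (F.diff z).1 := hF.differentiable (by simp)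
  have hG2 : ContDiff ℝ 2 (G.diff z).1 := contDiff_two_of_smooth hG
  have hF1 : ContDiff ℝ 1 (F.diff z).1 := contDiff_one_of_smooth hF
  have hG1 : ContDiff ℝ 1 (G.diff z).1 := contDiff_one_of_smooth hG
  have hFc := F.hasCompactSupport_diff z
  have hI1 := integrable_mul_pb hzc hF hFc hG
  have hI2 : Integrable fun x => (F.diff z).1 x * pb (G.diff z).1 z.1 x :=
    (hF.continuous.mul (continuous_pb hG1 hz1)).integrable_of_hasCompactSupport hFc.mul_right
  have hpb : ∀ x, pb (fun y => z.1 y * (F.diff z).1 y) (G.diff z).1 x =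
      z.1 x * pb (F.diff z).1 (G.diff z).1 x - (F.diff z).1 x * pb (G.diff z).1 z.1 x := fun x => by
    rw [pb_mul_left (hzd x) (hFd x), pb_antisymm z.1]
    ring
  have h0 := integral_pb_eq_zero (hz1.mul hF1) hG2
    (((hzc.mul hF.continuous).mul (hG1.continuous_fderiv
      one_ne_zero).norm).integrable_of_hasCompactSupport (hFc.mul_left.mul_right)) (by
    rw [show pb (fun y => z.1 y * (F.diff z).1 y) (G.diff z).1 = fun x =>
      z.1 x * pb (F.diff z).1 (G.diff z).1 x - (F.diff z).1 x * pb (G.diff z).1 z.1 x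
      from funext hpb]
    exact hI1.sub hI2)
  simp only [hpb] at h0
  rw [integral_sub hI1 hI2, sub_eq_zero] at h0
  simp only [bracket, extPoisson, pairExt, pair, zero_mul, add_zero]
  rw [poisson_eq_pb hz1 hG2, ← h0, flow, apply_prod_zero]
  simp only [pb_diff_left, Finset.mul_sum, mul_left_comm (z.1 _)]
  rw [integral_finsetSum _ fun i _ => (integrable_mul_pb hzc (F.f_smooth i) (F.f_compact i)
    hG).const_mul _]
  simp only [integral_const_mul]

lemma flow_eq (hz : Continuous z.1) (i : Fin F.l) : (F.flow G z).1 i =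
    ∑ j, fderiv ℝ G.φ (G.arg z) (Pi.single j 1, 0) * ∫ x, z.1 x * pb (F.f i) (G.f j) x := by
  simp only [← integral_const_mul]
  rw [← integral_finsetSum _ fun j _ => (integrable_mul_pb hz (F.f_smooth i) (F.f_compact i)
    (G.f_smooth j)).const_mul _]
  refine integral_congr_ae (Eventually.of_forall fun x => ?_)
  change z.1 x * pb (F.f i) (G.diff z).1 x = _
  rw [pb_antisymm, pb_diff_left, ← Finset.sum_neg_distrib, Finset.mul_sum]
  refine Finset.sum_congr rfl fun j _ => ?_
  rw [pb_antisymm (G.f j)]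
  ring

lemma arg_line {a : X d → ℝ} (hz : Continuous z.1) (ha : Continuous a) (s t : ℝ) :
    F.arg (z + t • (a, s)) = F.arg z + t • F.arg (a, s) := by
  refine Prod.ext (funext fun i => ?_) rfl
  change ∫ x, F.f i x * (z.1 x + t * a x) = (∫ x, F.f i x * z.1 x) + t * ∫ x, F.f i x * a x
  rw [← integral_const_mul, ← integral_add (F.integrable_f_mul hz i)
    ((F.integrable_f_mul ha i).const_mul t)]
  exact integral_congr_ae (Eventually.of_forall fun x => by ring)

variable {z}

lemma contDiff_bracketDiff : ContDiff ℝ ∞ (F.bracketDiff G z).1 := by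
  have h : (F.bracketDiff G z).1 = fun x => pb (F.diff z).1 (G.diff z).1 x +
      (∑ i, F.hess z (Pi.single i 1, 0) (F.flow G z) * F.f i x) -
      ∑ i, G.hess z (Pi.single i 1, 0) (G.flow F z) * G.f i x := by
    funext x
    have h1 := F.apply_testVec ((F.hess z).flip (F.flow G z)) x
    have h2 := G.apply_testVec ((G.hess z).flip (G.flow F z)) x
    simp only [ContinuousLinearMap.flip_apply] at h1 h2
    rw [← h1, ← h2, bracketDiff]
  rw [h]
  exact ((contDiff_pb (F.contDiff_diff z) (G.contDiff_diff z)).add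
    (ContDiff.sum fun i _ => contDiff_const.mul (F.f_smooth i))).sub
    (ContDiff.sum fun i _ => contDiff_const.mul (G.f_smooth i))

lemma hasCompactSupport_bracketDiff : HasCompactSupport (F.bracketDiff G z).1 := by
  have h1 : HasCompactSupport fun x => F.hess z (F.testVec x) (F.flow G z) := by
    rw [show (fun x => F.hess z (F.testVec x) (F.flow G z)) = _ from
      funext fun x => F.apply_testVec ((F.hess z).flip (F.flow G z)) x]
    exact F.hasCompactSupport_sum _
  have h2 : HasCompactSupport fun x => G.hess z (G.testVec x) (G.flow F z) := by
    rw [show (fun x => G.hess z (G.testVec x) (G.flow F z)) = _ from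
      funext fun x => G.apply_testVec ((G.hess z).flip (G.flow F z)) x]
    exact G.hasCompactSupport_sum _
  exact (((F.hasCompactSupport_diff z).pb_left (g := (G.diff z).1)).add h1).sub h2

/-- Integrating `T (f₁, …, f_l)` against a density. -/
lemma integral_apply_testVec (T : ((Fin F.l → ℝ) × ℝ) →L[ℝ] ℝ) {a : X d → ℝ} (ha : Continuous a)
    (s : ℝ) : (∫ x, T (F.testVec x) * a x) + s * T (0, 1) = T (F.arg (a, s)) := by
  have h : F.arg (a, s) = (fun i => ∫ x, F.f i x * a x, 0) + s • (0, 1) := by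
    ext <;> simp [arg]
  rw [h, map_add, map_smul, apply_prod_zero, smul_eq_mul]
  congr 1
  simp only [← integral_const_mul]
  rw [← integral_finsetSum _ fun i _ => (F.integrable_f_mul ha i).const_mul _]
  refine integral_congr_ae (Eventually.of_forall fun x => ?_)
  simp only [apply_testVec, Finset.sum_mul, mul_assoc]

lemma integrable_apply_testVec (T : ((Fin F.l → ℝ) × ℝ) →L[ℝ] ℝ) {a : X d → ℝ}
    (ha : Continuous a) : Integrable fun x => T (F.testVec x) * a x := by
  simp only [apply_testVec, Finset.sum_mul, mul_assoc]
  exact integrable_finsetSum _ fun i _ => (F.integrable_f_mul ha i).const_mul _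

/-- The bracket along a line, in terms of the outer functions and of brackets of test functions. -/
lemma bracket_line {a : X d → ℝ} (hz : ContDiff ℝ 2 z.1) (ha : ContDiff ℝ 2 a) (s t : ℝ) :
    bracket extPoisson F G (z + t • (a, s)) =
      ∑ i, ∑ j, fderiv ℝ F.φ (F.arg z + t • F.arg (a, s)) (Pi.single i 1, 0) *
        fderiv ℝ G.φ (G.arg z + t • G.arg (a, s)) (Pi.single j 1, 0) *
        ((∫ x, z.1 x * pb (F.f i) (G.f j) x) + t * ∫ x, a x * pb (F.f i) (G.f j) x) := by
  have hzc := hz.continuous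
  have hac := ha.continuous
  have hct : ContDiff ℝ 2 (z + t • ((a, s) : ExtSpace d)).1 := hz.add (contDiff_const.mul ha)
  rw [bracket_eq F G _ hct, flow, apply_prod_zero]
  refine Finset.sum_congr rfl fun i _ => ?_
  have := flow_eq F G _ hct.continuous i
  simp only [flow] at this
  rw [this, Finset.mul_sum]
  refine Finset.sum_congr rfl fun j _ => ?_
  rw [arg_line F z hzc hac, arg_line G z hzc hac, ← mul_assoc]
  congr 1
  change ∫ x, (z.1 x + t * a x) * pb (F.f i) (G.f j) x = _
  rw [← integral_const_mul, ← integral_add (integrable_mul_pb hzc (F.f_smooth i) (F.f_compact i)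
    (G.f_smooth j)) ((integrable_mul_pb hac (F.f_smooth i) (F.f_compact i)
      (G.f_smooth j)).const_mul t)]
  exact integral_congr_ae (Eventually.of_forall fun x => by ring)

lemma integral_pb_diff_mul {a : X d → ℝ} (ha : Continuous a) :
    ∫ x, pb (F.diff z).1 (G.diff z).1 x * a x =
      ∑ i, ∑ j, fderiv ℝ F.φ (F.arg z) (Pi.single i 1, 0) *
        fderiv ℝ G.φ (G.arg z) (Pi.single j 1, 0) * ∫ x, a x * pb (F.f i) (G.f j) x := by
  simp only [← integral_const_mul]
  have hI : ∀ i j, Integrable fun x => fderiv ℝ F.φ (F.arg z) (Pi.single i 1, 0) *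
      fderiv ℝ G.φ (G.arg z) (Pi.single j 1, 0) * (a x * pb (F.f i) (G.f j) x) :=
    fun i j => (integrable_mul_pb ha (F.f_smooth i) (F.f_compact i) (G.f_smooth j)).const_mul _
  simp only [← fun i => integral_finsetSum Finset.univ fun j _ => hI i j]
  rw [← integral_finsetSum _ fun i _ => integrable_finsetSum _ fun j _ => hI i j]
  refine integral_congr_ae (Eventually.of_forall fun x => ?_)
  simp only [pb_diff_left, Finset.sum_mul]
  refine Finset.sum_congr rfl fun i _ => ?_
  rw [pb_antisymm, pb_diff_left, ← Finset.sum_neg_distrib, Finset.mul_sum, Finset.sum_mul]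
  refine Finset.sum_congr rfl fun j _ => ?_
  rw [pb_antisymm (G.f j)]
  ring

lemma apply_flow (hz : Continuous z.1) (T : ((Fin F.l → ℝ) × ℝ) →L[ℝ] ℝ) : T (F.flow G z) =
    ∑ i, ∑ j, T (Pi.single i 1, 0) * (fderiv ℝ G.φ (G.arg z) (Pi.single j 1, 0) *
      ∫ x, z.1 x * pb (F.f i) (G.f j) x) := by
  rw [show F.flow G z = ((F.flow G z).1, 0) from rfl, apply_prod_zero]
  refine Finset.sum_congr rfl fun i _ => ?_
  rw [flow_eq F G z hz, Finset.mul_sum]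

lemma neg_apply_flow_swap (hz : Continuous z.1) (T : ((Fin G.l → ℝ) × ℝ) →L[ℝ] ℝ) :
    -T (G.flow F z) = ∑ i, ∑ j, fderiv ℝ F.φ (F.arg z) (Pi.single i 1, 0) *
      (T (Pi.single j 1, 0) * ∫ x, z.1 x * pb (F.f i) (G.f j) x) := by
  rw [apply_flow G F hz, Finset.sum_comm, ← Finset.sum_neg_distrib]
  refine Finset.sum_congr rfl fun i _ => ?_
  rw [← Finset.sum_neg_distrib]
  refine Finset.sum_congr rfl fun j _ => ?_
  have : ∫ x, z.1 x * pb (G.f j) (F.f i) x = -∫ x, z.1 x * pb (F.f i) (G.f j) x := by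
    rw [← integral_neg]
    refine integral_congr_ae (Eventually.of_forall fun x => ?_)
    simp only [pb_antisymm (G.f j), mul_neg]
  rw [this]
  ring

lemma pairExt_bracketDiff_line {a : X d → ℝ} (ha : Continuous a) (s : ℝ) :
    pairExt (a, s) (F.bracketDiff G z) = (∫ x, pb (F.diff z).1 (G.diff z).1 x * a x) +
      F.hess z (F.arg (a, s)) (F.flow G z) - G.hess z (G.arg (a, s)) (G.flow F z) := by
  have i1 : Integrable fun x => pb (F.diff z).1 (G.diff z).1 x * a x := by
    simpa only [mul_comm] using integrable_mul_pb ha (F.contDiff_diff z)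
      (F.hasCompactSupport_diff z) (G.contDiff_diff z)
  have i2 := F.integrable_apply_testVec ((F.hess z).flip (F.flow G z)) ha
  have i3 := G.integrable_apply_testVec ((G.hess z).flip (G.flow F z)) ha
  have j2 := F.integral_apply_testVec ((F.hess z).flip (F.flow G z)) ha s
  have j3 := G.integral_apply_testVec ((G.hess z).flip (G.flow F z)) ha s
  simp only [ContinuousLinearMap.flip_apply] at i2 i3 j2 j3
  rw [← j2, ← j3]
  simp only [pairExt, pair, bracketDiff, sub_mul, add_mul]
  have i4 := i1.add i2
  rw [Pi.add_def] at i4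
  rw [integral_sub i4 i3, integral_add i1 i2]
  ring

lemma hasDerivAt_fderiv_line (w u : (Fin F.l → ℝ) × ℝ) :
    HasDerivAt (fun t : ℝ => fderiv ℝ F.φ (F.arg z + t • w) u) (F.hess z w u) 0 := by
  have hlin : HasDerivAt (fun t : ℝ => F.arg z + t • w) w 0 := by
    simpa using ((hasDerivAt_id (0 : ℝ)).smul_const w).const_add (F.arg z)
  have h1 : HasFDerivAt (fderiv ℝ F.φ) (F.hess z) (F.arg z + (0 : ℝ) • w) := by
    rw [zero_smul, add_zero]
    exact F.hasFDerivAt_fderiv (F.arg z)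
  have h2 : HasDerivAt (fun t : ℝ => fderiv ℝ F.φ (F.arg z + t • w)) (F.hess z w) 0 :=
    HasFDerivAt.comp_hasDerivAt (0 : ℝ) h1 hlin
  exact (ContinuousLinearMap.apply ℝ ℝ u).hasFDerivAt.comp_hasDerivAt (0 : ℝ) h2

lemma contDiff_fderiv_line (w u : (Fin F.l → ℝ) × ℝ) :
    ContDiff ℝ 1 fun t : ℝ => fderiv ℝ F.φ (F.arg z + t • w) u :=
  (F.contDiff_fderiv.comp (by fun_prop)).clm_apply contDiff_const

lemma hasDifferential_bracket (hz : ContDiff ℝ 2 z.1) :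
    HasDifferential (bracket extPoisson F G) z (F.bracketDiff G z) := by
  intro b hb hc _ s
  have ha : ContDiff ℝ 2 fun x => b x * z.1 x := (contDiff_two_of_smooth hb).mul hz
  generalize (fun x => b x * z.1 x) = a at ha
  simp only [bracket_line F G hz ha]
  constructor
  · refine (ContDiff.sum fun i _ => ContDiff.sum fun j _ => ?_).contDiffAt
    exact ((F.contDiff_fderiv_line _ _).mul (G.contDiff_fderiv_line _ _)).mul (by fun_prop)
  · have hd := HasDerivAt.fun_sum (u := Finset.univ) fun i _ =>
      HasDerivAt.fun_sum (u := Finset.univ) fun j _ =>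
        ((F.hasDerivAt_fderiv_line (z := z) (F.arg (a, s)) (Pi.single i 1, 0)).fun_mul
          (G.hasDerivAt_fderiv_line (z := z) (G.arg (a, s)) (Pi.single j 1, 0))).fun_mul
          (((hasDerivAt_id (0 : ℝ)).mul_const (∫ x, a x * pb (F.f i) (G.f j) x)).const_add
            (∫ x, z.1 x * pb (F.f i) (G.f j) x))
    refine hd.congr_deriv ?_
    rw [pairExt_bracketDiff_line F G ha.continuous, integral_pb_diff_mul F G ha.continuous,
      apply_flow F G hz.continuous, sub_eq_add_neg, neg_apply_flow_swap F G hz.continuous,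
      ← Finset.sum_add_distrib, ← Finset.sum_add_distrib]
    refine Finset.sum_congr rfl fun i _ => ?_
    rw [← Finset.sum_add_distrib, ← Finset.sum_add_distrib]
    refine Finset.sum_congr rfl fun j _ => ?_
    simp only [zero_smul, add_zero, id, zero_mul, one_mul]
    ring

end SmoothFunctional

namespace Model

variable {M : Model d} {H₂ : (X d → ℝ) → (X d → ℝ) → ℝ}

/-- The derivative of a bracket along the Hamiltonian flow of a third functional. -/
lemma pairExt_bracketDiff (hM : M.Condition H₂) {z : ExtSpace d} (hz : M.IsState z.1)
    (F G H : SmoothFunctional d) : pairExt (extPoisson z (H.diff z)) (F.bracketDiff G z) =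
      (∫ x, z.1 x * pb (pb (F.diff z).1 (G.diff z).1) (H.diff z).1 x) +
        F.hess z (F.flow H z) (F.flow G z) - G.hess z (G.flow H z) (G.flow F z) := by
  have hzc := hz.smooth.continuous
  have two : ∀ {f : X d → ℝ}, ContDiff ℝ ∞ f → ContDiff ℝ 2 f := contDiff_two_of_smooth
  have hcotH : (H.diff z).1 ∈ M.cot z.1 := mem_cot_of_hasCompactSupport hM hz
    (two (H.contDiff_diff z)) (H.hasCompactSupport_diff z)
  have hcotB : (F.bracketDiff G z).1 ∈ M.cot z.1 := mem_cot_of_hasCompactSupport hM hz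
    (two (F.contDiff_bracketDiff G)) (F.hasCompactSupport_bracketDiff G)
  have hpbd : ∀ x, DifferentiableAt ℝ (pb (F.diff z).1 (G.diff z).1) x :=
    (contDiff_pb (F.contDiff_diff z) (G.contDiff_diff z)).differentiable (by simp)
  -- the bracket of `x ↦ T (f₁(x), …, f_l(x))` with `H`
  have hT : ∀ (F : SmoothFunctional d) (T : ((Fin F.l → ℝ) × ℝ) →L[ℝ] ℝ),
      (Differentiable ℝ fun x => T (F.testVec x)) ∧
      (Integrable fun x => z.1 x * pb (fun x => T (F.testVec x)) (H.diff z).1 x) ∧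
      ∫ x, z.1 x * pb (fun x => T (F.testVec x)) (H.diff z).1 x = T (F.flow H z) := by
    intro F T
    have h1 : ∀ x, z.1 x * pb (fun x => T (F.testVec x)) (H.diff z).1 x =
        ∑ i, T (Pi.single i 1, 0) * (z.1 x * pb (F.f i) (H.diff z).1 x) := fun x => by
      simp only [F.apply_testVec T]
      rw [pb_sum_left _ fun i _ => (F.differentiable_f i x).const_mul _, Finset.mul_sum]
      refine Finset.sum_congr rfl fun i _ => ?_
      rw [pb_const_mul_left (F.differentiable_f i x)]
      ring
    have hI : ∀ i, Integrable fun x =>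
        T (Pi.single i 1, 0) * (z.1 x * pb (F.f i) (H.diff z).1 x) := fun i =>
      (SmoothFunctional.integrable_mul_pb hzc (F.f_smooth i) (F.f_compact i)
        (H.contDiff_diff z)).const_mul _
    simp only [h1]
    refine ⟨?_, integrable_finsetSum _ fun i _ => hI i, ?_⟩
    · simp only [F.apply_testVec T]
      exact Differentiable.fun_sum fun i _ => (F.differentiable_f i).const_mul _
    · rw [integral_finsetSum _ fun i _ => hI i, SmoothFunctional.flow, apply_prod_zero]
      simp only [integral_const_mul]
  obtain ⟨d1, i1, e1⟩ := hT F ((F.hess z).flip (F.flow G z))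
  obtain ⟨d2, i2, e2⟩ := hT G ((G.hess z).flip (G.flow F z))
  have i0 : Integrable fun x => z.1 x * pb (pb (F.diff z).1 (G.diff z).1) (H.diff z).1 x :=
    SmoothFunctional.integrable_mul_pb hzc (contDiff_pb (F.contDiff_diff z) (G.contDiff_diff z))
      (F.hasCompactSupport_diff z).pb_left (H.contDiff_diff z)
  simp only [ContinuousLinearMap.flip_apply] at d1 i1 e1 d2 i2 e2
  simp only [extPoisson, pairExt, pair, zero_mul, add_zero]
  rw [integral_mul_poisson hM hz hcotH hcotB, ← e1, ← e2, ← integral_add i0 i1]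
  have i3 := i0.add i1
  rw [Pi.add_def] at i3
  rw [← integral_sub i3 i2]
  refine integral_congr_ae (Eventually.of_forall fun x => ?_)
  have : (F.bracketDiff G z).1 = fun x => (pb (F.diff z).1 (G.diff z).1 x +
      F.hess z (F.testVec x) (F.flow G z)) +
      (-1) * G.hess z (G.testVec x) (G.flow F z) := by
    funext x
    simp only [SmoothFunctional.bracketDiff]
    ring
  simp only [this]
  rw [pb_add_left ((hpbd x).fun_add (d1 x)) ((d2 x).const_mul _), pb_add_left (hpbd x) (d1 x),
    pb_const_mul_left (d2 x)]
  ring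

/-- The Jacobi identity. The second derivatives of the outer functions cancel by symmetry, and what
remains is the Jacobi identity of the canonical bracket. -/
lemma jacobiIdentity (hM : M.Condition H₂) : JacobiIdentity M.extStateSpace extPoisson := by
  intro F G H z hz
  have hz' : M.IsState z.1 := hz
  have two : ∀ {f : X d → ℝ}, ContDiff ℝ ∞ f → ContDiff ℝ 2 f := contDiff_two_of_smooth
  have hmem : ∀ F G : SmoothFunctional d, F.bracketDiff G z ∈ M.extStateSpace.cot z := fun F G =>
    ⟨mem_cot_of_hasCompactSupport hM hz' (two (F.contDiff_bracketDiff G))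
      (F.hasCompactSupport_bracketDiff G), trivial⟩
  refine ⟨_, hmem F G, _, hmem H F, _, hmem G H, F.hasDifferential_bracket G hz'.smooth,
    H.hasDifferential_bracket F hz'.smooth, G.hasDifferential_bracket H hz'.smooth, ?_⟩
  rw [pairExt_bracketDiff hM hz', pairExt_bracketDiff hM hz', pairExt_bracketDiff hM hz',
    F.hess_symm z (F.flow H z), G.hess_symm z (G.flow H z), H.hess_symm z (H.flow G z)]
  have hI : ∀ F G H : SmoothFunctional d, Integrable fun x =>
      z.1 x * pb (pb (F.diff z).1 (G.diff z).1) (H.diff z).1 x := fun F G H =>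
    SmoothFunctional.integrable_mul_pb hz'.smooth.continuous
      (contDiff_pb (F.contDiff_diff z) (G.contDiff_diff z))
      (F.hasCompactSupport_diff z).pb_left (H.contDiff_diff z)
  have h0 : (∫ x, z.1 x * pb (pb (F.diff z).1 (G.diff z).1) (H.diff z).1 x) +
      (∫ x, z.1 x * pb (pb (H.diff z).1 (F.diff z).1) (G.diff z).1 x) +
      (∫ x, z.1 x * pb (pb (G.diff z).1 (H.diff z).1) (F.diff z).1 x) = 0 := by
    have h1 := (hI F G H).add (hI H F G)
    rw [Pi.add_def] at h1
    rw [← integral_add (hI F G H) (hI H F G), ← integral_add h1 (hI G H F)]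
    refine integral_eq_zero_of_ae (Eventually.of_forall fun x => ?_)
    have := pb_jacobi (two (F.contDiff_diff z)) (two (G.contDiff_diff z))
      (two (H.contDiff_diff z)) x
    simp only [Pi.zero_apply]
    rw [← mul_add, ← mul_add, this, mul_zero]
  linarith

end Model

/-! ### The generator on functions of the momentum -/

section Generator

variable (G : (P d →ᵇ ℝ) →ₗ.[ℝ] (P d →ᵇ ℝ))

/-- The function of the momentum is in the domain of the operator. -/
def InDomain (g : P d → ℝ) : Prop := ∃ f : G.domain, ((f : P d →ᵇ ℝ) : P d → ℝ) = g

variable {G} {f g : P d → ℝ}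

lemma applyGen_eq (f : G.domain) (h : ((f : P d →ᵇ ℝ) : P d → ℝ) = g) (p : P d) :
    applyGen G g p = G f p := by
  have hex : ∃ f : G.domain, ((f : P d →ᵇ ℝ) : P d → ℝ) = g := ⟨f, h⟩
  rw [applyGen, dif_pos hex]
  congr 2
  exact Subtype.ext (DFunLike.coe_injective (hex.choose_spec.trans h.symm))

lemma InDomain.add (hf : InDomain G f) (hg : InDomain G g) :
    InDomain G (fun p => f p + g p) ∧
      ∀ p, applyGen G (fun p => f p + g p) p = applyGen G f p + applyGen G g p := by
  obtain ⟨f', rfl⟩ := hf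
  obtain ⟨g', rfl⟩ := hg
  refine ⟨⟨f' + g', rfl⟩, fun p => ?_⟩
  rw [applyGen_eq (g := fun p => (f' : P d →ᵇ ℝ) p + (g' : P d →ᵇ ℝ) p) (f' + g') rfl,
    applyGen_eq f' rfl, applyGen_eq g' rfl, LinearPMap.map_add]
  rfl

lemma InDomain.const_mul (hf : InDomain G f) (c : ℝ) :
    InDomain G (fun p => c * f p) ∧
      ∀ p, applyGen G (fun p => c * f p) p = c * applyGen G f p := by
  obtain ⟨f', rfl⟩ := hf
  refine ⟨⟨c • f', rfl⟩, fun p => ?_⟩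
  rw [applyGen_eq (g := fun p => c * (f' : P d →ᵇ ℝ) p) (c • f') rfl,
    applyGen_eq f' rfl, LinearPMap.map_smul]
  rfl

end Generator

namespace Model

variable {M : Model d} {H₂ : (X d → ℝ) → (X d → ℝ) → ℝ} {ρ : X d → ℝ}

/-! ### Algebraic properties of the test functions -/

section TestFunctions

variable (hM : M.Condition H₂)
include hM

lemma inDomain_of_mem_test {f : X d → ℝ} (hf : f ∈ M.test) (q : P d) :
    InDomain M.gen fun p => f (q, p) := by
  obtain ⟨g, hg⟩ := (hM.test_domain f hf).1 q
  exact ⟨g, funext hg⟩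

lemma inDomain_const (c : ℝ) :
    InDomain M.gen (fun _ => c) ∧ ∀ p, applyGen M.gen (fun _ => c) p = 0 := by
  obtain ⟨f, hf, hf0⟩ := hM.gen_const
  have h1 : InDomain M.gen fun _ => (1 : ℝ) := ⟨f, funext hf⟩
  have h2 := h1.const_mul c
  simp only [mul_one] at h2
  refine ⟨h2.1, fun p => ?_⟩
  rw [h2.2, applyGen_eq f (funext hf), hf0, mul_zero]

lemma liftGen_const (c : ℝ) (x : X d) : liftGen M.gen (fun _ => c) x = 0 :=
  (inDomain_const hM c).2 x.2

lemma exp_mem_test {f : X d → ℝ} (hf : f ∈ M.test) : (fun x => Real.exp (f x)) ∈ M.test :=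
  hM.test_comp 1 (fun _ => f) (fun v => Real.exp (v 0)) (fun _ => hf) (by fun_prop)

lemma mul_mem_test {f g : X d → ℝ} (hf : f ∈ M.test) (hg : g ∈ M.test) :
    (fun x => f x * g x) ∈ M.test :=
  hM.test_comp 2 ![f, g] (fun v => v 0 * v 1)
    (fun i => by fin_cases i <;> simpa) (by fun_prop)

omit hM in
lemma add_mem_test {f g : X d → ℝ} (hf : f ∈ M.test) (hg : g ∈ M.test) :
    (fun x => f x + g x) ∈ M.test := M.test.add_mem hf hg

omit hM in
lemma sub_mem_test {f g : X d → ℝ} (hf : f ∈ M.test) (hg : g ∈ M.test) :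
    (fun x => f x - g x) ∈ M.test := M.test.sub_mem hf hg

lemma liftGen_add {f g : X d → ℝ} (hf : f ∈ M.test) (hg : g ∈ M.test) (x : X d) :
    liftGen M.gen (fun x => f x + g x) x = liftGen M.gen f x + liftGen M.gen g x :=
  ((inDomain_of_mem_test hM hf x.1).add (inDomain_of_mem_test hM hg x.1)).2 x.2

lemma liftGen_const_mul {f : X d → ℝ} (hf : f ∈ M.test) (c : ℝ) (x : X d) :
    liftGen M.gen (fun x => c * f x) x = c * liftGen M.gen f x :=
  ((inDomain_of_mem_test hM hf x.1).const_mul c).2 x.2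

lemma exists_bound_of_mem_test {f : X d → ℝ} (hf : f ∈ M.test) :
    ContDiff ℝ 2 f ∧ ∃ C, ∀ x, |f x| ≤ C := by
  obtain ⟨h, C, hC⟩ := hM.test_smooth f hf
  refine ⟨h, C, fun x => ?_⟩
  have := hC 0 (by omega) x
  rwa [norm_iteratedFDeriv_zero] at this

lemma continuous_of_mem_test {f : X d → ℝ} (hf : f ∈ M.test) : Continuous f :=
  (exists_bound_of_mem_test hM hf).1.continuous

lemma continuous_liftGen {f : X d → ℝ} (hf : f ∈ M.test) : Continuous (liftGen M.gen f) :=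
  (hM.test_domain f hf).2.1

/-- Products `f 𝒢 g` are bounded. -/
lemma exists_bound_mul_liftGen {f g : X d → ℝ} (hf : f ∈ M.test) (hg : g ∈ M.test) :
    ∃ C, ∀ x, |f x * liftGen M.gen g x| ≤ C := by
  obtain ⟨-, C, hC⟩ := exists_bound_of_mem_test hM hf
  obtain ⟨D, hD⟩ := (hM.test_domain g hg).2.2
  refine ⟨C * D, fun x => ?_⟩
  rw [abs_mul]
  exact mul_le_mul (hC x) (hD x) (abs_nonneg _) ((abs_nonneg _).trans (hC x))

/-- The positive maximum principle for functions on phase space. -/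
lemma liftGen_nonneg_of_min {f : X d → ℝ} (hf : f ∈ M.test) (x : X d)
    (h : ∀ p, f x ≤ f (x.1, p)) : 0 ≤ liftGen M.gen f x := by
  obtain ⟨g, hg⟩ := inDomain_of_mem_test hM hf x.1
  rw [liftGen, applyGen_eq g hg]
  refine hM.gen_min g x.2 fun p => ?_
  rw [hg]
  exact h p

/-- Convexity of `f ↦ e^{-f} 𝒢 e^f` in the form of a subgradient inequality. The function
`e^{g - g(x)} - e^{f - f(x)} (1 + (g - f) - (g - f)(x))` has its minimum, zero, at `x`. -/
lemma exp_liftGen_subgradient {f g : X d → ℝ} (hf : f ∈ M.test) (hg : g ∈ M.test) (x : X d) :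
    Real.exp (-f x) * liftGen M.gen (fun y => Real.exp (f y)) x +
      (Real.exp (-f x) * liftGen M.gen (fun y => (g y - f y) * Real.exp (f y)) x -
        (g x - f x) * (Real.exp (-f x) * liftGen M.gen (fun y => Real.exp (f y)) x)) ≤
    Real.exp (-g x) * liftGen M.gen (fun y => Real.exp (g y)) x := by
  have h1 := exp_mem_test hM hf
  have h2 := exp_mem_test hM hg
  have h3 := mul_mem_test hM (sub_mem_test hg hf) h1
  let a := Real.exp (-g x)
  let b := -(Real.exp (-f x) * (1 - (g x - f x)))
  let c := -Real.exp (-f x)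
  have m2 : (fun y => a * Real.exp (g y)) ∈ M.test := M.test.smul_mem a h2
  have m1 : (fun y => b * Real.exp (f y)) ∈ M.test := M.test.smul_mem b h1
  have m3 : (fun y => c * ((g y - f y) * Real.exp (f y))) ∈ M.test := M.test.smul_mem c h3
  have m12 := add_mem_test m1 m3
  have hmin := liftGen_nonneg_of_min hM (add_mem_test m2 m12) x fun p => by
    have e1 : a * Real.exp (g x) = 1 := by simp [a, ← Real.exp_add]
    have e2 : Real.exp (-f x) * Real.exp (f x) = 1 := by simp [← Real.exp_add]
    have hx : a * Real.exp (g x) +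
        (b * Real.exp (f x) + c * ((g x - f x) * Real.exp (f x))) = 0 := by
      rw [e1]
      simp only [b, c]
      linear_combination (-1 : ℝ) * e2
    rw [hx]
    have e3 : a * Real.exp (g (x.1, p)) = Real.exp (f (x.1, p) - f x) *
        Real.exp ((g (x.1, p) - g x) - (f (x.1, p) - f x)) := by
      rw [← Real.exp_add, ← Real.exp_add]
      congr 1
      ring
    have e4 : Real.exp (-f x) * Real.exp (f (x.1, p)) = Real.exp (f (x.1, p) - f x) := by
      rw [← Real.exp_add]
      congr 1
      ring
    have e5 : b * Real.exp (f (x.1, p)) + c * ((g (x.1, p) - f (x.1, p)) * Real.exp (f (x.1, p))) =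
        -(Real.exp (f (x.1, p) - f x) *
          (((g (x.1, p) - g x) - (f (x.1, p) - f x)) + 1)) := by
      rw [← e4]
      simp only [b, c]
      ring
    rw [e3, e5, ← sub_eq_add_neg, ← mul_sub]
    exact mul_nonneg (Real.exp_pos _).le (sub_nonneg.2 (Real.add_one_le_exp _))
  rw [liftGen_add hM m2 m12, liftGen_add hM m1 m3, liftGen_const_mul hM h2,
    liftGen_const_mul hM h1, liftGen_const_mul hM h3] at hmin
  simp only [a, b, c] at hmin
  linarith

end TestFunctions

/-! ### The limiting Hamiltonian on test functions -/

section Hamiltonian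

/-- `n⁻¹ e^{-nF} G_n e^{nF}` for the linear functional `F(μ) = ∫ f dμ`. -/
lemma preHamiltonian_linear (hM : M.Condition H₂) {f : X d → ℝ} (hf : f ∈ M.test) {n : ℕ}
    (hn : n ≠ 0) (y : Fin n → X d) :
    preHamiltonian M.gen (cylinder (fun _ : Fin 1 => f) fun v => v 0) y =
      ∫ x, Real.exp (-f x) * liftGen M.gen (fun y => Real.exp (f y)) x ∂(empirical y) := by
  have hn' : (n : ℝ) ≠ 0 := by exact_mod_cast hn
  have hF : ∀ y : Fin n → X d,
      n * cylinder (fun _ : Fin 1 => f) (fun v => v 0) (empirical y) = ∑ i, f (y i) := fun y => by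
    rw [cylinder, integral_empirical, mul_inv_cancel_left₀ hn']
  rw [integral_empirical, preHamiltonian]
  simp only [particleGen, hF]
  rw [mul_assoc, Finset.mul_sum]
  congr 1
  refine Finset.sum_congr rfl fun i _ => ?_
  have hu : ∀ p, Real.exp (∑ j, f (Function.update y i ((y i).1, p) j)) =
      Real.exp (∑ j, f (y j) - f (y i)) * Real.exp (f ((y i).1, p)) := fun p => by
    rw [← Real.exp_add]
    congr 1
    have h1 := Finset.sum_update_of_mem (Finset.mem_univ i) (fun j => f (y j)) (f ((y i).1, p))
    have h2 := Finset.sum_erase_add Finset.univ (fun j => f (y j)) (Finset.mem_univ i)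
    have h3 : ∀ j, f (Function.update y i ((y i).1, p) j) =
        Function.update (fun j => f (y j)) i (f ((y i).1, p)) j := fun j => by
      rcases eq_or_ne j i with rfl | hj
      · simp
      · simp [hj]
    simp only [h3, h1, Finset.sdiff_singleton_eq_erase]
    linarith
  simp only [hu]
  rw [((inDomain_of_mem_test hM (exp_mem_test hM hf) (y i).1).const_mul _).2, ← mul_assoc,
    ← Real.exp_add]
  congr 2
  ring

variable (hM : M.Condition H₂) (hρ : M.IsState ρ)
include hρ

lemma isProbabilityMeasure_law : IsProbabilityMeasure (law ρ) := by
  constructor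
  rw [law, withDensity_apply _ MeasurableSet.univ, Measure.restrict_univ,
    ← ofReal_integral_eq_lintegral_ofReal hρ.integrable (Eventually.of_forall hρ.nonneg),
    hρ.integral_eq_one, ENNReal.ofReal_one]

lemma integral_law (g : X d → ℝ) : ∫ x, g x ∂(law ρ) = ∫ x, g x * ρ x := by
  rw [law, integral_withDensity_eq_integral_toReal_smul
    hρ.smooth.continuous.measurable.ennreal_ofReal (Eventually.of_forall fun _ => by simp)]
  simp only [ENNReal.toReal_ofReal (hρ.nonneg _), smul_eq_mul, mul_comm]

include hM

/-- On test functions the limiting Hamiltonian is `∫ e^{-f} (𝒢 e^f) ρ`. -/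
lemma hamiltonian_eq {f : X d → ℝ} (hf : f ∈ M.test) : H₂ ρ f =
    ∫ x, Real.exp (-f x) * liftGen M.gen (fun y => Real.exp (f y)) x * ρ x := by
  have := isProbabilityMeasure_law hρ
  obtain ⟨y, hy⟩ := exists_empirical_tendsto (law ρ)
  have h1 := hM.limit ρ hρ 1 (fun _ => f) (fun v => v 0) (fun _ => hf) (by fun_prop) y hy
  have hfd : cylinderDeriv (fun _ : Fin 1 => f) (fun v => v 0) (law ρ) = f := by
    funext x
    have : HasFDerivAt (fun v : Fin 1 → ℝ => v 0) (ContinuousLinearMap.proj (R := ℝ) 0)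
        (fun _ => ∫ x', f x' ∂(law ρ)) :=
      (ContinuousLinearMap.proj (R := ℝ) (φ := fun _ : Fin 1 => ℝ) 0).hasFDerivAt
    simp [cylinderDeriv, this.fderiv]
  rw [hfd] at h1
  have hneg : (fun x => -f x) ∈ M.test := M.test.neg_mem hf
  have hc : Continuous fun x => Real.exp (-f x) * liftGen M.gen (fun y => Real.exp (f y)) x :=
    (continuous_of_mem_test hM hneg).rexp.mul (continuous_liftGen hM (exp_mem_test hM hf))
  obtain ⟨C, hC⟩ := exists_bound_mul_liftGen hM (exp_mem_test hM hneg) (exp_mem_test hM hf)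
  have h2 := hy (BoundedContinuousFunction.ofNormedAddCommGroup _ hc C hC)
  simp only [BoundedContinuousFunction.coe_ofNormedAddCommGroup] at h2
  rw [← integral_law hρ]
  refine tendsto_nhds_unique h1 (h2.congr' ?_)
  filter_upwards [eventually_ne_atTop 0] with n hn
  exact (preHamiltonian_linear hM hf hn _).symm

end Hamiltonian

/-! ### Reversibility on phase space -/

section Reversibility

lemma integrable_gaussian {m : ℝ} (hm : 0 < m) :
    Integrable fun p : P d => Real.exp (-‖p‖ ^ 2 / (2 * m)) := by
  have hb : 0 < (2 * m)⁻¹ := by positivity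
  have h := GaussianFourier.integral_rexp_neg_mul_sq_norm (V := P d) hb
  have h2 : Integrable fun p : P d => Real.exp (-(2 * m)⁻¹ * ‖p‖ ^ 2) := by
    by_contra hni
    rw [integral_undef hni] at h
    have : 0 < (Real.pi / (2 * m)⁻¹) ^ ((Module.finrank ℝ (P d) : ℝ) / 2) := by positivity
    exact this.ne h
  refine h2.congr (Eventually.of_forall fun p => ?_)
  simp only
  congr 1
  field_simp

lemma integral_maxwellian (m : ℝ) (hm : 0 < m) (g : P d → ℝ) :
    ∫ p, g p ∂(maxwellian d m) = (2 * Real.pi * m) ^ (-(d : ℝ) / 2) *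
      ∫ p, Real.exp (-‖p‖ ^ 2 / (2 * m)) * g p := by
  have hc : Continuous fun p : P d =>
      (2 * Real.pi * m) ^ (-(d : ℝ) / 2) * Real.exp (-‖p‖ ^ 2 / (2 * m)) := by fun_prop
  rw [maxwellian, integral_withDensity_eq_integral_toReal_smul hc.measurable.ennreal_ofReal
    (Eventually.of_forall fun _ => by simp), ← integral_const_mul]
  refine integral_congr_ae (Eventually.of_forall fun p => ?_)
  have : 0 ≤ (2 * Real.pi * m) ^ (-(d : ℝ) / 2) * Real.exp (-‖p‖ ^ 2 / (2 * m)) := by positivity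
  simp only [ENNReal.toReal_ofReal this, smul_eq_mul]
  ring

/-- Half of the momentum part of `dS(ρ)`. -/
def halfEntropy (M : Model d) (ρ : X d → ℝ) : X d → ℝ :=
  momentumPart ((1 / 2 : ℝ) • M.dEntropy ρ)

/-- The density `ρ(q, 0) exp(-|p|²/2m)`, which is reversible for `𝒢`. -/
def base (M : Model d) (ρ : X d → ℝ) (x : X d) : ℝ :=
  ρ (x.1, 0) * Real.exp (-‖x.2‖ ^ 2 / (2 * M.mass))

/-- `f 𝒢 g - g 𝒢 f`, which has mean zero with respect to the Gaussian by reversibility. -/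
def wronskian (M : Model d) (f g : X d → ℝ) (x : X d) : ℝ :=
  f x * liftGen M.gen g x - g x * liftGen M.gen f x

lemma halfEntropy_mem (hρ : M.IsState ρ) : M.halfEntropy ρ ∈ M.test := by
  have h : M.halfEntropy ρ = (1 / 2 : ℝ) • momentumPart (M.dEntropy ρ) := by
    funext x
    simp only [halfEntropy, momentumPart, Pi.smul_apply, smul_eq_mul]
    ring
  rw [h]
  exact M.test.smul_mem _ hρ.dEntropy_test

lemma base_mul_exp (hρ : M.IsState ρ) (x : X d) :
    M.base ρ x * Real.exp (2 * M.halfEntropy ρ x) = ρ x := by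
  have h : 2 * M.halfEntropy ρ x = Real.log (ρ x) - Real.log (ρ (x.1, 0)) +
      ‖x.2‖ ^ 2 / (2 * M.mass) := by
    simp only [halfEntropy, momentumPart, Pi.smul_apply, smul_eq_mul, dEntropy, dEnergy, norm_zero]
    ring
  rw [h, base, Real.exp_add, Real.exp_sub, Real.exp_log (hρ.pos x), Real.exp_log (hρ.pos _)]
  have h2 := (hρ.pos (x.1, 0)).ne'
  rw [neg_div, Real.exp_neg]
  field_simp

lemma base_nonneg (hρ : M.IsState ρ) (x : X d) : 0 ≤ M.base ρ x :=
  mul_nonneg (hρ.nonneg _) (Real.exp_pos _).le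

lemma continuous_base (hρ : M.IsState ρ) : Continuous (M.base ρ) := by
  have := hρ.smooth.continuous
  unfold base
  fun_prop

variable (hM : M.Condition H₂) (hρ : M.IsState ρ)
include hM

lemma continuous_wronskian {f g : X d → ℝ} (hf : f ∈ M.test) (hg : g ∈ M.test) :
    Continuous (M.wronskian f g) :=
  ((continuous_of_mem_test hM hf).mul (continuous_liftGen hM hg)).sub
    ((continuous_of_mem_test hM hg).mul (continuous_liftGen hM hf))

lemma exists_bound_wronskian {f g : X d → ℝ} (hf : f ∈ M.test) (hg : g ∈ M.test) :
    ∃ C, ∀ x, |M.wronskian f g x| ≤ C := by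
  obtain ⟨C, hC⟩ := exists_bound_mul_liftGen hM hf hg
  obtain ⟨D, hD⟩ := exists_bound_mul_liftGen hM hg hf
  exact ⟨C + D, fun x => (abs_sub _ _).trans (add_le_add (hC x) (hD x))⟩

/-- Reversibility, for fixed position. -/
lemma integral_gaussian_wronskian {f g : X d → ℝ} (hf : f ∈ M.test) (hg : g ∈ M.test) (q : P d) :
    ∫ p, Real.exp (-‖p‖ ^ 2 / (2 * M.mass)) * M.wronskian f g (q, p) = 0 := by
  obtain ⟨f', hf'⟩ := inDomain_of_mem_test hM hf q
  obtain ⟨g', hg'⟩ := inDomain_of_mem_test hM hg q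
  have hrev := hM.gen_reversible f' g'
  have hpos : (0 : ℝ) < (2 * Real.pi * M.mass) ^ (-(d : ℝ) / 2) := by
    have := hM.mass_pos
    positivity
  rw [integral_maxwellian _ hM.mass_pos, integral_maxwellian _ hM.mass_pos] at hrev
  have hrev' := mul_left_cancel₀ hpos.ne' hrev
  have hI : ∀ h k : P d →ᵇ ℝ, Integrable fun p => Real.exp (-‖p‖ ^ 2 / (2 * M.mass)) *
      (h p * k p) := fun h k => by
    have := (integrable_gaussian (d := d) hM.mass_pos).bdd_mul (c := ‖h * k‖)
      ((h * k).continuous.aestronglyMeasurable) (Eventually.of_forall (h * k).norm_coe_le_norm)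
    simpa only [BoundedContinuousFunction.mul_apply, mul_comm] using this
  have h1 : ∀ p, Real.exp (-‖p‖ ^ 2 / (2 * M.mass)) * M.wronskian f g (q, p) =
      Real.exp (-‖p‖ ^ 2 / (2 * M.mass)) * ((f' : P d →ᵇ ℝ) p * M.gen g' p) -
      Real.exp (-‖p‖ ^ 2 / (2 * M.mass)) * ((g' : P d →ᵇ ℝ) p * M.gen f' p) := fun p => by
    simp only [wronskian, liftGen]
    rw [applyGen_eq f' hf', applyGen_eq g' hg', congrFun hf' p, congrFun hg' p]
    ring
  simp only [h1]
  rw [integral_sub (hI _ _) (hI _ _), sub_eq_zero]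
  exact hrev'

include hρ

omit hρ in
/-- Reversibility on phase space: `f 𝒢 g - g 𝒢 f` has mean zero for each position. -/
lemma integral_mul_base_wronskian {f g : X d → ℝ} (hf : f ∈ M.test) (hg : g ∈ M.test) (b : P d → ℝ)
    (hI : Integrable fun x : X d => b x.1 * (M.base ρ x * M.wronskian f g x)) :
    ∫ x : X d, b x.1 * (M.base ρ x * M.wronskian f g x) = 0 := by
  rw [Measure.volume_eq_prod] at hI ⊢
  rw [integral_prod _ hI]
  refine integral_eq_zero_of_ae (Eventually.of_forall fun q => ?_)
  have h : ∀ p, b q * (M.base ρ (q, p) * M.wronskian f g (q, p)) =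
      b q * ρ (q, 0) * (Real.exp (-‖p‖ ^ 2 / (2 * M.mass)) * M.wronskian f g (q, p)) := fun p => by
    simp only [base]
    ring
  simp only [h]
  rw [integral_const_mul, integral_gaussian_wronskian hM hf hg, mul_zero]
  rfl

lemma exists_base_le : ∃ K, 0 ≤ K ∧ ∀ x, M.base ρ x ≤ K * ρ x := by
  obtain ⟨-, C, hC⟩ := exists_bound_of_mem_test hM (halfEntropy_mem hρ)
  refine ⟨Real.exp (2 * C), (Real.exp_pos _).le, fun x => ?_⟩
  rw [← base_mul_exp hρ x, mul_left_comm, ← Real.exp_add]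
  refine le_mul_of_one_le_right (base_nonneg hρ x) (Real.one_le_exp ?_)
  have := (abs_le.1 (hC x)).1
  linarith

lemma exists_abs_base_mul_le {f : X d → ℝ} (hf : ∃ C, ∀ x, |f x| ≤ C) :
    ∃ C, 0 ≤ C ∧ ∀ x, |M.base ρ x * f x| ≤ C * ρ x := by
  obtain ⟨K, hK0, hK⟩ := exists_base_le hM hρ
  obtain ⟨C, hC⟩ := hf
  have hC0 : 0 ≤ C := (abs_nonneg _).trans (hC 0)
  refine ⟨C * K, by positivity, fun x => ?_⟩
  rw [abs_mul, abs_of_nonneg (base_nonneg hρ x), mul_comm, mul_assoc]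
  exact mul_le_mul (hC x) (hK x) (base_nonneg hρ x) hC0

lemma integrable_base_mul {f : X d → ℝ} (hfc : Continuous f) (hf : ∃ C, ∀ x, |f x| ≤ C) :
    Integrable fun x => M.base ρ x * f x := by
  obtain ⟨C, -, hC⟩ := exists_abs_base_mul_le hM hρ hf
  exact (hρ.integrable.const_mul C).mono' ((continuous_base hρ).mul hfc).aestronglyMeasurable
    (Eventually.of_forall hC)

lemma integrable_base_mul_liftGen {f g : X d → ℝ} (hf : f ∈ M.test) (hg : g ∈ M.test) :
    Integrable fun x => M.base ρ x * (f x * liftGen M.gen g x) :=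
  integrable_base_mul hM hρ ((continuous_of_mem_test hM hf).mul (continuous_liftGen hM hg))
    (exists_bound_mul_liftGen hM hf hg)

/-- `𝒢` is symmetric with respect to `base`. -/
lemma integral_base_symm {f g : X d → ℝ} (hf : f ∈ M.test) (hg : g ∈ M.test) :
    ∫ x, M.base ρ x * (f x * liftGen M.gen g x) = ∫ x, M.base ρ x * (g x * liftGen M.gen f x) := by
  have h := integral_mul_base_wronskian hM hf hg (fun _ => 1) (by
    simpa only [one_mul] using integrable_base_mul hM hρ (continuous_wronskian hM hf hg)
      (exists_bound_wronskian hM hf hg))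
  simp only [wronskian, one_mul, mul_sub] at h
  rw [integral_sub (integrable_base_mul_liftGen hM hρ hf hg)
    (integrable_base_mul_liftGen hM hρ hg hf), sub_eq_zero] at h
  exact h

lemma base_wronskian_mem_tan {f g : X d → ℝ} (hf : f ∈ M.test) (hg : g ∈ M.test) :
    (fun x => M.base ρ x * M.wronskian f g x) ∈ M.tan ρ := by
  obtain ⟨C, hC0, hC⟩ := exists_abs_base_mul_le hM hρ (exists_bound_wronskian hM hf hg)
  have hI := integrable_of_le_weight hM hρ ((continuous_base hρ).mul
    (continuous_wronskian hM hf hg)).aestronglyMeasurable C fun x => (hC x).trans (by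
      rw [mul_left_comm]
      exact le_mul_of_one_le_left (mul_nonneg hC0 (hρ.nonneg x)) (one_le_weight hM hρ x))
  refine ⟨hI.1, hI.2, ?_⟩
  have h := integral_mul_base_wronskian hM hf hg (fun _ => 1) (by
    simp only [one_mul]
    exact hI.1)
  simpa only [one_mul] using h

/-- These tangent vectors do not see functions of the position. -/
lemma pair_base_wronskian {f g : X d → ℝ} (hf : f ∈ M.test) (hg : g ∈ M.test) {η : X d → ℝ}
    (hη : η ∈ M.cot ρ) :
    Integrable (fun x => momentumPart η x * (M.base ρ x * M.wronskian f g x)) ∧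
    pair (fun x => M.base ρ x * M.wronskian f g x) η =
      ∫ x, momentumPart η x * (M.base ρ x * M.wronskian f g x) := by
  have hv := base_wronskian_mem_tan hM hρ hf hg
  have hI := integrable_pair hM hρ hv hη
  obtain ⟨hηs, C, hC0, hC⟩ := exists_bound_of_mem_cot (weight_nonneg hM hρ) hη
  have hI0 : Integrable fun x : X d => η (x.1, 0) * (M.base ρ x * M.wronskian f g x) := by
    have hηc := hηs.continuous
    refine (hv.2.1.norm.const_mul C).mono' ((by fun_prop :
      Continuous fun x : X d => η (x.1, 0)).aestronglyMeasurable.mul hv.1.1)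
      (Eventually.of_forall fun x => ?_)
    rw [norm_mul, norm_mul (M.weight ρ x), Real.norm_eq_abs (M.weight ρ x),
      abs_of_nonneg (weight_nonneg hM hρ x), ← mul_assoc]
    gcongr
    refine ((hC (x.1, 0)).1).trans ?_
    gcongr
    have := kinetic_nonneg hM x
    simp only [weight, norm_zero, ne_eq, OfNat.ofNat_ne_zero, not_false_eq_true, zero_pow, zero_div]
    linarith
  have h0 := integral_mul_base_wronskian hM hf hg (fun q => η (q, 0)) hI0
  have h1 : ∀ x, momentumPart η x * (M.base ρ x * M.wronskian f g x) =
      η x * (M.base ρ x * M.wronskian f g x) -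
        η (x.1, 0) * (M.base ρ x * M.wronskian f g x) := fun x => by
    simp only [momentumPart]
    ring
  simp only [h1]
  refine ⟨hI.sub hI0, ?_⟩
  rw [integral_sub hI hI0, h0, sub_zero]
  rfl

/-- The limiting Hamiltonian, in terms of the reversible density. -/
lemma hamiltonian_halfEntropy_add {f : X d → ℝ} (hf : f ∈ M.test) :
    H₂ ρ (fun x => M.halfEntropy ρ x + f x) =
      ∫ x, M.base ρ x * (Real.exp (M.halfEntropy ρ x - f x) *
        liftGen M.gen (fun y => Real.exp (M.halfEntropy ρ y + f y)) x) := by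
  rw [hamiltonian_eq hM hρ (add_mem_test (halfEntropy_mem hρ) hf)]
  refine integral_congr_ae (Eventually.of_forall fun x => ?_)
  simp only
  conv_lhs => rw [← base_mul_exp hρ x]
  rw [show M.halfEntropy ρ x - f x = -(M.halfEntropy ρ x + f x) + 2 * M.halfEntropy ρ x by ring,
    Real.exp_add (-(M.halfEntropy ρ x + f x))]
  ring

/-- Reversibility makes the tilted Hamiltonian even. -/
lemma hamiltonian_even {f : X d → ℝ} (hf : f ∈ M.test) :
    H₂ ρ (fun x => M.halfEntropy ρ x + f x) = H₂ ρ (fun x => M.halfEntropy ρ x - f x) := by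
  have hu := halfEntropy_mem hρ
  have hneg : (fun x => -f x) ∈ M.test := M.test.neg_mem hf
  have h2 := hamiltonian_halfEntropy_add hM hρ hneg
  simp only [sub_neg_eq_add, ← sub_eq_add_neg] at h2
  rw [hamiltonian_halfEntropy_add hM hρ hf, h2]
  exact integral_base_symm hM hρ (exp_mem_test hM (sub_mem_test hu hf))
    (exp_mem_test hM (add_mem_test hu hf))

/-- The derivative of the tilted Hamiltonian at `f`, a signed density. -/
def tiltedGradient (M : Model d) (ρ f : X d → ℝ) (x : X d) : ℝ :=
  M.base ρ x * M.wronskian (fun y => Real.exp (M.halfEntropy ρ y + f y))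
    (fun y => Real.exp (M.halfEntropy ρ y - f y)) x

/-- The tilted Hamiltonian is convex, with an explicit subgradient. -/
lemma hamiltonian_subgradient {f g : X d → ℝ} (hf : f ∈ M.test) (hg : g ∈ M.test) :
    H₂ ρ (fun x => M.halfEntropy ρ x + f x) + ∫ x, (g x - f x) * M.tiltedGradient ρ f x ≤
      H₂ ρ (fun x => M.halfEntropy ρ x + g x) := by
  have hu := halfEntropy_mem hρ
  have huf := add_mem_test hu hf
  have hug := add_mem_test hu hg
  have hδ := sub_mem_test hg hf
  have e1 := exp_mem_test hM huf
  have e2 := exp_mem_test hM hug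
  have e3 := exp_mem_test hM (sub_mem_test hu hf)
  have e4 := exp_mem_test hM (sub_mem_test hu hg)
  have e5 := mul_mem_test hM hδ e1
  have e6 := mul_mem_test hM hδ e3
  have i1 := integrable_base_mul_liftGen hM hρ e3 e1
  have i2 := integrable_base_mul_liftGen hM hρ e4 e2
  have i3 := integrable_base_mul_liftGen hM hρ e3 e5
  have i4 := integrable_base_mul_liftGen hM hρ e6 e1
  have i5 := integrable_base_mul_liftGen hM hρ e5 e3
  have hgrad : ∫ x, (g x - f x) * M.tiltedGradient ρ f x =
      (∫ x, M.base ρ x * (Real.exp (M.halfEntropy ρ x - f x) *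
        liftGen M.gen (fun y => (g y - f y) * Real.exp (M.halfEntropy ρ y + f y)) x)) -
      ∫ x, M.base ρ x * (((g x - f x) * Real.exp (M.halfEntropy ρ x - f x)) *
        liftGen M.gen (fun y => Real.exp (M.halfEntropy ρ y + f y)) x) := by
    rw [integral_base_symm hM hρ e3 e5, ← integral_sub i5 i4]
    refine integral_congr_ae (Eventually.of_forall fun x => ?_)
    simp only [tiltedGradient, wronskian]
    ring
  rw [hgrad, hamiltonian_halfEntropy_add hM hρ hf, hamiltonian_halfEntropy_add hM hρ hg,
    ← integral_sub i3 i4]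
  have i34 := i3.sub i4
  rw [Pi.sub_def] at i34
  rw [← integral_add i1 i34]
  refine integral_mono (i1.add i34) i2 fun x => ?_
  have h := exp_liftGen_subgradient hM huf hug x
  have hr := mul_le_mul_of_nonneg_left h (hρ.nonneg x)
  have r1 : ρ x * Real.exp (-(M.halfEntropy ρ x + f x)) =
      M.base ρ x * Real.exp (M.halfEntropy ρ x - f x) := by
    conv_lhs => rw [← base_mul_exp hρ x]
    rw [mul_assoc, ← Real.exp_add]
    congr 2
    ring
  have r2 : ρ x * Real.exp (-(M.halfEntropy ρ x + g x)) =
      M.base ρ x * Real.exp (M.halfEntropy ρ x - g x) := by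
    conv_lhs => rw [← base_mul_exp hρ x]
    rw [mul_assoc, ← Real.exp_add]
    congr 2
    ring
  simp only [add_sub_add_left_eq_sub] at hr
  rw [← mul_assoc (ρ x) (Real.exp (-(M.halfEntropy ρ x + g x))), r2] at hr
  refine le_trans (le_of_eq ?_) (hr.trans (le_of_eq (by ring)))
  simp only
  linear_combination (-(liftGen M.gen (fun y => Real.exp (M.halfEntropy ρ y + f y)) x) -
    liftGen M.gen (fun y => (g y - f y) * Real.exp (M.halfEntropy ρ y + f y)) x +
    (g x - f x) * liftGen M.gen (fun y => Real.exp (M.halfEntropy ρ y + f y)) x) * r1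

end Reversibility

/-! ### The adjoint of the generator -/

section Adjoint

variable (hM : M.Condition H₂) (hρ : M.IsState ρ)
include hM hρ

omit hρ in
/-- The density of `𝒢*(ρ)` is the gradient of the tilted Hamiltonian at `-dS(ρ)/2`. -/
lemma tiltedGradient_neg_halfEntropy (x : X d) :
    M.tiltedGradient ρ (fun y => -M.halfEntropy ρ y) x =
      M.base ρ x * liftGen M.gen (fun y => Real.exp (2 * M.halfEntropy ρ y)) x := by
  simp only [tiltedGradient, wronskian, add_neg_cancel, Real.exp_zero, sub_neg_eq_add, one_mul,
    liftGen_const hM, mul_zero, sub_zero, ← two_mul]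

/-- By symmetry of `𝒢` with respect to `base`, the density `base 𝒢(ρ/base)` represents `𝒢*(ρ)`. -/
lemma isAdjointImage_tiltedGradient :
    M.IsAdjointImage ρ (M.tiltedGradient ρ fun y => -M.halfEntropy ρ y) := by
  have hu := halfEntropy_mem hρ
  have hneg : (fun x => -M.halfEntropy ρ x) ∈ M.test := M.test.neg_mem hu
  refine ⟨base_wronskian_mem_tan hM hρ (exp_mem_test hM (add_mem_test hu hneg))
    (exp_mem_test hM (sub_mem_test hu hneg)), fun f hf => ?_⟩
  have h2 : (fun y => Real.exp (2 * M.halfEntropy ρ y)) ∈ M.test :=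
    exp_mem_test hM (M.test.smul_mem 2 hu)
  have h := integral_base_symm hM hρ hf h2
  refine Eq.trans ?_ (h.trans ?_)
  · refine integral_congr_ae (Eventually.of_forall fun x => ?_)
    simp only [tiltedGradient_neg_halfEntropy hM]
    ring
  · refine integral_congr_ae (Eventually.of_forall fun x => ?_)
    simp only
    conv_rhs => rw [← base_mul_exp hρ x]
    ring

lemma isAdjointImage_adjointGen : M.IsAdjointImage ρ (M.adjointGen ρ) := by
  have h : ∃ g, M.IsAdjointImage ρ g := ⟨_, isAdjointImage_tiltedGradient hM hρ⟩
  rw [adjointGen, dif_pos h]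
  exact h.choose_spec

lemma adjointGen_ae_eq :
    M.adjointGen ρ =ᵐ[volume] M.tiltedGradient ρ fun y => -M.halfEntropy ρ y := by
  obtain ⟨t1, h1⟩ := isAdjointImage_adjointGen hM hρ
  obtain ⟨t2, h2⟩ := isAdjointImage_tiltedGradient hM hρ
  refine ae_eq_of_integral_contDiff_smul_eq t1.1.locallyIntegrable t2.1.locallyIntegrable
    fun f hf hc => ?_
  have hft := hM.test_compact f (contDiff_two_of_smooth hf) hc
  simp only [smul_eq_mul]
  rw [h1 f hft, h2 f hft]

end Adjoint

end Model

/-! ### Legendre transforms with respect to a pairing -/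

section Conjugate

variable {A B : Type*} (b : A → B → ℝ) (S : Set B) (φ : B → EReal)

/-- The Legendre transform of `φ`, as a function on `S`, with respect to the pairing `b`. -/
def conjugate (a : A) : EReal := ⨆ x ∈ S, (b a x : EReal) - φ x

variable {b S φ}

lemma sub_le_conjugate (a : A) {x : B} (hx : x ∈ S) : (b a x : EReal) - φ x ≤ conjugate b S φ a :=
  le_iSup₂ (f := fun x _ => (b a x : EReal) - φ x) x hx

lemma conjugate_nonneg {x : B} (hx : x ∈ S) (hφ : φ x = 0) (a : A) (hb : b a x = 0) :
    0 ≤ conjugate b S φ a := by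
  have h := sub_le_conjugate (b := b) (φ := φ) a hx
  rwa [hφ, hb, EReal.coe_zero, sub_zero] at h

lemma conjugate_zero {x : B} (hx : x ∈ S) (hφ : φ x = 0) (h0 : ∀ y ∈ S, 0 ≤ φ y) (a : A)
    (hb : ∀ y ∈ S, b a y = 0) : conjugate b S φ a = 0 := by
  refine le_antisymm (iSup₂_le fun y hy => ?_) (conjugate_nonneg hx hφ a (hb x hx))
  rw [hb y hy, EReal.coe_zero, zero_sub]
  exact EReal.neg_le_zero.2 (h0 y hy)

lemma conjugate_le_of_neg [Neg B] (hS : ∀ x ∈ S, -x ∈ S) (hφ : ∀ x ∈ S, φ (-x) = φ x) {a a' : A}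
    (hb : ∀ x ∈ S, b a' x = b a (-x)) : conjugate b S φ a' ≤ conjugate b S φ a := by
  refine iSup₂_le fun x hx => ?_
  rw [hb x hx, ← hφ x hx]
  exact sub_le_conjugate a (hS x hx)

lemma conjugate_neg [InvolutiveNeg B] (hS : ∀ x ∈ S, -x ∈ S) (hφ : ∀ x ∈ S, φ (-x) = φ x) {a a' : A}
    (hb : ∀ x ∈ S, b a' x = b a (-x)) : conjugate b S φ a' = conjugate b S φ a := by
  refine le_antisymm (conjugate_le_of_neg hS hφ hb) (conjugate_le_of_neg hS hφ fun x hx => ?_)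
  rw [hb (-x) (hS x hx), neg_neg]

lemma conjugate_convex (h0 : ∀ y ∈ S, 0 ≤ φ y) {a a' c : A} {s t : ℝ} (hs : 0 ≤ s) (ht : 0 ≤ t)
    (hst : s + t = 1) (hb : ∀ x ∈ S, b c x = s * b a x + t * b a' x) :
    conjugate b S φ c ≤ (s : EReal) * conjugate b S φ a + (t : EReal) * conjugate b S φ a' := by
  refine iSup₂_le fun x hx => ?_
  have h1 := sub_le_conjugate (b := b) (φ := φ) a hx
  have h2 := sub_le_conjugate (b := b) (φ := φ) a' hx
  have hx0 := h0 x hx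
  rw [hb x hx]
  induction hφ : φ x with
  | bot => simp [hφ] at hx0
  | top => simp [EReal.sub_top]
  | coe r =>
    rw [hφ] at h1 h2
    have hs' : (0 : EReal) ≤ s := by exact_mod_cast hs
    have ht' : (0 : EReal) ≤ t := by exact_mod_cast ht
    have e : ((s * b a x + t * b a' x : ℝ) : EReal) - (r : EReal) =
        (s : EReal) * ((b a x : EReal) - r) + (t : EReal) * ((b a' x : EReal) - r) := by
      rw [← EReal.coe_sub, ← EReal.coe_sub, ← EReal.coe_sub, ← EReal.coe_mul, ← EReal.coe_mul,
        ← EReal.coe_add]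
      congr 1
      linear_combination r * hst
    rw [e]
    exact add_le_add (mul_le_mul_of_nonneg_left h1 hs') (mul_le_mul_of_nonneg_left h2 ht')

/-- Young's inequality `y ≤ u + v` can be solved for either potential, also when one is infinite. -/
lemma coe_sub_le_of_coe_sub_le {y : ℝ} {u v : EReal} (hu : 0 ≤ u)
    (h : (y : EReal) - u ≤ v) (hv : 0 ≤ v) : (y : EReal) - v ≤ u := by
  induction u with
  | bot => simp at hu
  | top => exact le_top
  | coe u =>
    induction v with
    | bot => simp at hv
    | top => simp [EReal.sub_top]
    | coe v =>
      rw [← EReal.coe_sub, EReal.coe_le_coe_iff] at h ⊢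
      linarith

end Conjugate

lemma momentumPart_add (ξ η : X d → ℝ) :
    momentumPart (ξ + η) = momentumPart ξ + momentumPart η := by
  funext x
  simp only [momentumPart, Pi.add_apply]
  ring

lemma momentumPart_smul (a : ℝ) (ξ : X d → ℝ) : momentumPart (a • ξ) = a • momentumPart ξ := by
  funext x
  simp only [momentumPart, Pi.smul_apply, smul_eq_mul]
  ring

lemma pair_smul_right (v ξ : X d → ℝ) (a : ℝ) : pair v (a • ξ) = a * pair v ξ := by
  simp only [pair, Pi.smul_apply, smul_eq_mul, mul_assoc, integral_const_mul]

lemma pair_smul_left (v ξ : X d → ℝ) (a : ℝ) : pair (a • v) ξ = a * pair v ξ := by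
  simp only [pair, Pi.smul_apply, smul_eq_mul, mul_left_comm, integral_const_mul]

lemma pair_neg_right (v ξ : X d → ℝ) : pair v (-ξ) = -pair v ξ := by
  rw [← neg_one_smul ℝ, pair_smul_right, neg_one_mul]

lemma pair_neg_left (v ξ : X d → ℝ) : pair (-v) ξ = -pair v ξ := by
  rw [← neg_one_smul ℝ, pair_smul_left, neg_one_mul]

lemma pair_zero_right (v : X d → ℝ) : pair v 0 = 0 := by simp [pair]

lemma pair_zero_left (ξ : X d → ℝ) : pair 0 ξ = 0 := by simp [pair]

lemma pair_congr_left {v w : X d → ℝ} (h : v =ᵐ[volume] w) (ξ : X d → ℝ) : pair v ξ = pair w ξ :=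
  integral_congr_ae (h.mono fun x hx => by simp only [hx])

namespace Model

variable {M : Model d} {H₂ : (X d → ℝ) → (X d → ℝ) → ℝ} {ρ : X d → ℝ}

/-! ### The dissipation potentials -/

section Core

variable {ξ η : X d → ℝ}

lemma core_add (hξ : ξ ∈ M.core ρ) (hη : η ∈ M.core ρ) : ξ + η ∈ M.core ρ :=
  ⟨(M.cot ρ).add_mem hξ.1 hη.1, by
    rw [momentumPart_add]
    exact M.test.add_mem hξ.2 hη.2⟩

lemma core_smul (hξ : ξ ∈ M.core ρ) (a : ℝ) : a • ξ ∈ M.core ρ :=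
  ⟨(M.cot ρ).smul_mem a hξ.1, by
    rw [momentumPart_smul]
    exact M.test.smul_mem a hξ.2⟩

lemma core_neg (hξ : ξ ∈ M.core ρ) : -ξ ∈ M.core ρ := by
  rw [← neg_one_smul ℝ]
  exact core_smul hξ _

lemma zero_mem_core : (0 : X d → ℝ) ∈ M.core ρ :=
  ⟨(M.cot ρ).zero_mem, by
    have : momentumPart (0 : X d → ℝ) = 0 := by
      funext x
      simp [momentumPart]
    rw [this]
    exact M.test.zero_mem⟩

lemma dEntropy_mem_core (hρ : M.IsState ρ) : M.dEntropy ρ ∈ M.core ρ :=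
  ⟨hρ.dEntropy_mem, hρ.dEntropy_test⟩

end Core

lemma shiftedHamiltonian_eq (ξ : X d → ℝ) : M.shiftedHamiltonian H₂ ρ ξ =
    H₂ ρ (fun x => M.halfEntropy ρ x + momentumPart ξ x) - H₂ ρ (M.halfEntropy ρ) := by
  rw [shiftedHamiltonian, momentumPart_add, add_comm]
  rfl

/-- The derivative of the shifted Hamiltonian at `ξ`. -/
def coreGradient (M : Model d) (ρ ξ : X d → ℝ) : X d → ℝ := M.tiltedGradient ρ (momentumPart ξ)

variable (hM : M.Condition H₂) (hρ : M.IsState ρ)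

section Shifted

variable {ξ η : X d → ℝ}

lemma shiftedHamiltonian_zero : M.shiftedHamiltonian H₂ ρ 0 = 0 := by
  simp [shiftedHamiltonian]

lemma coreGradient_zero : M.coreGradient ρ 0 = 0 := by
  funext x
  simp [coreGradient, tiltedGradient, wronskian, momentumPart]

include hM hρ

/-- Evenness of the shifted Hamiltonian, a consequence of reversibility. -/
lemma shiftedHamiltonian_neg (hξ : ξ ∈ M.core ρ) :
    M.shiftedHamiltonian H₂ ρ (-ξ) = M.shiftedHamiltonian H₂ ρ ξ := by
  rw [shiftedHamiltonian_eq, shiftedHamiltonian_eq, hamiltonian_even hM hρ hξ.2]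
  congr 2
  funext x
  simp only [momentumPart, Pi.neg_apply]
  ring

lemma coreGradient_mem_tan (hξ : ξ ∈ M.core ρ) : M.coreGradient ρ ξ ∈ M.tan ρ :=
  base_wronskian_mem_tan hM hρ (exp_mem_test hM (add_mem_test (halfEntropy_mem hρ) hξ.2))
    (exp_mem_test hM (sub_mem_test (halfEntropy_mem hρ) hξ.2))

lemma pair_coreGradient (hξ : ξ ∈ M.core ρ) (hη : η ∈ M.cot ρ) :
    pair (M.coreGradient ρ ξ) η = ∫ x, momentumPart η x * M.coreGradient ρ ξ x :=
  (pair_base_wronskian hM hρ (exp_mem_test hM (add_mem_test (halfEntropy_mem hρ) hξ.2))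
    (exp_mem_test hM (sub_mem_test (halfEntropy_mem hρ) hξ.2)) hη).2

lemma pair_add_right {v : X d → ℝ} (hv : v ∈ M.tan ρ) (hξ : ξ ∈ M.cot ρ) (hη : η ∈ M.cot ρ) :
    pair v (ξ + η) = pair v ξ + pair v η := by
  simp only [pair, Pi.add_apply, add_mul]
  exact integral_add (integrable_pair hM hρ hv hξ) (integrable_pair hM hρ hv hη)

lemma pair_sub_right {v : X d → ℝ} (hv : v ∈ M.tan ρ) (hξ : ξ ∈ M.cot ρ) (hη : η ∈ M.cot ρ) :
    pair v (ξ - η) = pair v ξ - pair v η := by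
  rw [sub_eq_add_neg, pair_add_right hM hρ hv hξ ((M.cot ρ).neg_mem hη), pair_neg_right,
    sub_eq_add_neg]

lemma pair_add_left {v w : X d → ℝ} (hv : v ∈ M.tan ρ) (hw : w ∈ M.tan ρ) (hξ : ξ ∈ M.cot ρ) :
    pair (v + w) ξ = pair v ξ + pair w ξ := by
  simp only [pair, Pi.add_apply, mul_add]
  exact integral_add (integrable_pair hM hρ hv hξ) (integrable_pair hM hρ hw hξ)

/-- Convexity of the shifted Hamiltonian, in the form of a subgradient inequality. -/
lemma shiftedHamiltonian_subgradient (hξ : ξ ∈ M.core ρ) (hη : η ∈ M.core ρ) :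
    M.shiftedHamiltonian H₂ ρ ξ + (pair (M.coreGradient ρ ξ) η - pair (M.coreGradient ρ ξ) ξ) ≤
      M.shiftedHamiltonian H₂ ρ η := by
  have hv := coreGradient_mem_tan hM hρ hξ
  rw [← pair_sub_right hM hρ hv hη.1 hξ.1,
    pair_coreGradient hM hρ hξ ((M.cot ρ).sub_mem hη.1 hξ.1), shiftedHamiltonian_eq,
    shiftedHamiltonian_eq]
  have h := hamiltonian_subgradient hM hρ hξ.2 hη.2
  have e : ∀ x, momentumPart (η - ξ) x = momentumPart η x - momentumPart ξ x := fun x => by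
    simp only [momentumPart, Pi.sub_apply]
    ring
  simp only [e]
  simp only [coreGradient]
  linarith

/-- An even convex function has its minimum at zero, where the gradient vanishes. -/
lemma shiftedHamiltonian_nonneg (hξ : ξ ∈ M.core ρ) : 0 ≤ M.shiftedHamiltonian H₂ ρ ξ := by
  have h := shiftedHamiltonian_subgradient hM hρ zero_mem_core hξ
  rwa [shiftedHamiltonian_zero, coreGradient_zero, pair_zero_left, pair_zero_left, sub_zero,
    add_zero] at h

end Shifted

lemma Ψ_eq_conjugate (v : X d → ℝ) : M.Ψ H₂ ρ v =
    conjugate pair (M.core ρ) (fun ξ => (M.shiftedHamiltonian H₂ ρ ξ : EReal)) v := by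
  simp only [Ψ, conjugate, EReal.coe_sub]

lemma Ψstar_eq_conjugate (ξ : X d → ℝ) : M.Ψstar H₂ ρ ξ =
    conjugate (fun ξ v => pair v ξ) (M.tan ρ : Set (X d → ℝ)) (M.Ψ H₂ ρ) ξ := rfl

lemma extΨ_eq_conjugate (z v : ExtSpace d) : M.extΨ H₂ z v =
    conjugate pairExt (M.extStateSpace.cot z : Set (ExtSpace d)) (M.extΨstar H₂ z) v := rfl

lemma Ψ_nonneg (v : X d → ℝ) : 0 ≤ M.Ψ H₂ ρ v := by
  rw [Ψ_eq_conjugate]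
  refine conjugate_nonneg zero_mem_core ?_ v (pair_zero_right v)
  rw [shiftedHamiltonian_zero, EReal.coe_zero]

lemma Ψ_congr {v w : X d → ℝ} (h : v =ᵐ[volume] w) : M.Ψ H₂ ρ v = M.Ψ H₂ ρ w := by
  simp only [Ψ, pair_congr_left h]

lemma pair_sub_le_Ψ {ξ : X d → ℝ} (hξ : ξ ∈ M.core ρ) (v : X d → ℝ) :
    ((pair v ξ - M.shiftedHamiltonian H₂ ρ ξ : ℝ) : EReal) ≤ M.Ψ H₂ ρ v :=
  le_iSup₂ (f := fun ξ _ => ((pair v ξ - M.shiftedHamiltonian H₂ ρ ξ : ℝ) : EReal)) ξ hξ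

lemma pair_sub_le_Ψstar {v : X d → ℝ} (hv : v ∈ M.tan ρ) (ξ : X d → ℝ) :
    (pair v ξ : EReal) - M.Ψ H₂ ρ v ≤ M.Ψstar H₂ ρ ξ :=
  le_iSup₂ (f := fun v _ => (pair v ξ : EReal) - M.Ψ H₂ ρ v) v hv

section Potentials

include hM hρ

lemma Ψ_zero : M.Ψ H₂ ρ 0 = 0 := by
  rw [Ψ_eq_conjugate]
  refine conjugate_zero zero_mem_core ?_ (fun η hη => ?_) 0 fun η _ => pair_zero_left η
  · rw [shiftedHamiltonian_zero, EReal.coe_zero]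
  · exact_mod_cast shiftedHamiltonian_nonneg hM hρ hη

lemma Ψ_neg (v : X d → ℝ) : M.Ψ H₂ ρ (-v) = M.Ψ H₂ ρ v := by
  rw [Ψ_eq_conjugate, Ψ_eq_conjugate]
  refine conjugate_neg (fun ξ hξ => core_neg hξ) (fun ξ hξ => ?_) fun ξ _ => ?_
  · rw [shiftedHamiltonian_neg hM hρ hξ]
  · rw [pair_neg_left, pair_neg_right]

/-- At a gradient the supremum that defines `Ψ` is attained. -/
lemma Ψ_coreGradient {ξ : X d → ℝ} (hξ : ξ ∈ M.core ρ) : M.Ψ H₂ ρ (M.coreGradient ρ ξ) =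
    ((pair (M.coreGradient ρ ξ) ξ - M.shiftedHamiltonian H₂ ρ ξ : ℝ) : EReal) := by
  refine le_antisymm (iSup₂_le fun η hη => ?_) (pair_sub_le_Ψ hξ _)
  have h := shiftedHamiltonian_subgradient hM hρ hξ hη
  rw [EReal.coe_le_coe_iff]
  linarith

/-- On the core, the dual potential is the shifted Hamiltonian. -/
lemma Ψstar_eq_shiftedHamiltonian {ξ : X d → ℝ} (hξ : ξ ∈ M.core ρ) :
    M.Ψstar H₂ ρ ξ = (M.shiftedHamiltonian H₂ ρ ξ : EReal) := by
  refine le_antisymm (iSup₂_le fun v _ => ?_) ?_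
  · refine coe_sub_le_of_coe_sub_le ?_ ?_ (Ψ_nonneg v)
    · exact_mod_cast shiftedHamiltonian_nonneg hM hρ hξ
    · rw [← EReal.coe_sub]
      exact pair_sub_le_Ψ hξ v
  · have h := pair_sub_le_Ψstar (H₂ := H₂) (coreGradient_mem_tan hM hρ hξ) ξ
    rwa [Ψ_coreGradient hM hρ hξ, ← EReal.coe_sub, sub_sub_cancel] at h

omit hρ in
lemma Ψstar_nonneg (hρ : M.IsState ρ) (ξ : X d → ℝ) : 0 ≤ M.Ψstar H₂ ρ ξ := by
  rw [Ψstar_eq_conjugate]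
  exact conjugate_nonneg (M.tan ρ).zero_mem (Ψ_zero hM hρ) ξ (pair_zero_left ξ)

lemma Ψstar_zero : M.Ψstar H₂ ρ 0 = 0 := by
  rw [Ψstar_eq_conjugate]
  exact conjugate_zero (M.tan ρ).zero_mem (Ψ_zero hM hρ) (fun v _ => Ψ_nonneg v) 0
    fun v _ => pair_zero_right v

lemma Ψstar_neg (ξ : X d → ℝ) : M.Ψstar H₂ ρ (-ξ) = M.Ψstar H₂ ρ ξ := by
  rw [Ψstar_eq_conjugate, Ψstar_eq_conjugate]
  refine conjugate_neg (fun v hv => (M.tan ρ).neg_mem hv) (fun v _ => Ψ_neg hM hρ v) fun v _ => ?_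
  rw [pair_neg_left, pair_neg_right]

lemma Ψstar_convex {ξ η : X d → ℝ} (hξ : ξ ∈ M.cot ρ) (hη : η ∈ M.cot ρ) {a b : ℝ} (ha : 0 ≤ a)
    (hb : 0 ≤ b) (hab : a + b = 1) :
    M.Ψstar H₂ ρ (a • ξ + b • η) ≤ (a : EReal) * M.Ψstar H₂ ρ ξ + (b : EReal) * M.Ψstar H₂ ρ η := by
  simp only [Ψstar_eq_conjugate]
  refine conjugate_convex (fun v _ => Ψ_nonneg v) ha hb hab fun v hv => ?_
  rw [pair_add_right hM hρ hv ((M.cot ρ).smul_mem a hξ) ((M.cot ρ).smul_mem b hη),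
    pair_smul_right, pair_smul_right]

/-- `Ψ` is the Legendre transform of its dual. -/
lemma Ψ_eq_iSup_Ψstar {v : X d → ℝ} (hv : v ∈ M.tan ρ) :
    M.Ψ H₂ ρ v = ⨆ ξ ∈ M.cot ρ, (pair v ξ : EReal) - M.Ψstar H₂ ρ ξ := by
  refine le_antisymm (iSup₂_le fun ξ hξ => ?_) (iSup₂_le fun ξ _ => ?_)
  · rw [EReal.coe_sub, ← Ψstar_eq_shiftedHamiltonian hM hρ hξ]
    exact le_iSup₂ (f := fun ξ _ => (pair v ξ : EReal) - M.Ψstar H₂ ρ ξ) ξ hξ.1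
  · exact coe_sub_le_of_coe_sub_le (Ψ_nonneg v) (pair_sub_le_Ψstar hv ξ) (Ψstar_nonneg hM hρ ξ)

end Potentials

/-! ### The extended system -/

section Extended

variable {z : ExtSpace d} (hz : M.IsState z.1)
include hM hz

lemma sub_smul_dEnergy_mem {ζ : ExtSpace d} (hζ : ζ ∈ M.extStateSpace.cot z) :
    ζ.1 - ζ.2 • M.dEnergy z.1 ∈ M.cot z.1 :=
  (M.cot z.1).sub_mem hζ.1 ((M.cot z.1).smul_mem _ (dEnergy_mem hM hz))

/-- On tangent vectors that conserve the total energy, `Ψ̄` is `Ψ`. -/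
lemma extΨ_eq_Ψ {v : X d → ℝ} (hv : v ∈ M.tan z.1) :
    M.extΨ H₂ z (v, -pair v (M.dEnergy z.1)) = M.Ψ H₂ z.1 v := by
  have hE := dEnergy_mem hM hz
  rw [Ψ_eq_iSup_Ψstar hM hz hv]
  refine le_antisymm (iSup₂_le fun ζ hζ => ?_) (iSup₂_le fun ξ hξ => ?_)
  · refine le_iSup₂_of_le (ζ.1 - ζ.2 • M.dEnergy z.1) (sub_smul_dEnergy_mem hM hz hζ) ?_
    rw [pair_sub_right hM hz hv hζ.1 ((M.cot z.1).smul_mem _ hE), pair_smul_right, extΨstar,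
      pairExt]
    simp only
    rw [show pair v ζ.1 + -pair v (M.dEnergy z.1) * ζ.2 =
      pair v ζ.1 - ζ.2 * pair v (M.dEnergy z.1) by ring]
  · refine le_iSup₂_of_le (ξ, (0 : ℝ)) ⟨hξ, trivial⟩ ?_
    rw [extΨstar, pairExt]
    simp

/-- Tangent vectors that do not conserve the total energy have infinite dissipation. -/
lemma extΨ_eq_top {v : X d → ℝ} {s : ℝ} (hs : s ≠ -pair v (M.dEnergy z.1)) :
    M.extΨ H₂ z (v, s) = ⊤ := by
  refine (EReal.eq_top_iff_forall_lt _).2 fun y => ?_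
  have hc : pair v (M.dEnergy z.1) + s ≠ 0 := fun h => hs (by linarith)
  let r : ℝ := (y + 1) / (pair v (M.dEnergy z.1) + s)
  have h := sub_le_conjugate (b := pairExt) (φ := M.extΨstar H₂ z) (v, s)
    (S := (M.extStateSpace.cot z : Set (ExtSpace d))) (x := (r • M.dEnergy z.1, r))
    ⟨(M.cot z.1).smul_mem _ (dEnergy_mem hM hz), trivial⟩
  rw [← extΨ_eq_conjugate, extΨstar] at h
  simp only at h
  rw [sub_self, Ψstar_zero hM hz, sub_zero, pairExt] at h
  simp only at h
  rw [pair_smul_right, show r * pair v (M.dEnergy z.1) + s * r = y + 1 by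
    simp only [r]
    field_simp] at h
  refine lt_of_lt_of_le ?_ h
  exact_mod_cast lt_add_one y

omit hM hz in
lemma extΨstar_add_smul (ζ : ExtSpace d) (α : ℝ) :
    M.extΨstar H₂ z (ζ + α • M.dExtEnergy z) = M.extΨstar H₂ z ζ := by
  simp only [extΨstar]
  congr 1
  simp only [dExtEnergy, Prod.fst_add, Prod.snd_add, Prod.smul_fst, Prod.smul_snd, smul_eq_mul,
    mul_one, add_smul]
  abel

/-- `Ψ̄*` is the Legendre transform of `Ψ̄`: only tangent vectors that conserve the total energy
contribute. -/
lemma extΨstar_eq_iSup {ζ : ExtSpace d} (hζ : ζ ∈ M.extStateSpace.cot z) :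
    M.extΨstar H₂ z ζ = ⨆ v ∈ M.extStateSpace.tan z, (pairExt v ζ : EReal) - M.extΨ H₂ z v := by
  have hE := dEnergy_mem hM hz
  have key : ∀ v ∈ M.tan z.1, pairExt (v, -pair v (M.dEnergy z.1)) ζ =
      pair v (ζ.1 - ζ.2 • M.dEnergy z.1) := fun v hv => by
    rw [pair_sub_right hM hz hv hζ.1 ((M.cot z.1).smul_mem _ hE), pair_smul_right, pairExt]
    simp only
    ring
  refine le_antisymm (iSup₂_le fun v hv => ?_) (iSup₂_le fun v hv => ?_)
  · refine le_iSup₂_of_le (v, -pair v (M.dEnergy z.1)) ⟨hv, trivial⟩ ?_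
    rw [key v hv, extΨ_eq_Ψ hM hz hv]
  · obtain ⟨v, s⟩ := v
    by_cases hs : s = -pair v (M.dEnergy z.1)
    · rw [hs, key v hv.1, extΨ_eq_Ψ hM hz hv.1]
      exact pair_sub_le_Ψstar hv.1 _
    · rw [extΨ_eq_top hM hz hs, EReal.sub_top]
      exact bot_le

lemma extΨstar_nonneg (ζ : ExtSpace d) : 0 ≤ M.extΨstar H₂ z ζ := Ψstar_nonneg hM hz _

lemma extΨstar_zero : M.extΨstar H₂ z 0 = 0 := by
  rw [extΨstar, Prod.fst_zero, Prod.snd_zero, zero_smul, sub_zero, Ψstar_zero hM hz]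

lemma extΨstar_neg (ζ : ExtSpace d) : M.extΨstar H₂ z (-ζ) = M.extΨstar H₂ z ζ := by
  rw [extΨstar, extΨstar, ← Ψstar_neg hM hz]
  congr 1
  rw [Prod.fst_neg, Prod.snd_neg, neg_smul]
  abel

lemma pairExt_add_smul {v w ζ : ExtSpace d} (hv : v ∈ M.extStateSpace.tan z)
    (hw : w ∈ M.extStateSpace.tan z) (hζ : ζ ∈ M.extStateSpace.cot z) (a b : ℝ) :
    pairExt (a • v + b • w) ζ = a * pairExt v ζ + b * pairExt w ζ := by
  simp only [pairExt, Prod.fst_add, Prod.snd_add, Prod.smul_fst, Prod.smul_snd, smul_eq_mul]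
  rw [pair_add_left hM hz ((M.tan z.1).smul_mem a hv.1) ((M.tan z.1).smul_mem b hw.1) hζ.1,
    pair_smul_left, pair_smul_left]
  ring

end Extended

include hM

lemma isSymmetricDissipationPair :
    IsSymmetricDissipationPair M.extStateSpace (M.extΨ H₂) (M.extΨstar H₂) where
  nonneg z hz v _ := conjugate_nonneg (M.extStateSpace.cot z).zero_mem (extΨstar_zero hM hz) v
    (by simp [pairExt, pair])
  nonneg_dual z hz ξ _ := extΨstar_nonneg hM hz ξ
  zero z hz := conjugate_zero (M.extStateSpace.cot z).zero_mem (extΨstar_zero hM hz)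
    (fun ζ _ => extΨstar_nonneg hM hz ζ) 0 fun ζ _ => by simp [pairExt, pair]
  zero_dual z hz := extΨstar_zero hM hz
  legendre z _ v _ := rfl
  legendre_dual z hz ξ hξ := extΨstar_eq_iSup hM hz hξ
  convex z hz v hv w hw a b ha hb hab := conjugate_convex
    (fun ζ _ => extΨstar_nonneg hM hz ζ) ha hb hab
    fun ζ hζ => pairExt_add_smul hM hz hv hw hζ a b
  convex_dual z hz ξ hξ η hη a b ha hb hab := by
    have h := Ψstar_convex hM hz (sub_smul_dEnergy_mem hM hz hξ) (sub_smul_dEnergy_mem hM hz hη)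
      ha hb hab
    refine le_trans (le_of_eq ?_) h
    rw [extΨstar]
    congr 1
    simp only [Prod.fst_add, Prod.snd_add, Prod.smul_fst, Prod.smul_snd, smul_eq_mul, add_smul,
      smul_sub, mul_smul]
    abel
  symm z hz v _ := conjugate_neg (fun ζ hζ => (M.extStateSpace.cot z).neg_mem hζ)
    (fun ζ _ => extΨstar_neg hM hz ζ) fun ζ _ => by
      simp only [pairExt, Prod.fst_neg, Prod.snd_neg, pair_neg_left, pair_neg_right]
      ring
  symm_dual z hz ξ _ := extΨstar_neg hM hz ξ

section Drift

include hρ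

lemma pair_poisson_self {ξ : X d → ℝ} (hξ : ξ ∈ M.cot ρ) : pair (poisson ρ ξ) ξ = 0 := by
  linarith [pair_poisson_antisymm hM hρ hξ hξ]

lemma drift_mem_tan : M.drift ρ ∈ M.tan ρ := by
  rw [drift_eq hM hρ]
  exact (M.tan ρ).add_mem (poisson_mem_tan hM hρ (dEnergy_mem hM hρ))
    (isAdjointImage_adjointGen hM hρ).1

lemma pair_drift {ξ : X d → ℝ} (hξ : ξ ∈ M.cot ρ) :
    pair (M.drift ρ) ξ = pair (poisson ρ (M.dEnergy ρ)) ξ + pair (M.adjointGen ρ) ξ := by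
  rw [drift_eq hM hρ]
  exact pair_add_left hM hρ (poisson_mem_tan hM hρ (dEnergy_mem hM hρ))
    (isAdjointImage_adjointGen hM hρ).1 hξ

lemma pair_drift_dEnergy :
    pair (M.drift ρ) (M.dEnergy ρ) = pair (M.adjointGen ρ) (M.dEnergy ρ) := by
  rw [pair_drift hM hρ (dEnergy_mem hM hρ), pair_poisson_self hM hρ (dEnergy_mem hM hρ), zero_add]

/-- The Hamiltonian part of the dynamics does not change the entropy. -/
lemma pair_drift_dEntropy :
    pair (M.drift ρ) (M.dEntropy ρ) = pair (M.adjointGen ρ) (M.dEntropy ρ) := by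
  have hE := dEnergy_mem hM hρ
  have hl := log_mem_cot hM hρ
  have h : M.dEntropy ρ = (fun x => Real.log (ρ x) + 1) + M.dEnergy ρ := rfl
  have h0 : pair (poisson ρ (M.dEnergy ρ)) (M.dEntropy ρ) = 0 := by
    rw [h, pair_add_right hM hρ (poisson_mem_tan hM hρ hE) hl hE, pair_poisson_self hM hρ hE,
      pair_poisson_antisymm hM hρ hE hl, poisson_log hM hρ, pair_zero_left, neg_zero, zero_add]
  rw [pair_drift hM hρ hρ.dEntropy_mem, h0, zero_add]

/-- `𝒢*(ρ)` is the gradient of the shifted Hamiltonian at `-dS(ρ)/2`. -/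
lemma adjointGen_ae_eq_coreGradient :
    M.adjointGen ρ =ᵐ[volume] M.coreGradient ρ (-(1 / 2 : ℝ) • M.dEntropy ρ) := by
  have h : momentumPart (-(1 / 2 : ℝ) • M.dEntropy ρ) = fun y => -M.halfEntropy ρ y := by
    funext x
    simp only [halfEntropy, momentumPart, Pi.smul_apply, smul_eq_mul]
    ring
  rw [coreGradient, h]
  exact adjointGen_ae_eq hM hρ

end Drift

/-- The energy-entropy balance: equality in Young's inequality for `𝒢*(ρ)` and `-dS(ρ)/2`. -/
lemma generic_equation {z : ExtSpace d} (hz : M.IsState z.1) :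
    M.extΨ H₂ z (M.extDrift z - extPoisson z (M.dExtEnergy z)) +
      M.extΨstar H₂ z (-(1 / 2 : ℝ) • M.dExtEntropy z) +
      ((1 / 2 * pairExt (M.extDrift z) (M.dExtEntropy z) : ℝ) : EReal) = 0 := by
  have hE := dEnergy_mem hM hz
  have hg := (isAdjointImage_adjointGen hM hz).1
  have hξ := core_smul (dEntropy_mem_core hz) (-(1 / 2 : ℝ))
  have hae := adjointGen_ae_eq_coreGradient hM hz
  have h1 : M.extDrift z - extPoisson z (M.dExtEnergy z) =
      (M.adjointGen z.1, -pair (M.adjointGen z.1) (M.dEnergy z.1)) := by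
    refine Prod.ext ?_ ?_
    · simp [extDrift, extPoisson, dExtEnergy, drift_eq hM hz]
    · simp [extDrift, extPoisson, pair_drift_dEnergy hM hz]
  have h2 : M.extΨstar H₂ z (-(1 / 2 : ℝ) • M.dExtEntropy z) =
      (M.shiftedHamiltonian H₂ z.1 (-(1 / 2 : ℝ) • M.dEntropy z.1) : EReal) := by
    rw [← Ψstar_eq_shiftedHamiltonian hM hz hξ, extΨstar]
    congr 1
    funext x
    simp only [dExtEntropy, Prod.smul_fst, Prod.smul_snd, Pi.sub_apply, Pi.smul_apply, smul_eq_mul]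
    ring
  have h3 : pairExt (M.extDrift z) (M.dExtEntropy z) =
      pair (M.adjointGen z.1) (M.dEntropy z.1) := by
    simp only [pairExt, extDrift, dExtEntropy]
    rw [pair_sub_right hM hz (drift_mem_tan hM hz) hz.dEntropy_mem hE, pair_drift_dEntropy hM hz]
    ring
  rw [h1, h2, h3, extΨ_eq_Ψ hM hz hg, Ψ_congr hae, Ψ_coreGradient hM hz hξ,
    ← pair_congr_left hae, pair_smul_right, ← EReal.coe_add, ← EReal.coe_add, ← EReal.coe_zero]
  congr 1
  ring

theorem isGENERIC : IsGENERIC M.extStateSpace M.extEntropy M.extEnergy M.dExtEntropy M.dExtEnergy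
    (M.extΨ H₂) (M.extΨstar H₂) extPoisson M.extDrift where
  dS_mem z hz := by
    rw [dExtEntropy_eq]
    exact ⟨log_mem_cot hM hz, trivial⟩
  dE_mem z hz := ⟨dEnergy_mem hM hz, trivial⟩
  hasDifferential_S z hz := hasDifferential_extEntropy hM hz
  hasDifferential_E z hz := hasDifferential_extEnergy hM hz
  F_mem z hz := ⟨drift_mem_tan hM hz, trivial⟩
  potentials := isSymmetricDissipationPair hM
  L_mem z hz ξ hξ := ⟨poisson_mem_tan hM hz hξ.1, trivial⟩
  L_linear z hz ξ hξ η hη a := by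
    refine Prod.ext (poisson_linear hz hξ.1 hη.1 a) ?_
    simp [extPoisson]
  L_antisymm z hz ξ hξ η hη := by
    simp only [pairExt, extPoisson, zero_mul, add_zero]
    exact pair_poisson_antisymm hM hz hξ.1 hη.1
  jacobi := jacobiIdentity hM
  degenerate_S z hz := by
    rw [dExtEntropy_eq]
    exact Prod.ext (poisson_log hM hz) rfl
  degenerate_E z hz ξ _ α := extΨstar_add_smul ξ α
  equation z hz := generic_equation hM hz

end Model

section MomentumDerivatives

variable {f g : X d → ℝ} {x : X d}

lemma dP_add (hf : DifferentiableAt ℝ f x) (hg : DifferentiableAt ℝ g x) (i : Fin d) :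
    dP i (fun y => f y + g y) x = dP i f x + dP i g x := by
  simp [dP, fderiv_fun_add hf hg]

lemma dP_const_mul (hf : DifferentiableAt ℝ f x) (c : ℝ) (i : Fin d) :
    dP i (fun y => c * f y) x = c * dP i f x := by
  simp [dP, fderiv_const_mul hf]

lemma dP_exp (hf : DifferentiableAt ℝ f x) (i : Fin d) :
    dP i (fun y => Real.exp (f y)) x = Real.exp (f x) * dP i f x := by
  simp [dP, fderiv_exp hf]

lemma fderiv_momentum (hf : DifferentiableAt ℝ f x) (i : Fin d) :
    fderiv ℝ (fun p => f (x.1, p)) x.2 (EuclideanSpace.single i 1) = dP i f x := by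
  have h1 : HasFDerivAt (fun p => f (x.1, p)) ((fderiv ℝ f x).comp
      (ContinuousLinearMap.inr ℝ (P d) (P d))) x.2 :=
    HasFDerivAt.comp (g := f) (f := fun p => (x.1, p)) x.2 hf.hasFDerivAt
      (hasFDerivAt_prodMk_right x.1 x.2)
  rw [h1.fderiv]
  rfl

/-- Functions of the position have no momentum derivative. -/
lemma dP_position {a : P d → ℝ} (ha : DifferentiableAt ℝ a x.1) (i : Fin d) :
    dP i (fun y : X d => a y.1) x = 0 := by
  have h : HasFDerivAt (fun y : X d => a y.1) ((fderiv ℝ a x.1).comp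
      (ContinuousLinearMap.fst ℝ (P d) (P d))) x :=
    HasFDerivAt.comp (g := a) (f := Prod.fst) x ha.hasFDerivAt hasFDerivAt_fst
  simp [dP, h.fderiv, eP]

lemma dP_coord (i j : Fin d) (c : ℝ) : dP i (fun y : X d => c * y.2 j) x =
    if i = j then c else 0 := by
  have h : HasFDerivAt (fun y : X d => c * y.2 j) (c • (EuclideanSpace.proj (𝕜 := ℝ) j).comp
      (ContinuousLinearMap.snd ℝ (P d) (P d))) x :=
    (ContinuousLinearMap.hasFDerivAt ((EuclideanSpace.proj (𝕜 := ℝ) j).comp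
      (ContinuousLinearMap.snd ℝ (P d) (P d)))).const_mul c
  rw [dP, h.fderiv]
  rcases eq_or_ne i j with rfl | hij
  · simp [eP]
  · simp [eP, hij, hij.symm]

lemma dP_momentumPart (hf : Differentiable ℝ f) (i : Fin d) :
    dP i (momentumPart f) x = dP i f x := by
  have h0 : Differentiable ℝ fun q : P d => f (q, 0) := by fun_prop
  have h : momentumPart f = fun y => f y + -1 * f (y.1, 0) := by
    funext y
    simp only [momentumPart]
    ring
  rw [h, dP_add (hf x) (by fun_prop), dP_const_mul (by fun_prop), dP_position (h0 x.1)]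
  ring

lemma norm_sq_gradP (hf : DifferentiableAt ℝ f x) : ‖gradP f x‖ ^ 2 = ∑ i, dP i f x ^ 2 := by
  rw [EuclideanSpace.real_norm_sq_eq]
  simp only [gradP_apply hf]

end MomentumDerivatives

namespace Model

variable {M : Model d} {H₂ : (X d → ℝ) → (X d → ℝ) → ℝ} {ρ : X d → ℝ} {γ : ℝ}

lemma dP_dEnergy (hd : DifferentiableAt ℝ (M.dEnergy ρ) x) (i : Fin d) :
    dP i (M.dEnergy ρ) x = M.mass⁻¹ * x.2 i := by
  rw [← gradP_apply hd, gradP_dEnergy]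
  rfl

/-! ### The quadratic form of the momentum gradients -/

/-- The form `∫ ⟨∇_p ξ, ∇_p η⟩ ρ`. -/
def momentumForm (ρ ξ η : X d → ℝ) : ℝ := ∫ x, (∑ i, dP i ξ x * dP i η x) * ρ x

/-- A bound for the momentum gradients of the truncations of a cotangent vector. -/
def growth (M : Model d) (ρ : X d → ℝ) (x : X d) : ℝ :=
  M.weight ρ x * (1 + ‖fderiv ℝ (M.dEnergy ρ) x‖)

lemma integrable_growth (hρ : M.IsState ρ) : Integrable fun x => M.growth ρ x ^ 2 * ρ x := by
  simp only [growth, mul_pow]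
  exact hρ.moments

lemma abs_sum_mul_le {a b : Fin d → ℝ} {C D g r : ℝ} (hC : ∀ i, |a i| ≤ C * g)
    (hD : ∀ i, |b i| ≤ D * g) (hr : 0 ≤ r) :
    |(∑ i, a i * b i) * r| ≤ d * (C * D) * (g ^ 2 * r) := by
  rw [abs_mul, abs_of_nonneg hr]
  have h : |∑ i, a i * b i| ≤ ∑ _i : Fin d, (C * g) * (D * g) :=
    (Finset.abs_sum_le_sum_abs _ _).trans (Finset.sum_le_sum fun i _ => by
      rw [abs_mul]
      exact mul_le_mul (hC i) (hD i) (abs_nonneg _) ((abs_nonneg _).trans (hC i)))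
  refine (mul_le_mul_of_nonneg_right h hr).trans (le_of_eq ?_)
  simp only [Finset.sum_const, Finset.card_univ, Fintype.card_fin, nsmul_eq_mul]
  ring

variable (hM : M.Condition H₂) (hρ : M.IsState ρ)

section Form

variable {ξ η ζ : X d → ℝ}

include hM hρ

lemma one_add_le_growth (x : X d) : 1 + ‖fderiv ℝ (M.dEnergy ρ) x‖ ≤ M.growth ρ x :=
  le_mul_of_one_le_left (by positivity) (one_le_weight hM hρ x)

lemma weight_le_growth (x : X d) : M.weight ρ x ≤ M.growth ρ x :=
  le_mul_of_one_le_right (weight_nonneg hM hρ x)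
    (by linarith [norm_nonneg (fderiv ℝ (M.dEnergy ρ) x)])

lemma exists_abs_dP_le (hξ : ξ ∈ M.cot ρ) :
    ∃ C, 0 ≤ C ∧ ∀ x i, |dP i ξ x| ≤ C * M.growth ρ x := by
  obtain ⟨-, C, hC0, hC⟩ := exists_bound_of_mem_cot (weight_nonneg hM hρ) hξ
  exact ⟨C, hC0, fun x i => (abs_dP_le i ξ x).trans ((hC x).2.trans
    (mul_le_mul_of_nonneg_left (one_add_le_growth hM hρ x) hC0))⟩

lemma integrable_momentumForm (hξ : ξ ∈ M.cot ρ) (hη : η ∈ M.cot ρ) :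
    Integrable fun x => (∑ i, dP i ξ x * dP i η x) * ρ x := by
  obtain ⟨C, -, hC⟩ := exists_abs_dP_le hM hρ hξ
  obtain ⟨D, -, hD⟩ := exists_abs_dP_le hM hρ hη
  have hξ1 : ContDiff ℝ 1 ξ := hξ.1.of_le one_le_two
  have hη1 : ContDiff ℝ 1 η := hη.1.of_le one_le_two
  refine ((integrable_growth hρ).const_mul (d * (C * D))).mono' ?_
    (Eventually.of_forall fun x => abs_sum_mul_le (hC x) (hD x) (hρ.nonneg x))
  exact ((continuous_finsetSum _ fun i _ => (continuous_dP hξ1 i).mul (continuous_dP hη1 i)).mul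
    hρ.smooth.continuous).aestronglyMeasurable

omit hM hρ in
lemma momentumForm_comm (ξ η : X d → ℝ) : momentumForm ρ ξ η = momentumForm ρ η ξ := by
  simp only [momentumForm, mul_comm]

lemma momentumForm_add_smul (hξ : ξ ∈ M.cot ρ) (hη : η ∈ M.cot ρ) (hζ : ζ ∈ M.cot ρ) (a : ℝ) :
    momentumForm ρ (ξ + a • η) ζ = momentumForm ρ ξ ζ + a * momentumForm ρ η ζ := by
  rw [momentumForm, momentumForm, momentumForm, ← integral_const_mul,
    ← integral_add (integrable_momentumForm hM hρ hξ hζ)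
      ((integrable_momentumForm hM hρ hη hζ).const_mul a)]
  refine integral_congr_ae (Eventually.of_forall fun x => ?_)
  have hξd := hξ.1.differentiable two_ne_zero x
  have hηd := hη.1.differentiable two_ne_zero x
  have h : ∀ i, dP i (ξ + a • η) x = dP i ξ x + a * dP i η x := fun i => by
    rw [← dP_const_mul hηd, ← dP_add hξd (hηd.const_mul a)]
    rfl
  simp only [h, add_mul, Finset.sum_add_distrib, Finset.mul_sum, mul_assoc, Finset.sum_mul]

lemma momentumForm_add_smul_self (hξ : ξ ∈ M.cot ρ) (hη : η ∈ M.cot ρ) (a : ℝ) :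
    momentumForm ρ (ξ + a • η) (ξ + a • η) = momentumForm ρ ξ ξ + 2 * a * momentumForm ρ ξ η +
      a ^ 2 * momentumForm ρ η η := by
  have hs := (M.cot ρ).add_mem hξ ((M.cot ρ).smul_mem a hη)
  rw [momentumForm_add_smul hM hρ hξ hη hs, momentumForm_comm ξ, momentumForm_comm η,
    momentumForm_add_smul hM hρ hξ hη hξ, momentumForm_add_smul hM hρ hξ hη hη,
    momentumForm_comm η ξ]
  ring

omit hM in
/-- Dominated convergence for the form. -/
lemma tendsto_momentumForm {F G : ℕ → X d → ℝ} (hF : ∀ n, ContDiff ℝ 1 (F n))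
    (hG : ∀ n, ContDiff ℝ 1 (G n)) {C D : ℝ} (hC : ∀ n x i, |dP i (F n) x| ≤ C * M.growth ρ x)
    (hD : ∀ n x i, |dP i (G n) x| ≤ D * M.growth ρ x)
    (hFξ : ∀ x i, Tendsto (fun n => dP i (F n) x) atTop (𝓝 (dP i ξ x)))
    (hGη : ∀ x i, Tendsto (fun n => dP i (G n) x) atTop (𝓝 (dP i η x))) :
    Tendsto (fun n => momentumForm ρ (F n) (G n)) atTop (𝓝 (momentumForm ρ ξ η)) := by
  refine tendsto_integral_of_dominated_convergence
    (fun x => d * (C * D) * (M.growth ρ x ^ 2 * ρ x)) (fun n => ?_)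
    ((integrable_growth hρ).const_mul _)
    (fun n => Eventually.of_forall fun x => abs_sum_mul_le (hC n x) (hD n x) (hρ.nonneg x))
    (Eventually.of_forall fun x =>
      (tendsto_finsetSum _ fun i _ => (hFξ x i).mul (hGη x i)).mul_const _)
  exact ((continuous_finsetSum _ fun i _ =>
    (continuous_dP (hF n) i).mul (continuous_dP (hG n) i)).mul
    hρ.smooth.continuous).aestronglyMeasurable

end Form

/-! ### Truncation of cotangent vectors -/

section Truncation

/-- The product of a function with a smooth cutoff at scale `n`. -/
def truncation (n : ℕ) (ξ : X d → ℝ) (x : X d) : ℝ := cutoff (X d) n x * ξ x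

variable {ξ η : X d → ℝ}

lemma contDiff_truncation (hξ : ContDiff ℝ 2 ξ) (n : ℕ) : ContDiff ℝ 2 (truncation n ξ) :=
  (contDiff_infty.1 (cutoff_contDiff n) 2).mul hξ

lemma hasCompactSupport_truncation (n : ℕ) (ξ : X d → ℝ) : HasCompactSupport (truncation n ξ) :=
  (cutoff_hasCompactSupport n).mul_right

lemma tendsto_truncation (ξ : X d → ℝ) (x : X d) :
    Tendsto (fun n => truncation n ξ x) atTop (𝓝 (ξ x)) := by
  simpa only [one_mul, truncation] using (cutoff_tendsto x).mul_const (ξ x)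

lemma isCb2_of_hasCompactSupport {A : Type*} [NormedAddCommGroup A] [NormedSpace ℝ A] {f : A → ℝ}
    (hf : ContDiff ℝ 2 f) (hc : HasCompactSupport f) : IsCb2 f := by
  have h : ∀ k ≤ 2, ∃ C, ∀ x, ‖iteratedFDeriv ℝ k f x‖ ≤ C := fun k hk =>
    (hf.continuous_iteratedFDeriv (by exact_mod_cast hk)).bounded_above_of_compact_support
      (hc.iteratedFDeriv k)
  choose! C hC using h
  refine ⟨hf, max (C 0) (max (C 1) (C 2)), fun k hk x => (hC k hk x).trans ?_⟩
  interval_cases k <;> simp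

lemma dP_truncation (hξ : Differentiable ℝ ξ) (n : ℕ) (x : X d) (i : Fin d) :
    dP i (truncation n ξ) x = cutoff (X d) n x * dP i ξ x + ξ x * dP i (cutoff (X d) n) x :=
  dP_mul ((cutoff_contDiff n).differentiable (by simp) x) (hξ x) i

lemma tendsto_dP_truncation (hξ : Differentiable ℝ ξ) (x : X d) (i : Fin d) :
    Tendsto (fun n => dP i (truncation n ξ) x) atTop (𝓝 (dP i ξ x)) := by
  obtain ⟨K, -, hK⟩ := exists_norm_fderiv_cutoff_le (E := X d)
  have h0 : Tendsto (fun n => dP i (cutoff (X d) n) x) atTop (𝓝 0) := by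
    refine squeeze_zero_norm (fun n => (abs_dP_le i _ x).trans (hK n x)) ?_
    have := (tendsto_one_div_add_atTop_nhds_zero_nat (𝕜 := ℝ)).const_mul K
    simpa only [one_div, mul_zero] using this
  simp only [dP_truncation hξ]
  simpa using ((cutoff_tendsto x).mul_const (dP i ξ x)).add (h0.const_mul (ξ x))

include hM hρ

lemma truncation_mem_core (hξ : ContDiff ℝ 2 ξ) (n : ℕ) : truncation n ξ ∈ M.core ρ := by
  have hs := contDiff_truncation hξ n
  have hc := hasCompactSupport_truncation n ξ
  refine ⟨mem_cot_of_hasCompactSupport hM hρ hs hc, ?_⟩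
  have h0 : IsCb2 fun q : P d => truncation n ξ (q, 0) := by
    refine isCb2_of_hasCompactSupport (hs.comp (contDiff_id.prodMk contDiff_const)) ?_
    exact hc.comp_isClosedEmbedding (g := fun q : P d => (q, (0 : P d)))
      (Topology.IsClosedEmbedding.of_continuous_injective_isClosedMap (by fun_prop)
        (fun a b h => (Prod.ext_iff.1 h).1) (isClosedMap_prodMk_right 0))
  exact sub_mem_test (hM.test_compact _ hs hc) (hM.test_position _ h0)

lemma exists_abs_dP_truncation_le (hξ : ξ ∈ M.cot ρ) :
    ∃ C, 0 ≤ C ∧ ∀ n x i, |dP i (truncation n ξ) x| ≤ C * M.growth ρ x := by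
  obtain ⟨hs, C, hC0, hC⟩ := exists_bound_of_mem_cot (weight_nonneg hM hρ) hξ
  obtain ⟨K, hK0, hK⟩ := exists_norm_fderiv_cutoff_le (E := X d)
  refine ⟨C + C * K, by positivity, fun n x i => ?_⟩
  rw [dP_truncation (hs.differentiable two_ne_zero), add_mul]
  refine (abs_add_le _ _).trans (add_le_add ?_ ?_)
  · rw [abs_mul, abs_of_nonneg (cutoff_nonneg n x)]
    exact (mul_le_of_le_one_left (abs_nonneg _) (cutoff_le_one n x)).trans
      ((abs_dP_le i ξ x).trans ((hC x).2.trans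
        (mul_le_mul_of_nonneg_left (one_add_le_growth hM hρ x) hC0)))
  · have hn : ((n : ℝ) + 1)⁻¹ ≤ 1 := inv_le_one_of_one_le₀ (by linarith [n.cast_nonneg (α := ℝ)])
    have hχ : |dP i (cutoff (X d) n) x| ≤ K := (abs_dP_le i _ x).trans ((hK n x).trans
      (mul_le_of_le_one_right hK0 hn))
    rw [abs_mul]
    refine (mul_le_mul (hC x).1 hχ (abs_nonneg _)
      (mul_nonneg hC0 (weight_nonneg hM hρ x))).trans ?_
    rw [mul_right_comm]
    exact mul_le_mul_of_nonneg_left (weight_le_growth hM hρ x) (by positivity)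

lemma tendsto_pair_truncation {v : X d → ℝ} (hv : v ∈ M.tan ρ) (hξ : ξ ∈ M.cot ρ) :
    Tendsto (fun n => pair v (truncation n ξ)) atTop (𝓝 (pair v ξ)) := by
  have hI := integrable_pair hM hρ hv hξ
  refine tendsto_integral_of_dominated_convergence (fun x => ‖ξ x * v x‖) (fun n => ?_) hI.norm
    (fun n => Eventually.of_forall fun x => ?_)
    (Eventually.of_forall fun x => (tendsto_truncation ξ x).mul_const _)
  · exact (contDiff_truncation hξ.1 n).continuous.aestronglyMeasurable.mul hv.1.1
  · rw [truncation, mul_assoc, norm_mul, Real.norm_eq_abs (cutoff _ _ _),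
      abs_of_nonneg (cutoff_nonneg n x)]
    exact mul_le_of_le_one_left (norm_nonneg _) (cutoff_le_one n x)

/-- The form converges along truncations of both arguments. -/
lemma tendsto_momentumForm_truncation (hξ : ξ ∈ M.cot ρ) :
    Tendsto (fun n => momentumForm ρ (truncation n ξ) (truncation n ξ)) atTop
      (𝓝 (momentumForm ρ ξ ξ)) := by
  obtain ⟨C, -, hC⟩ := exists_abs_dP_truncation_le hM hρ hξ
  have h1 : ∀ n, ContDiff ℝ 1 (truncation n ξ) := fun n =>
    (contDiff_truncation hξ.1 n).of_le one_le_two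
  have h2 := tendsto_dP_truncation (hξ.1.differentiable two_ne_zero)
  exact tendsto_momentumForm hρ h1 h1 hC hC h2 h2

/-- The form converges along truncations of one argument. -/
lemma tendsto_momentumForm_truncation_right (hη : η ∈ M.cot ρ) (hξ : ξ ∈ M.cot ρ) :
    Tendsto (fun n => momentumForm ρ η (truncation n ξ)) atTop (𝓝 (momentumForm ρ η ξ)) := by
  obtain ⟨C, -, hC⟩ := exists_abs_dP_truncation_le hM hρ hξ
  obtain ⟨D, -, hD⟩ := exists_abs_dP_le hM hρ hη
  exact tendsto_momentumForm hρ (fun _ => hη.1.of_le one_le_two)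
    (fun n => (contDiff_truncation hξ.1 n).of_le one_le_two) (fun _ => hD) hC
    (fun _ _ => tendsto_const_nhds) (tendsto_dP_truncation (hξ.1.differentiable two_ne_zero))

end Truncation

end Model

namespace Model

variable {M : Model d} {H₂ : (X d → ℝ) → (X d → ℝ) → ℝ} {ρ : X d → ℝ} {γ : ℝ}

/-! ### The Fokker-Planck operator on test functions -/

section FokkerPlanck

variable (hM : M.Condition H₂) (hρ : M.IsState ρ)

lemma laplacian_momentum {f : X d → ℝ} (hf : ContDiff ℝ 2 f) (x : X d) :
    Laplacian.laplacian (fun p => f (x.1, p)) x.2 = ∑ i, dP i (dP i f) x := by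
  have hg : ContDiff ℝ 2 fun p => f (x.1, p) := hf.comp (contDiff_const.prodMk contDiff_id)
  have hgd : DifferentiableAt ℝ (fderiv ℝ fun p => f (x.1, p)) x.2 :=
    (hg.fderiv_right (m := 1) (by norm_num)).differentiable one_ne_zero _
  rw [InnerProductSpace.laplacian_eq_iteratedFDeriv_orthonormalBasis _
    (EuclideanSpace.basisFun (Fin d) ℝ)]
  refine Finset.sum_congr rfl fun i _ => ?_
  rw [iteratedFDeriv_two_apply]
  simp only [EuclideanSpace.basisFun_apply, Matrix.cons_val_zero, Matrix.cons_val_one]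
  have h1 : (fun p => fderiv ℝ (fun p => f (x.1, p)) p (EuclideanSpace.single i 1)) =
      fun p => dP i f (x.1, p) := by
    funext p
    exact fderiv_momentum (x := (x.1, p)) (hf.differentiable two_ne_zero _) i
  rw [← fderiv_momentum ((contDiff_one_dP hf i).differentiable one_ne_zero x), ← h1,
    fderiv_clm_apply hgd (differentiableAt_const _)]
  simp

include hM

lemma liftGen_eq (hγ : M.IsVlasovFokkerPlanck γ) {f : X d → ℝ} (hf : f ∈ M.test) (x : X d) :
    liftGen M.gen f x = γ * ∑ i, (dP i (dP i f) x - M.mass⁻¹ * x.2 i * dP i f x) := by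
  obtain ⟨g, hg⟩ := inDomain_of_mem_test hM hf x.1
  have hfs := (exists_bound_of_mem_test hM hf).1
  rw [liftGen, applyGen_eq g hg, (hγ g).2, hg, laplacian_momentum hfs x]
  have h : inner ℝ (M.mass⁻¹ • x.2) (gradient (fun p => f (x.1, p)) x.2) =
      ∑ i, M.mass⁻¹ * x.2 i * dP i f x := by
    have := gradP_apply (hfs.differentiable two_ne_zero x)
    rw [PiLp.inner_apply]
    refine Finset.sum_congr rfl fun i _ => ?_
    rw [← this i]
    simp only [gradP, PiLp.smul_apply, smul_eq_mul, RCLike.inner_apply, conj_trivial]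
    ring
  rw [h, Finset.sum_sub_distrib]
  ring

/-- The carré du champ identity `e^{-f} 𝒢 e^f = 𝒢 f + γ |∇_p f|²`. -/
lemma liftGen_exp (hγ : M.IsVlasovFokkerPlanck γ) {f : X d → ℝ} (hf : f ∈ M.test) (x : X d) :
    liftGen M.gen (fun y => Real.exp (f y)) x =
      Real.exp (f x) * (liftGen M.gen f x + γ * ∑ i, dP i f x ^ 2) := by
  have hfs := (exists_bound_of_mem_test hM hf).1
  have hfd := hfs.differentiable two_ne_zero
  have h1 : ∀ i, dP i (fun y => Real.exp (f y)) = fun y => Real.exp (f y) * dP i f y :=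
    fun i => funext fun y => dP_exp (hfd y) i
  have h2 : ∀ i, dP i (fun y => Real.exp (f y) * dP i f y) x =
      Real.exp (f x) * (dP i (dP i f) x + dP i f x ^ 2) := fun i => by
    rw [dP_mul (hfd x).exp ((contDiff_one_dP hfs i).differentiable one_ne_zero x), dP_exp (hfd x)]
    ring
  rw [liftGen_eq hM hγ (exp_mem_test hM hf), liftGen_eq hM hγ hf]
  simp only [h1, h2]
  rw [← mul_add, ← Finset.sum_add_distrib, mul_left_comm, Finset.mul_sum (a := Real.exp (f x))]
  congr 1
  exact Finset.sum_congr rfl fun i _ => by ring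

lemma exists_abs_dP_le_of_mem_test {f : X d → ℝ} (hf : f ∈ M.test) :
    ∃ C, ∀ x, |∑ i, dP i f x ^ 2| ≤ C := by
  obtain ⟨-, C, hC⟩ := hM.test_smooth f hf
  refine ⟨d * C ^ 2, fun x => ?_⟩
  have h1 : ∀ i, dP i f x ^ 2 ≤ C ^ 2 := fun i => by
    have := hC 1 (by omega) x
    rw [norm_iteratedFDeriv_one] at this
    exact sq_le_sq' (abs_le.1 ((abs_dP_le i f x).trans this)).1
      (abs_le.1 ((abs_dP_le i f x).trans this)).2
  rw [abs_of_nonneg (Finset.sum_nonneg fun i _ => sq_nonneg _)]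
  refine (Finset.sum_le_sum fun i _ => h1 i).trans (le_of_eq ?_)
  simp

include hρ

omit hM in
lemma integrable_mul_density_of_bounded {f : X d → ℝ} (hf : Continuous f)
    (hb : ∃ C, ∀ x, |f x| ≤ C) : Integrable fun x => f x * ρ x := by
  obtain ⟨C, hC⟩ := hb
  exact hρ.integrable.bdd_mul hf.aestronglyMeasurable (Eventually.of_forall hC)

lemma hamiltonian_fokkerPlanck (hγ : M.IsVlasovFokkerPlanck γ) {f : X d → ℝ} (hf : f ∈ M.test) :
    H₂ ρ f = (∫ x, liftGen M.gen f x * ρ x) + γ * momentumForm ρ f f ∧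
      Integrable (fun x => liftGen M.gen f x * ρ x) := by
  have hfs := (exists_bound_of_mem_test hM hf).1.of_le (m := 1) one_le_two
  have i1 := integrable_mul_density_of_bounded hρ (continuous_liftGen hM hf)
    (hM.test_domain f hf).2.2
  have i2 : Integrable fun x => (∑ i, dP i f x ^ 2) * ρ x := integrable_mul_density_of_bounded hρ
    (continuous_finsetSum _ fun i _ => (continuous_dP hfs i).pow 2)
    (exists_abs_dP_le_of_mem_test hM hf)
  refine ⟨?_, i1⟩
  rw [hamiltonian_eq hM hρ hf, momentumForm, ← integral_const_mul]
  simp only [← sq]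
  rw [← integral_add i1 (i2.const_mul γ)]
  refine integral_congr_ae (Eventually.of_forall fun x => ?_)
  simp only [liftGen_exp hM hγ hf, ← mul_assoc, ← Real.exp_add, neg_add_cancel, Real.exp_zero]
  ring

omit hM hρ in
lemma momentumForm_momentumPart {ξ η : X d → ℝ} (hξ : Differentiable ℝ ξ)
    (hη : Differentiable ℝ η) :
    momentumForm ρ (momentumPart ξ) (momentumPart η) = momentumForm ρ ξ η := by
  simp only [momentumForm, dP_momentumPart hξ, dP_momentumPart hη]

/-- In the Fokker-Planck case the shifted Hamiltonian is quadratic: being even, it agrees with its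
even part. -/
lemma shiftedHamiltonian_fokkerPlanck (hγ : M.IsVlasovFokkerPlanck γ) {ξ : X d → ℝ}
    (hξ : ξ ∈ M.core ρ) : M.shiftedHamiltonian H₂ ρ ξ = γ * momentumForm ρ ξ ξ := by
  have hu := halfEntropy_mem hρ
  have key : ∀ η ∈ M.core ρ, M.shiftedHamiltonian H₂ ρ η =
      (∫ x, liftGen M.gen (momentumPart η) x * ρ x) +
      γ * (2 * momentumForm ρ ((1 / 2 : ℝ) • M.dEntropy ρ) η + momentumForm ρ η η) := by
    intro η hη
    have hS := core_smul (dEntropy_mem_core hρ) (1 / 2 : ℝ)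
    have hadd := core_add hS hη
    have e : (fun x => M.halfEntropy ρ x + momentumPart η x) =
        momentumPart ((1 / 2 : ℝ) • M.dEntropy ρ + η) := by
      rw [momentumPart_add]
      rfl
    have hs := (hamiltonian_fokkerPlanck hM hρ hγ (add_mem_test hu hη.2))
    obtain ⟨hu1, hu2⟩ := hamiltonian_fokkerPlanck hM hρ hγ hu
    obtain ⟨-, hη2⟩ := hamiltonian_fokkerPlanck hM hρ hγ hη.2
    have d1 := hS.1.1.differentiable two_ne_zero
    have d2 := hadd.1.1.differentiable two_ne_zero
    have q := momentumForm_add_smul_self hM hρ hS.1 hη.1 1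
    rw [one_smul] at q
    rw [shiftedHamiltonian_eq, hs.1, hu1]
    simp only [liftGen_add hM hu hη.2, add_mul]
    rw [integral_add hu2 hη2, e, momentumForm_momentumPart d2 d2, halfEntropy,
      momentumForm_momentumPart d1 d1, q]
    ring
  have hneg := shiftedHamiltonian_neg hM hρ hξ
  have k1 := key ξ hξ
  have k2 := key (-ξ) (core_neg hξ)
  have e1 : momentumPart (-ξ) = fun x => -1 * momentumPart ξ x := by
    funext x
    simp only [momentumPart, Pi.neg_apply]
    ring
  have e2 : ∀ η ∈ M.cot ρ, momentumForm ρ η (-ξ) = -momentumForm ρ η ξ := fun η hη => by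
    have h := momentumForm_add_smul hM hρ ((M.cot ρ).zero_mem) hξ.1 hη (-1)
    have h0 := momentumForm_add_smul hM hρ ((M.cot ρ).zero_mem) hξ.1 hη 0
    rw [zero_smul, add_zero, zero_mul, add_zero] at h0
    have hz : momentumForm ρ 0 η = 0 := by
      have := momentumForm_add_smul hM hρ ((M.cot ρ).zero_mem) ((M.cot ρ).zero_mem) hη 1
      rw [smul_zero, add_zero] at this
      linarith
    rw [hz, neg_one_smul, zero_add, zero_add] at h
    rw [momentumForm_comm, h, momentumForm_comm ξ]
    ring
  have hS := ((M.cot ρ).smul_mem (1 / 2 : ℝ) hρ.dEntropy_mem)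
  have hξn := (M.cot ρ).neg_mem hξ.1
  rw [e1, e2 _ hS, momentumForm_comm (-ξ), e2 _ hξn, momentumForm_comm (-ξ), e2 _ hξ.1] at k2
  simp only [liftGen_const_mul hM hξ.2, mul_assoc, integral_const_mul] at k2
  linarith

/-- The gradients of the quadratic potential. -/
lemma pair_coreGradient_core (hγ : M.IsVlasovFokkerPlanck γ) {ξ η : X d → ℝ}
    (hξ : ξ ∈ M.core ρ) (hη : η ∈ M.core ρ) :
    pair (M.coreGradient ρ ξ) η = 2 * γ * momentumForm ρ ξ η := by
  have hv := coreGradient_mem_tan hM hρ hξ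
  have h : ∀ t : ℝ, t * (pair (M.coreGradient ρ ξ) η - 2 * γ * momentumForm ρ ξ η) ≤
      t ^ 2 * (γ * momentumForm ρ η η) := fun t => by
    have h := shiftedHamiltonian_subgradient hM hρ hξ (core_add hξ (core_smul hη t))
    rw [shiftedHamiltonian_fokkerPlanck hM hρ hγ hξ,
      shiftedHamiltonian_fokkerPlanck hM hρ hγ (core_add hξ (core_smul hη t)),
      momentumForm_add_smul_self hM hρ hξ.1 hη.1,
      pair_add_right hM hρ hv hξ.1 ((M.cot ρ).smul_mem t hη.1), pair_smul_right] at h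
    linarith
  by_contra hne
  set a := pair (M.coreGradient ρ ξ) η - 2 * γ * momentumForm ρ ξ η with ha
  have ha0 : a ≠ 0 := sub_ne_zero.2 hne
  set b := γ * momentumForm ρ η η
  have hb : 0 < |b| + 1 := by positivity
  -- a small multiple of `a` makes the linear term win
  have ht := h (a / (2 * (|b| + 1)))
  have e : a / (2 * (|b| + 1)) * a - (a / (2 * (|b| + 1))) ^ 2 * b =
      a ^ 2 / (4 * (|b| + 1) ^ 2) * (2 * (|b| + 1) - b) := by
    field_simp
    ring
  have hp : 0 < a ^ 2 / (4 * (|b| + 1) ^ 2) * (2 * (|b| + 1) - b) := by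
    have : 0 < 2 * (|b| + 1) - b := by linarith [le_abs_self b, abs_nonneg b]
    positivity
  linarith

/-- The pairing formula extends from the core to all cotangent vectors by truncation. -/
lemma pair_coreGradient_eq (hγ : M.IsVlasovFokkerPlanck γ) {ξ η : X d → ℝ}
    (hξ : ξ ∈ M.core ρ) (hη : η ∈ M.cot ρ) :
    pair (M.coreGradient ρ ξ) η = 2 * γ * momentumForm ρ ξ η := by
  refine tendsto_nhds_unique
    (tendsto_pair_truncation hM hρ (coreGradient_mem_tan hM hρ hξ) hη) ?_
  simp only [pair_coreGradient_core hM hρ hγ hξ (truncation_mem_core hM hρ hη.1 _)]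
  exact (tendsto_momentumForm_truncation_right hM hρ hξ.1 hη).const_mul _

/-- The dual potential on all cotangent vectors, by truncation: from above since the pairings and
the quadratic form converge, from below by testing with the gradients at the truncations. -/
lemma Ψstar_fokkerPlanck (hγ : M.IsVlasovFokkerPlanck γ) {ξ : X d → ℝ} (hξ : ξ ∈ M.cot ρ) :
    M.Ψstar H₂ ρ ξ = ((γ * momentumForm ρ ξ ξ : ℝ) : EReal) := by
  have hc := truncation_mem_core hM hρ hξ.1
  have hT := (tendsto_momentumForm_truncation hM hρ hξ).const_mul γ
  refine le_antisymm (iSup₂_le fun v hv => ?_) ?_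
  · have hn : ∀ n, ((pair v (truncation n ξ) : ℝ) : EReal) - M.Ψ H₂ ρ v ≤
        ((γ * momentumForm ρ (truncation n ξ) (truncation n ξ) : ℝ) : EReal) := fun n => by
      rw [← shiftedHamiltonian_fokkerPlanck hM hρ hγ (hc n),
        ← Ψstar_eq_shiftedHamiltonian hM hρ (hc n)]
      exact pair_sub_le_Ψstar hv _
    have h0 := Ψ_nonneg (M := M) (H₂ := H₂) (ρ := ρ) v
    induction hΨ : M.Ψ H₂ ρ v with
    | bot => simp [hΨ] at h0
    | top => simp [EReal.sub_top]
    | coe r =>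
      simp only [hΨ, ← EReal.coe_sub, EReal.coe_le_coe_iff] at hn ⊢
      exact le_of_tendsto_of_tendsto' ((tendsto_pair_truncation hM hρ hv hξ).sub_const r) hT hn
  · have hn : ∀ n, ((2 * γ * momentumForm ρ ξ (truncation n ξ) -
        γ * momentumForm ρ (truncation n ξ) (truncation n ξ) : ℝ) : EReal) ≤ M.Ψstar H₂ ρ ξ := by
      intro n
      have h := pair_sub_le_Ψstar (H₂ := H₂) (coreGradient_mem_tan hM hρ (hc n)) ξ
      rw [Ψ_coreGradient hM hρ (hc n), shiftedHamiltonian_fokkerPlanck hM hρ hγ (hc n),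
        pair_coreGradient_eq hM hρ hγ (hc n) hξ, pair_coreGradient_eq hM hρ hγ (hc n) (hc n).1,
        ← EReal.coe_sub] at h
      refine le_trans (le_of_eq ?_) h
      rw [momentumForm_comm ξ]
      congr 1
      ring
    have hlim := ((tendsto_momentumForm_truncation_right hM hρ hξ hξ).const_mul (2 * γ)).sub hT
    have e : 2 * γ * momentumForm ρ ξ ξ - γ * momentumForm ρ ξ ξ = γ * momentumForm ρ ξ ξ := by ring
    rw [e] at hlim
    exact le_of_tendsto' ((continuous_coe_real_ereal.tendsto _).comp hlim) hn

end FokkerPlanck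

/-! ### The quadratic structure -/

section Quadratic

variable (hM : M.Condition H₂) (hρ : M.IsState ρ)
include hM hρ

omit hM in
lemma dP_log_add_one (x : X d) (i : Fin d) :
    ρ x * dP i (fun y => Real.log (ρ y) + 1) x = dP i ρ x := by
  have := (hρ.pos x).ne'
  rw [dP, fderiv_log_add_one hρ]
  simp [dP, this]

lemma dP_dEntropy (x : X d) (i : Fin d) :
    ρ x * dP i (M.dEntropy ρ) x = dP i ρ x + ρ x * (M.mass⁻¹ * x.2 i) := by
  have h1 := (log_mem_cot hM hρ).1.differentiable two_ne_zero x
  have h2 := (contDiff_dEnergy hM hρ).differentiable two_ne_zero x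
  rw [← dP_log_add_one hρ, ← dP_dEnergy h2, ← mul_add, ← dP_add h1 h2]
  rfl

/-- The gradient of the quadratic potential is a diffusion operator. -/
lemma coreGradient_fokkerPlanck (hγ : M.IsVlasovFokkerPlanck γ) {ξ : X d → ℝ} (hξ : ξ ∈ M.core ρ)
    (x : X d) : M.coreGradient ρ ξ x = -(2 * γ) * ∑ i, dP i (fun y => ρ y * dP i ξ y) x := by
  have hu := halfEntropy_mem hρ
  have hf := hξ.2
  have hξd := hξ.1.1.differentiable two_ne_zero
  have hfs := (exists_bound_of_mem_test hM hf).1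
  have hus := (exists_bound_of_mem_test hM hu).1
  have hfd := hfs.differentiable two_ne_zero
  have hud := hus.differentiable two_ne_zero
  have hSd : Differentiable ℝ (M.dEntropy ρ) := hρ.dEntropy_mem.1.differentiable two_ne_zero
  have hneg : (fun y => -1 * momentumPart ξ y) ∈ M.test := M.test.smul_mem (-1) hf
  have e1 : (fun y => Real.exp (M.halfEntropy ρ y - momentumPart ξ y)) =
      fun y => Real.exp (M.halfEntropy ρ y + -1 * momentumPart ξ y) := by
    funext y
    congr 1
    ring
  have du : ∀ i, 2 * dP i (M.halfEntropy ρ) x = dP i (M.dEntropy ρ) x := fun i => by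
    rw [halfEntropy, dP_momentumPart (hSd.const_smul _)]
    have := dP_const_mul (hSd x) (1 / 2) i
    rw [show ((1 / 2 : ℝ) • M.dEntropy ρ) = fun y => 1 / 2 * M.dEntropy ρ y from rfl, this]
    ring
  have dd : ∀ i, dP i (dP i ξ) x = dP i (dP i (momentumPart ξ)) x := fun i => by
    congr 1
    funext y
    exact (dP_momentumPart hξd i).symm
  have dρ : ∀ i, dP i (fun y => ρ y * dP i ξ y) x = ρ x * (dP i (dP i (momentumPart ξ)) x -
      M.mass⁻¹ * x.2 i * dP i (momentumPart ξ) x +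
      2 * (dP i (M.halfEntropy ρ) x * dP i (momentumPart ξ) x)) := fun i => by
    have h := dP_dEntropy hM hρ x i
    rw [dP_mul (hρ.smooth.differentiable two_ne_zero x)
      ((contDiff_one_dP hξ.1.1 i).differentiable one_ne_zero x), dd, dP_momentumPart hξd]
    linear_combination -(dP i ξ x) * h - dP i ξ x * ρ x * du i
  have hbase := base_mul_exp hρ x
  have hexp : Real.exp (M.halfEntropy ρ x + momentumPart ξ x) *
      Real.exp (M.halfEntropy ρ x + -1 * momentumPart ξ x) =
      Real.exp (2 * M.halfEntropy ρ x) := by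
    rw [← Real.exp_add]
    congr 1
    ring
  have dplus : ∀ i, dP i (fun y => M.halfEntropy ρ y + momentumPart ξ y) x =
      dP i (M.halfEntropy ρ) x + dP i (momentumPart ξ) x := fun i => dP_add (hud x) (hfd x) i
  have dminus : ∀ i, dP i (fun y => M.halfEntropy ρ y + -1 * momentumPart ξ y) x =
      dP i (M.halfEntropy ρ) x - dP i (momentumPart ξ) x := fun i => by
    rw [dP_add (hud x) ((hfd x).const_mul _), dP_const_mul (hfd x)]
    ring
  have e1x := congrFun e1 x
  simp only [coreGradient, tiltedGradient, wronskian, e1] at e1x ⊢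
  rw [e1x]
  rw [liftGen_exp hM hγ (add_mem_test hu hneg), liftGen_exp hM hγ (add_mem_test hu hf),
    liftGen_add hM hu hneg, liftGen_add hM hu hf, liftGen_const_mul hM hf]
  simp only [dplus, dminus, dρ]
  have hsq : ∑ i, (dP i (M.halfEntropy ρ) x - dP i (momentumPart ξ) x) ^ 2 -
      ∑ i, (dP i (M.halfEntropy ρ) x + dP i (momentumPart ξ) x) ^ 2 =
      -4 * ∑ i, dP i (M.halfEntropy ρ) x * dP i (momentumPart ξ) x := by
    rw [← Finset.sum_sub_distrib, Finset.mul_sum]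
    exact Finset.sum_congr rfl fun i _ => by ring
  have hL := liftGen_eq hM hγ hf x
  rw [← Finset.mul_sum, Finset.sum_add_distrib, ← Finset.mul_sum, ← hbase, ← hexp]
  linear_combination M.base ρ x * (Real.exp (M.halfEntropy ρ x + momentumPart ξ x) *
      Real.exp (M.halfEntropy ρ x + -1 * momentumPart ξ x)) * (γ * hsq - 2 * hL)

lemma abs_mass_inv_mul_le (x : X d) (i : Fin d) :
    |M.mass⁻¹ * x.2 i| ≤ ‖fderiv ℝ (M.dEnergy ρ) x‖ := by
  rw [← dP_dEnergy ((contDiff_dEnergy hM hρ).differentiable two_ne_zero x)]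
  exact abs_dP_le i _ x

omit hM hρ in
lemma contDiff_friction (hρ : ContDiff ℝ 2 ρ) (m : ℝ) (i : Fin d) :
    ContDiff ℝ 2 fun y : X d => ρ y * (m * y.2 i) := by
  fun_prop

omit hM in
lemma dP_friction (x : X d) (i : Fin d) : dP i (fun y => ρ y * (M.mass⁻¹ * y.2 i)) x =
    ρ x * M.mass⁻¹ + M.mass⁻¹ * x.2 i * dP i ρ x := by
  rw [dP_mul (hρ.smooth.differentiable two_ne_zero x) (by fun_prop), dP_coord, if_pos rfl]

lemma integrable_weight_friction :
    Integrable (fun x => ∑ i, dP i (fun y => ρ y * (M.mass⁻¹ * y.2 i)) x) ∧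
    Integrable (fun x => M.weight ρ x * ∑ i, dP i (fun y => ρ y * (M.mass⁻¹ * y.2 i)) x) := by
  obtain ⟨C, hC0, hC⟩ := exists_norm_fderiv_le hM hρ
  have hc : Continuous fun x => ∑ i, dP i (fun y => ρ y * (M.mass⁻¹ * y.2 i)) x :=
    continuous_finsetSum _ fun i _ =>
      continuous_dP ((contDiff_friction hρ.smooth M.mass⁻¹ i).of_le one_le_two) i
  refine integrable_of_le hM hρ hc.aestronglyMeasurable (d * (|M.mass⁻¹| + C)) fun x => ?_
  set g := ‖fderiv ℝ (M.dEnergy ρ) x‖ with hg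
  have hg0 : 0 ≤ g := norm_nonneg _
  have hr := hρ.nonneg x
  have hi : ∀ i, |dP i (fun y => ρ y * (M.mass⁻¹ * y.2 i)) x| ≤
      (|M.mass⁻¹| + C) * ((1 + g) ^ 2 * ρ x) := fun i => by
    rw [dP_friction hρ]
    refine (abs_add_le _ _).trans ?_
    rw [abs_mul, abs_mul (M.mass⁻¹ * x.2 i), abs_of_nonneg hr, add_mul]
    refine add_le_add ?_ ?_
    · rw [mul_comm]
      refine mul_le_mul_of_nonneg_left (le_mul_of_one_le_left hr ?_) (abs_nonneg _)
      exact one_le_pow₀ (by linarith)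
    · refine (mul_le_mul (abs_mass_inv_mul_le hM hρ x i) ((abs_dP_le i ρ x).trans (hC x))
        (abs_nonneg _) hg0).trans ?_
      rw [← hg]
      have : 0 ≤ C * ρ x * (1 + g) := by positivity
      nlinarith
  have hw := one_le_weight hM hρ x
  refine (Finset.abs_sum_le_sum_abs _ _).trans ((Finset.sum_le_sum fun i _ => hi i).trans ?_)
  have h1 : (1 + g) ^ 2 * ρ x ≤ M.weight ρ x * (1 + g) ^ 2 * ρ x := by
    rw [mul_assoc]
    exact le_mul_of_one_le_left (by positivity) hw
  rw [Finset.sum_const, Finset.card_univ, Fintype.card_fin, nsmul_eq_mul, ← mul_assoc]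
  exact mul_le_mul_of_nonneg_left h1 (by positivity)

/-- Integration by parts against the friction field `ρ p/m`. -/
lemma integral_mul_friction {ξ : X d → ℝ} (hξ : ξ ∈ M.cot ρ) :
    Integrable (fun x => ξ x * ∑ i, dP i (fun y => ρ y * (M.mass⁻¹ * y.2 i)) x) ∧
    ∫ x, ξ x * ∑ i, dP i (fun y => ρ y * (M.mass⁻¹ * y.2 i)) x =
      -momentumForm ρ ξ (M.dEnergy ρ) := by
  obtain ⟨hξs, C, hC0, hC⟩ := exists_bound_of_mem_cot (weight_nonneg hM hρ) hξ
  have hfr := contDiff_friction hρ.smooth M.mass⁻¹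
  have hE := dEnergy_mem hM hρ
  obtain ⟨h1, h2⟩ := integrable_weight_friction hM hρ
  have hI : Integrable fun x => ξ x * ∑ i, dP i (fun y => ρ y * (M.mass⁻¹ * y.2 i)) x := by
    refine (h2.norm.const_mul C).mono' (hξs.continuous.aestronglyMeasurable.mul h1.1)
      (Eventually.of_forall fun x => ?_)
    rw [norm_mul, norm_mul, Real.norm_eq_abs (M.weight ρ x), abs_of_nonneg (weight_nonneg hM hρ x),
      ← mul_assoc]
    exact mul_le_mul_of_nonneg_right (hC x).1 (norm_nonneg _)
  have hF := integrable_momentumForm hM hρ hξ hE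
  have hu : ∀ i, ContDiff ℝ 1 fun x => ξ x * (ρ x * (M.mass⁻¹ * x.2 i)) := fun i =>
    (hξs.mul (hfr i)).of_le one_le_two
  have hui : ∀ i, Integrable fun x => ξ x * (ρ x * (M.mass⁻¹ * x.2 i)) := fun i => by
    refine (integrable_of_le hM hρ (hu i).continuous.aestronglyMeasurable C fun x => ?_).1
    have hw := weight_nonneg hM hρ x
    have hr := hρ.nonneg x
    have hp := abs_mass_inv_mul_le hM hρ x i
    rw [abs_mul, abs_mul (ρ x), abs_of_nonneg hr]
    refine (mul_le_mul (hC x).1 (mul_le_mul_of_nonneg_left hp hr) (by positivity)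
      (by positivity)).trans ?_
    rw [mul_assoc, mul_assoc (M.weight ρ x), mul_comm (ρ x)]
    gcongr
    nlinarith [norm_nonneg (fderiv ℝ (M.dEnergy ρ) x)]
  have hdiv : ∀ x, ∑ i, fderiv ℝ (fun x => ξ x * (ρ x * (M.mass⁻¹ * x.2 i))) x (eP i) =
      ξ x * (∑ i, dP i (fun y => ρ y * (M.mass⁻¹ * y.2 i)) x) +
        (∑ i, dP i ξ x * dP i (M.dEnergy ρ) x) * ρ x := fun x => by
    rw [Finset.mul_sum, Finset.sum_mul, ← Finset.sum_add_distrib]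
    refine Finset.sum_congr rfl fun i _ => ?_
    have := dP_mul (hξs.differentiable two_ne_zero x) ((hfr i).differentiable two_ne_zero x) i
    rw [dP_dEnergy (hE.1.differentiable two_ne_zero x)]
    refine this.trans ?_
    ring
  have h := integral_divergence_eq_zero volume eP
    (fun i x => ξ x * (ρ x * (M.mass⁻¹ * x.2 i))) hu hui (by
      simp only [hdiv]
      exact hI.add hF)
  simp only [hdiv] at h
  rw [integral_add hI hF] at h
  exact ⟨hI, eq_neg_of_add_eq_zero_left h⟩

lemma momentumForm_dEnergy_self :
    momentumForm ρ (M.dEnergy ρ) (M.dEnergy ρ) = ∫ x, ‖M.mass⁻¹ • x.2‖ ^ 2 * ρ x := by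
  have hd := (contDiff_dEnergy hM hρ).differentiable two_ne_zero
  refine integral_congr_ae (Eventually.of_forall fun x => ?_)
  simp only [← sq]
  rw [← norm_sq_gradP (hd x), gradP_dEnergy]

lemma momentumForm_dEnergy {ξ : X d → ℝ} (hξ : Differentiable ℝ ξ) :
    momentumForm ρ ξ (M.dEnergy ρ) =
      ∫ x, inner ℝ (M.mass⁻¹ • x.2) (gradP ξ x) * ρ x := by
  have hd := (contDiff_dEnergy hM hρ).differentiable two_ne_zero
  refine integral_congr_ae (Eventually.of_forall fun x => ?_)
  simp only [PiLp.inner_apply, gradP_apply (hξ x), dP_dEnergy (hd x), PiLp.smul_apply, smul_eq_mul,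
    RCLike.inner_apply, conj_trivial]

/-- By integration by parts, `∫ ⟨∇_p log ρ, p/m⟩ ρ = -d/m`. -/
lemma momentumForm_log_dEnergy :
    momentumForm ρ (fun x => Real.log (ρ x) + 1) (M.dEnergy ρ) = -(d / M.mass) := by
  have h1 : (fun _ => 1 : X d → ℝ) ∈ M.cot ρ := const_mem_cot hM hρ 1
  have hE := dEnergy_mem hM hρ
  have h0 : momentumForm ρ (fun _ => (1 : ℝ)) (M.dEnergy ρ) = 0 := by
    simp [momentumForm, dP]
  have hF := integrable_momentumForm hM hρ (log_mem_cot hM hρ) hE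
  have h := (integral_mul_friction hM hρ h1).2
  rw [h0, neg_zero] at h
  have e : ∀ x, 1 * ∑ i, dP i (fun y => ρ y * (M.mass⁻¹ * y.2 i)) x =
      d * M.mass⁻¹ * ρ x +
      (∑ i, dP i (fun x => Real.log (ρ x) + 1) x * dP i (M.dEnergy ρ) x) * ρ x := fun x => by
    simp only [dP_friction hρ, ← dP_log_add_one hρ, dP_dEnergy (hE.1.differentiable two_ne_zero x)]
    rw [Finset.sum_add_distrib, Finset.sum_mul]
    simp only [Finset.sum_const, Finset.card_univ, Fintype.card_fin, nsmul_eq_mul, one_mul]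
    congr 1
    · ring
    · exact Finset.sum_congr rfl fun i _ => by ring
  simp only [e] at h
  rw [integral_add (hρ.integrable.const_mul _) hF, integral_const_mul, hρ.integral_eq_one] at h
  rw [momentumForm, div_eq_mul_inv]
  linarith

end Quadratic

/-! ### The extended system in the Fokker-Planck case -/

section ExtendedFokkerPlanck

variable (hM : M.Condition H₂) {z : ExtSpace d} (hz : M.IsState z.1)
include hM hz

lemma momentumForm_sub_smul_dEnergy {ζ : ExtSpace d} (hζ : ζ.1 ∈ M.cot z.1) :
    momentumForm z.1 (ζ.1 - ζ.2 • M.dEnergy z.1) (ζ.1 - ζ.2 • M.dEnergy z.1) =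
      momentumForm z.1 ζ.1 ζ.1 - 2 * ζ.2 * momentumForm z.1 ζ.1 (M.dEnergy z.1) +
        ζ.2 ^ 2 * momentumForm z.1 (M.dEnergy z.1) (M.dEnergy z.1) := by
  rw [sub_eq_add_neg, ← neg_smul, momentumForm_add_smul_self hM hz hζ (dEnergy_mem hM hz)]
  ring

lemma extΨstar_fokkerPlanck (hγ : M.IsVlasovFokkerPlanck γ) {ζ : ExtSpace d}
    (hζ : ζ ∈ M.extStateSpace.cot z) : M.extΨstar H₂ z ζ =
      ((γ * ∫ x, ‖gradP ζ.1 x - ζ.2 • (M.mass⁻¹ • x.2)‖ ^ 2 * z.1 x : ℝ) : EReal) := by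
  have hmem := sub_smul_dEnergy_mem hM hz hζ
  have h1 := hζ.1.1.differentiable two_ne_zero
  have h2 := hmem.1.differentiable two_ne_zero
  have hE := (contDiff_dEnergy hM hz).differentiable two_ne_zero
  rw [extΨstar, Ψstar_fokkerPlanck hM hz hγ hmem, momentumForm]
  congr 3
  funext x
  simp only [← sq]
  rw [← norm_sq_gradP (h2 x)]
  congr 3
  ext i
  rw [gradP_apply (h2 x), PiLp.sub_apply, PiLp.smul_apply, gradP_apply (h1 x), PiLp.smul_apply,
    smul_eq_mul, smul_eq_mul, ← dP_dEnergy (hE x)]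
  simp only [dP]
  rw [fderiv_sub (h1 x) ((hE x).const_smul _), fderiv_const_smul (hE x)]
  rfl

omit hM in
/-- The first component of `M̄` in coordinates. -/
lemma vfpOperator_fst {ζ : ExtSpace d} (hζ : ContDiff ℝ 2 ζ.1) (x : X d) :
    (M.vfpOperator γ z ζ).1 x = 2 * γ * (-(∑ i, dP i (fun y => z.1 y * dP i ζ.1 y) x) +
      ζ.2 * ∑ i, dP i (fun y => z.1 y * (M.mass⁻¹ * y.2 i)) x) := by
  have hd := hζ.differentiable two_ne_zero
  have hzd := hz.smooth.differentiable two_ne_zero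
  simp only [vfpOperator]
  rw [divP_eq (c := fun i y => z.1 y * dP i ζ.1 y) (fun y i => by
      rw [PiLp.smul_apply, gradP_apply (hd y), smul_eq_mul])
      (fun i => (hzd x).mul ((contDiff_one_dP hζ i).differentiable one_ne_zero x)),
    divP_eq (c := fun i y => z.1 y * (M.mass⁻¹ * y.2 i)) (fun y i => by
      rw [PiLp.smul_apply, PiLp.smul_apply, smul_eq_mul, smul_eq_mul])
      (fun i => (contDiff_friction hz.smooth M.mass⁻¹ i).differentiable two_ne_zero x)]

lemma vfpOperator_snd {ζ : ExtSpace d} (hζ : ζ.1 ∈ M.cot z.1) :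
    (M.vfpOperator γ z ζ).2 = 2 * γ * (-momentumForm z.1 ζ.1 (M.dEnergy z.1) +
      ζ.2 * momentumForm z.1 (M.dEnergy z.1) (M.dEnergy z.1)) := by
  rw [momentumForm_dEnergy hM hz (hζ.1.differentiable two_ne_zero), momentumForm_dEnergy_self hM hz]
  rfl

lemma extΨstar_eq_vfpOperator (hγ : M.IsVlasovFokkerPlanck γ) {ζ : ExtSpace d}
    (hζ : ζ.1 ∈ M.core z.1) : M.extΨstar H₂ z ζ =
      ((1 / 2 * pairExt (M.vfpOperator γ z ζ) ζ : ℝ) : EReal) := by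
  have hmem : ζ.1 - ζ.2 • M.dEnergy z.1 ∈ M.cot z.1 :=
    (M.cot z.1).sub_mem hζ.1 ((M.cot z.1).smul_mem _ (dEnergy_mem hM hz))
  obtain ⟨hI, hfr⟩ := integral_mul_friction hM hz hζ.1
  have hv := integrable_pair hM hz (coreGradient_mem_tan hM hz hζ) hζ.1
  have hp : pair (M.vfpOperator γ z ζ).1 ζ.1 = 2 * γ * momentumForm z.1 ζ.1 ζ.1 -
      2 * γ * ζ.2 * momentumForm z.1 ζ.1 (M.dEnergy z.1) := by
    have e : ∀ x, ζ.1 x * (M.vfpOperator γ z ζ).1 x = ζ.1 x * M.coreGradient z.1 ζ.1 x +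
        2 * γ * ζ.2 * (ζ.1 x * ∑ i, dP i (fun y => z.1 y * (M.mass⁻¹ * y.2 i)) x) := fun x => by
      rw [vfpOperator_fst hz hζ.1.1, coreGradient_fokkerPlanck hM hz hγ hζ]
      ring
    rw [← pair_coreGradient_eq hM hz hγ hζ hζ.1]
    simp only [pair, e]
    rw [integral_add hv (hI.const_mul _), integral_const_mul, hfr]
    ring
  rw [extΨstar, Ψstar_fokkerPlanck hM hz hγ hmem, momentumForm_sub_smul_dEnergy hM hz hζ.1, pairExt,
    hp, vfpOperator_snd hM hz hζ.1]
  congr 1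
  ring

/-- The rate of change of the energy of the heat bath. -/
lemma extDrift_snd (hγ : M.IsVlasovFokkerPlanck γ) :
    (M.extDrift z).2 = γ * momentumForm z.1 (fun x => Real.log (z.1 x) + 1) (M.dEnergy z.1) +
      γ * momentumForm z.1 (M.dEnergy z.1) (M.dEnergy z.1) := by
  have hE := dEnergy_mem hM hz
  have hS := core_smul (dEntropy_mem_core hz) (-(1 / 2 : ℝ))
  have e : -(1 / 2 : ℝ) • M.dEntropy z.1 = -(1 / 2 : ℝ) •
      ((fun x => Real.log (z.1 x) + 1) + (1 : ℝ) • M.dEnergy z.1) := by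
    rw [one_smul]
    rfl
  have hl := log_mem_cot hM hz
  have hz0 := (M.cot z.1).zero_mem
  have hsum := (M.cot z.1).add_mem hl ((M.cot z.1).smul_mem (1 : ℝ) hE)
  have h0 := momentumForm_add_smul hM hz hz0 hsum hE (-(1 / 2))
  rw [zero_add, momentumForm_add_smul hM hz hl hE hE] at h0
  have h00 : momentumForm z.1 0 (M.dEnergy z.1) = 0 := by
    have := momentumForm_add_smul hM hz hz0 hz0 hE 1
    rw [smul_zero, add_zero] at this
    linarith
  simp only [extDrift]
  rw [pair_drift_dEnergy hM hz, pair_congr_left (adjointGen_ae_eq_coreGradient hM hz),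
    pair_coreGradient_eq hM hz hγ hS hE, e, h0, h00]
  ring

lemma extDrift_fst_ae_eq (hγ : M.IsVlasovFokkerPlanck γ) :
    (M.extDrift z).1 =ᵐ[volume] (extPoisson z (M.dExtEnergy z) -
      (1 / 2 : ℝ) • M.vfpOperator γ z (M.dExtEntropy z)).1 := by
  have hl := log_mem_cot hM hz
  have hS := core_smul (dEntropy_mem_core hz) (-(1 / 2 : ℝ))
  filter_upwards [adjointGen_ae_eq_coreGradient hM hz] with x hx
  have hzd := hz.smooth.differentiable two_ne_zero
  have hdd : ∀ i, Differentiable ℝ fun y => z.1 y * dP i (fun x => Real.log (z.1 x) + 1) y :=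
    fun i y => (hzd y).mul ((contDiff_one_dP hl.1 i).differentiable one_ne_zero y)
  have hfd : ∀ i, Differentiable ℝ fun y => z.1 y * (M.mass⁻¹ * y.2 i) :=
    fun i => (contDiff_friction hz.smooth M.mass⁻¹ i).differentiable two_ne_zero
  have e : ∀ i, dP i (fun y => z.1 y * dP i (-(1 / 2 : ℝ) • M.dEntropy z.1) y) x = -(1 / 2) *
      (dP i (fun y => z.1 y * dP i (fun x => Real.log (z.1 x) + 1) y) x +
        dP i (fun y => z.1 y * (M.mass⁻¹ * y.2 i)) x) := fun i => by
    rw [← dP_add (hdd i x) (hfd i x), ← dP_const_mul ((hdd i x).fun_add (hfd i x))]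
    congr 1
    funext y
    have h1 := dP_const_mul (hz.dEntropy_mem.1.differentiable two_ne_zero y) (-(1 / 2)) i
    have h2 := dP_dEntropy hM hz y i
    rw [show (-(1 / 2 : ℝ) • M.dEntropy z.1) = fun y => -(1 / 2) * M.dEntropy z.1 y from rfl, h1,
      dP_log_add_one hz, ← h2]
    ring
  simp only [extDrift, drift_eq hM hz, Pi.add_apply, hx, coreGradient_fokkerPlanck hM hz hγ hS,
    Prod.fst_sub, Prod.smul_fst, Pi.sub_apply, Pi.smul_apply, smul_eq_mul, dExtEntropy_eq, e]
  rw [vfpOperator_fst hz hl.1, ← Finset.mul_sum, Finset.sum_add_distrib]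
  simp only [extPoisson, dExtEnergy]
  ring

lemma extDrift_snd_eq (hγ : M.IsVlasovFokkerPlanck γ) :
    (M.extDrift z).2 = (extPoisson z (M.dExtEnergy z) -
      (1 / 2 : ℝ) • M.vfpOperator γ z (M.dExtEntropy z)).2 := by
  have hl := log_mem_cot hM hz
  rw [extDrift_snd hM hz hγ, dExtEntropy_eq, Prod.snd_sub, Prod.smul_snd,
    vfpOperator_snd hM hz hl, extPoisson, smul_eq_mul]
  ring

lemma extDrift_snd_explicit (hγ : M.IsVlasovFokkerPlanck γ) :
    (M.extDrift z).2 = γ * (∫ x, ‖M.mass⁻¹ • x.2‖ ^ 2 * z.1 x) - γ * d / M.mass := by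
  rw [extDrift_snd hM hz hγ, momentumForm_log_dEnergy hM hz, momentumForm_dEnergy_self hM hz]
  ring

end ExtendedFokkerPlanck

end Model

end Underdamped

end

theorem corollary5p5 {d : ℕ} (M : Model d) (H₂ : (X d → ℝ) → (X d → ℝ) → ℝ)
    (hM : M.Condition H₂) :
    -- the vector field and the dissipation potential are what they should be
    (∀ ρ, M.IsState ρ → M.IsAdjointImage ρ (M.adjointGen ρ)) ∧
    (∀ ρ, M.IsState ρ → ∀ ξ ∈ M.core ρ,
      M.Ψstar H₂ ρ ξ = (M.shiftedHamiltonian H₂ ρ ξ : EReal)) ∧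
    -- the extended dynamics is GENERIC
    IsGENERIC M.extStateSpace M.extEntropy M.extEnergy M.dExtEntropy M.dExtEnergy
      (M.extΨ H₂) (M.extΨstar H₂) extPoisson M.extDrift ∧
    -- the Vlasov-Fokker-Planck case
    (∀ γ : ℝ, 0 < γ → M.IsVlasovFokkerPlanck γ → ∀ z ∈ M.extStateSpace.points,
      M.extEntropy z = (∫ x, Real.log (z.1 x) * z.1 x) - z.2 ∧
      (∀ ζ ∈ M.extStateSpace.cot z, M.extΨstar H₂ z ζ =
        ((γ * ∫ x, ‖gradP ζ.1 x - ζ.2 • (M.mass⁻¹ • x.2)‖ ^ 2 * z.1 x : ℝ) : EReal)) ∧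
      (∀ ζ : ExtSpace d, ζ.1 ∈ M.core z.1 → M.extΨstar H₂ z ζ =
        ((1 / 2 * pairExt (M.vfpOperator γ z ζ) ζ : ℝ) : EReal)) ∧
      (M.extDrift z).1 =ᵐ[volume] (extPoisson z (M.dExtEnergy z) -
        (1 / 2 : ℝ) • M.vfpOperator γ z (M.dExtEntropy z)).1 ∧
      (M.extDrift z).2 = (extPoisson z (M.dExtEnergy z) -
        (1 / 2 : ℝ) • M.vfpOperator γ z (M.dExtEntropy z)).2 ∧
      (M.extDrift z).2 =
        γ * (∫ x, ‖M.mass⁻¹ • x.2‖ ^ 2 * z.1 x) - γ * d / M.mass) := by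
  refine ⟨fun ρ hρ => Model.isAdjointImage_adjointGen hM hρ,
    fun ρ hρ ξ hξ => Model.Ψstar_eq_shiftedHamiltonian hM hρ hξ, Model.isGENERIC hM,
    fun γ _ hγ z hz => ⟨Model.extEntropy_eq z,
      fun ζ hζ => Model.extΨstar_fokkerPlanck hM hz hγ hζ,
      fun ζ hζ => Model.extΨstar_eq_vfpOperator hM hz hγ hζ,
      Model.extDrift_fst_ae_eq hM hz hγ, Model.extDrift_snd_eq hM hz hγ,
      Model.extDrift_snd_explicit hM hz hγ⟩⟩
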